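/- Let $g\ge 1$, let $\pi_1$ be the free group on $\mathbf u_1,\mathbf v_1,\dots,\mathbf u_g,\mathbf v_g$ (the fundamental group of the surface $\Sigma_{g,1}$, based on its boundary), let $\partial=\prod_{i=1}^g[\mathbf u_i,\mathbf v_i]$ be its boundary class, and identify the mapping class group $\mathcal M_{g,1}$ with $\{f\in\mathrm{Aut}(\pi_1): f(\partial)=\partial\}$ (Dehn-Nielsen). The right-handed Dehn twist along the boundary is $T_\partial(\mathbf x)=\partial^{-1}\mathbf x\,\partial$. Let $H=H_1(\Sigma_{g,1};\mathbb Q)$ and $\widehat T=\prod_{n\ge0}H^{\otimes n}$, filtered by $\widehat T_p=\prod_{n\ge p}H^{\otimes n}$; let $IA(\widehat T)$ be the group of filtration-preserving algebra automorphisms of $\widehat T$ that act trivially on $\widehat T_1/\widehat T_2$. For $m\geq 1$, the $m$-th component of $U\in IA(\widehat T)$ is the degree $m+1$ part of $U|_H-\mathrm{id}_H$, an element of $\mathrm{Hom}(H,H^{\otimes(m+1)})$. A marked trivalent once-bordered fatgraph $G$ is a fatgraph with one univalent vertex, all other vertices trivalent, and one boundary cycle, which starts at the tail $\mathbf t$ (the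 edge pointing away from the univalent vertex) and continues from an oriented edge along the next edge in the cyclic order at its end; its oriented edges $\mathbf e$ are labelled by elements $\mathbf e\in\pi_1$ that generate $\pi_1$, with $\bar{\mathbf e}\,\mathbf e=1$, with $\mathbf e_1\mathbf e_2\mathbf e_3=1$ for the cyclically ordered edges pointing into a trivalent vertex, and with $\bar{\mathbf t}=\partial$. Define $\ell^G(\mathbf x)=\sum_{n\ge1}\ell^G_n(\mathbf x)$, with $\ell^G_n(\mathbf x)\in H^{\otimes n}$, by $\ell^G_1(\mathbf x)=[\mathbf x]$ and, for $n\ge2$, $$\ell_n^G(\mathbf x)=-\tfrac13\sum_{i=1}^k h\bigl(\ell^G(\mathbf f_{i-1}),-\ell^G(\mathbf f_i)\bigr)_{(n)},\qquad h(X,Y)=\log(\exp X\exp Y)-X-Y,$$ where $\mathbf f_0=\mathbf x,\dots,\mathbf f_k=\bar{\mathbf x}$ is the path along the boundary cycle, if this path does not pass through the univalent vertex, and $\ell_n^G(\mathbf x)=-\ell_n^G(\bar{\mathbf x})$ otherwise. The fatgraph Magnus expansion $\theta^G:\pi_1\to 1+\widehat T_1$ is the homomorphism with $\theta^G(\mathbf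 e)=\exp\ell^G(\mathbf e)$ for all oriented edges. For a Whitehead move $W:G\to G'$ let $\tau(W)=\theta^G\circ(\theta^{G'})^{-1}\in IA(\widehat T)$ be the element that takes $\theta^{G'}$ to $\theta^G$, with components $\tau_m(W)$; for $\varphi\in\mathcal M_{g,1}$ acting trivially on $H$ let $\tau^{\theta^G}(\varphi)=\theta^G\circ\varphi\circ(\theta^G)^{-1}\in IA(\widehat T)$ be the total Johnson map, with components $\tau_m(\varphi)$. Let $G_0$ be the symplectic fatgraph: for each $i$ it has a genus one piece with stem $\mathbf s_i$ and vertices with cyclic orders of incoming edges $(\bar{\mathbf p}_i,\mathbf u_i,\mathbf v_i)$, $(\bar{\mathbf q}_i,\bar{\mathbf u}_i,\bar{\mathbf v}_i)$ and $(\mathbf s_i,\mathbf p_i,\mathbf q_i)$, and the stems are joined in order to a line that ends in the tail by vertices $(\mathbf c_{k+1},\bar{\mathbf c}_k,\bar{\mathbf s}_{k+1})$ for $1\le k<g$, where $\mathbf c_1=\mathbf s_1$ and $\mathbf c_g=\mathbf t$; here $\mathbf u_i,\mathbf v_i$ are edges labelled by the generators of the same name. Let $G_0\to G_1\to\dots\to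 G_N$, $N=12g-6$, be the Whitehead moves, each along the edge that follows the tail in the cyclic order at its trivalent end, which move the tail once around the fatgraph. Then: the expansions $\theta^{G_i}$ exist, are unique and are generalized Magnus expansions; the maps $\tau(W_i)$ (for $W_i:G_{i-1}\to G_i$) and $\tau^{\theta^{G_0}}(T_\partial)$ exist and are unique in $IA(\widehat T)$; the sequence represents the boundary twist, that is, $G_N\cong T_\partial(G_0)$ as marked fatgraphs; and the third component of the total Johnson map of $T_\partial$ with respect to $\theta^{G_0}$ satisfies $$\tau_3(T_\partial)=\sum_{i=1}^{N}\tau_3(W_i)=0 .$$ -/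

import Mathlib

open scoped TensorProduct

noncomputable section

namespace FatgraphJohnson

/-! ### The completed tensor algebra -/

section Tensors

/-- The rational first homology `H = ℚ ⊗ πᵃᵇ` of a group `π`. -/
abbrev RatH (π : Type) [Group π] : Type := ℚ ⊗[ℤ] Additive (Abelianization π)

/-- The class `[x] ∈ H` of a group element. -/
def homClass {π : Type} [Group π] (x : π) : RatH π :=
  (1 : ℚ) ⊗ₜ[ℤ] Additive.ofMul (Abelianization.of x)

variable (H : Type) [AddCommGroup H] [Module ℚ H]

/-- The `n`-th tensor power of `H`, as the degree `n` part of the tensor algebra. -/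
abbrev TPow (n : ℕ) : Submodule ℚ (TensorAlgebra ℚ H) :=
  LinearMap.range (TensorAlgebra.ι ℚ : H →ₗ[ℚ] TensorAlgebra ℚ H) ^ n

/-- The completed tensor algebra `∏ₙ H^{⊗n}`: sequences `(aₙ)` with `aₙ ∈ H^{⊗n}`, written as
power series `∑ aₙ Xⁿ`, with the product `(ab)ₙ = ∑_{i+j=n} aᵢ ⊗ bⱼ`. -/
def That : Subalgebra ℚ (PowerSeries (TensorAlgebra ℚ H)) where
  carrier := {f | ∀ n, PowerSeries.coeff n f ∈ TPow H n}
  mul_mem' := by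
    intro f g hf hg n
    rw [PowerSeries.coeff_mul]
    refine Submodule.sum_mem _ fun p hp => ?_
    rw [← Finset.HasAntidiagonal.mem_antidiagonal.mp hp, TPow, pow_add]
    exact Submodule.mul_mem_mul (hf _) (hg _)
  add_mem' := by
    intro f g hf hg n
    rw [map_add]
    exact Submodule.add_mem _ (hf n) (hg n)
  algebraMap_mem' := by
    intro r n
    rw [PowerSeries.algebraMap_apply, PowerSeries.coeff_C]
    split_ifs with h
    · subst h
      rw [TPow, pow_zero]
      exact Submodule.algebraMap_mem r
    · exact Submodule.zero_mem _

variable {H}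

/-- The degree `n` component of an element of the completed tensor algebra. -/
def comp (n : ℕ) : That H →ₗ[ℚ] TPow H n where
  toFun f := ⟨PowerSeries.coeff n f.1, f.2 n⟩
  map_add' f g := by ext; simp
  map_smul' r f := by ext; simp

/-- The element of the completed tensor algebra with prescribed components. -/
def ofComp (a : ∀ n, TPow H n) : That H :=
  ⟨PowerSeries.mk fun n => (a n : TensorAlgebra ℚ H), fun n => by
    rw [PowerSeries.coeff_mk]; exact (a n).2⟩

/-- `H^{⊗n}` as a direct factor of the completed tensor algebra. -/
def incl (n : ℕ) (a : TPow H n) : That H := ofComp (Pi.single n a)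

/-- The inclusion of `H` as the degree one part. -/
def inclH : H →ₗ[ℚ] That H where
  toFun x := incl 1 ⟨TensorAlgebra.ι ℚ x, by rw [TPow, pow_one]; exact LinearMap.mem_range_self _ x⟩
  map_add' x y := by
    apply Subtype.ext
    ext k
    rcases eq_or_ne k 1 with rfl | h
    · simp [incl, ofComp]
    · simp [incl, ofComp, h]
  map_smul' r x := by
    apply Subtype.ext
    ext k
    rcases eq_or_ne k 1 with rfl | h
    · simp [incl, ofComp]
    · simp [incl, ofComp, h]

/-- The filtration ideal `∏_{n ≥ p} H^{⊗n}`, as a set. -/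
def filt (H : Type) [AddCommGroup H] [Module ℚ H] (p : ℕ) : Set (That H) :=
  {f | ∀ n < p, comp n f = 0}

/-- `exp X = ∑ Xⁿ / n!`, for `X` without constant term (so that the sum is finite in each
degree). -/
def texp (X : That H) : That H :=
  ofComp fun k => ∑ n ∈ Finset.range (k + 1), ((n.factorial : ℚ)⁻¹) • comp k (X ^ n)

/-- `log Z = ∑_{n ≥ 1} (-1)^{n+1} (Z - 1)ⁿ / n`, for `Z` with constant term `1`. -/
def tlog (Z : That H) : That H :=
  ofComp fun k => ∑ n ∈ Finset.Icc 1 k, ((-1 : ℚ) ^ (n + 1) / n) • comp k ((Z - 1) ^ n)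

/-- The nonlinear part `h(X, Y) = log (exp X exp Y) - X - Y` of the Hausdorff series. -/
def haus (X Y : That H) : That H := tlog (texp X * texp Y) - X - Y

/-- `U ∈ IA(T̂)`: a filtration-preserving algebra automorphism which is the identity on the
quotient of the first filtration ideal by the second. -/
structure IsIA (U : That H ≃ₐ[ℚ] That H) : Prop where
  filt_iff : ∀ p f, U f ∈ filt H p ↔ f ∈ filt H p
  trivial_gr : ∀ f ∈ filt H 1, U f - f ∈ filt H 2

/-- The component in `Hom(H, H^{⊗(m+1)})` of `U`, under `U ↦ U|_H - id_H` (for `m ≥ 1`). -/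
def johnsonComponent (m : ℕ) (U : That H ≃ₐ[ℚ] That H) : H →ₗ[ℚ] TPow H (m + 1) :=
  comp (m + 1) ∘ₗ (U.toLinearMap - LinearMap.id) ∘ₗ inclH

end Tensors

/-! ### Generalized Magnus expansions and Johnson maps -/

section Magnus

variable {π : Type} [Group π]

/-- A generalized Magnus expansion: a homomorphism `θ` with `θ(x) = 1 + [x] + ⋯`. -/
structure IsMagnusExpansion (θ : π →* That (RatH π)) : Prop where
  zero : ∀ x, θ x - 1 ∈ filt (RatH π) 1
  one : ∀ x, θ x - 1 - inclH (homClass x) ∈ filt (RatH π) 2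

/-- `U` is an element of `IA(T̂)` with `U ∘ θ' = θ`. -/
def IsTransition (θ θ' : π →* That (RatH π)) (U : That (RatH π) ≃ₐ[ℚ] That (RatH π)) : Prop :=
  IsIA U ∧ ∀ x, U (θ' x) = θ x

/-- The element `θ ∘ θ'⁻¹` of `IA(T̂)` which takes the Magnus expansion `θ'` to `θ`. -/
def transition (θ θ' : π →* That (RatH π)) : That (RatH π) ≃ₐ[ℚ] That (RatH π) :=
  Classical.epsilon (IsTransition θ θ')

/-- The expansion `θ ∘ φ`. The total Johnson map `θ ∘ φ ∘ θ⁻¹` of `φ` is the transition that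
takes `θ` to `θ ∘ φ`. -/
def twist (θ : π →* That (RatH π)) (φ : MulAut π) : π →* That (RatH π) := θ.comp φ.toMonoidHom

/-- The total Johnson map `θ ∘ φ ∘ θ⁻¹` of an automorphism `φ`, with respect to `θ`. -/
def totalJohnson (θ : π →* That (RatH π)) (φ : MulAut π) : That (RatH π) ≃ₐ[ℚ] That (RatH π) :=
  transition (twist θ φ) θ

end Magnus

/-! ### Trivalent bordered fatgraphs -/

/-- A trivalent once-bordered fatgraph on a set `E` of oriented edges: `bar` reverses an edge;
`vert e` is the edge following `e` in the cyclic order of the edges that point into the end vertex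
of `e`; the tail points away from the only univalent vertex; and the boundary cycle from the tail,
which goes on from `e` along the reverse of `vert e`, runs through all oriented edges. -/
structure Fatgraph (E : Type) where
  bar : E → E
  vert : E → E
  tail : E
  bar_bar : ∀ e, bar (bar e) = e
  bar_ne : ∀ e, bar e ≠ e
  univalent : vert (bar tail) = bar tail
  trivalent : ∀ e, e ≠ bar tail → vert (vert (vert e)) = e ∧ vert e ≠ e
  boundary : ∀ e, ∃ k : ℕ, (fun x => bar (vert x))^[k] tail = e

namespace Fatgraph

variable {E : Type} (G : Fatgraph E)

/-- The successor of an oriented edge in the boundary cycle. -/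
def face (x : E) : E := G.bar (G.vert x)

/-- The position of an oriented edge in the boundary cycle, the tail having position `0`. -/
def pos (x : E) : ℕ := sInf {k : ℕ | G.face^[k] G.tail = x}

end Fatgraph

/-- A trivalent bordered fatgraph with a `π`-marking, for a group `π` with a boundary
element `δ`. -/
structure MarkedFatgraph (E : Type) (π : Type) [Group π] (δ : π) extends Fatgraph E where
  mark : E → π
  mark_bar : ∀ e, mark (bar e) * mark e = 1
  mark_vert : ∀ e, e ≠ bar tail → mark e * mark (vert e) * mark (vert (vert e)) = 1
  full_rank : Subgroup.closure (Set.range mark) = ⊤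
  geometric : mark (bar tail) = δ

namespace Fatgraph

variable {E : Type} (G : Fatgraph E)

theorem bar_inj {x y : E} (h : G.bar x = G.bar y) : x = y := by
  rw [← G.bar_bar x, h, G.bar_bar]

theorem vert_ne_tail {x : E} (h : x ≠ G.bar G.tail) : G.vert x ≠ G.bar G.tail := by
  intro hx
  have h3 := (G.trivalent x h).1
  rw [hx, G.univalent, G.univalent] at h3
  exact h h3.symm

theorem vert_inj {x y : E} (h : G.vert x = G.vert y) : x = y := by
  by_cases hx : x = G.bar G.tail
  · by_cases hy : y = G.bar G.tail
    · rw [hx, hy]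
    · exact absurd (h.symm.trans (by rw [hx, G.univalent])) (G.vert_ne_tail hy)
  · by_cases hy : y = G.bar G.tail
    · exact absurd (h.trans (by rw [hy, G.univalent])) (G.vert_ne_tail hx)
    · rw [← (G.trivalent x hx).1, h, (G.trivalent y hy).1]

/-- The endpoints of the edge underlying `e` are distinct trivalent vertices. -/
structure Movable (e : E) : Prop where
  ne_tail : e ≠ G.tail
  ne_bar_tail : e ≠ G.bar G.tail
  distinct₁ : G.vert e ≠ G.bar e
  distinct₂ : G.vert (G.vert e) ≠ G.bar e

/-- The edge that follows the tail at the trivalent end of the tail. -/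
def nextToTail : E := G.vert G.tail

theorem movable_nextToTail : G.Movable G.nextToTail := by
  have ht : G.tail ≠ G.bar G.tail := (G.bar_ne _).symm
  obtain ⟨h3, h1⟩ := G.trivalent _ ht
  refine ⟨h1, G.vert_ne_tail ht, ?_, ?_⟩
  · intro h
    have hf : G.bar (G.vert (G.vert G.tail)) = G.vert G.tail := by
      have := h; unfold nextToTail at this
      rw [this, G.bar_bar]
    have key : ∀ k : ℕ, (fun x => G.bar (G.vert x))^[k] G.tail = G.vert G.tail → False := by
      intro k
      induction k with
      | zero => intro hk; exact h1 hk.symm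
      | succ k ih =>
        intro hk
        rw [Function.iterate_succ_apply'] at hk
        exact ih (G.vert_inj (G.bar_inj (hk.trans hf.symm)))
    obtain ⟨k, hk⟩ := G.boundary (G.vert G.tail)
    exact key k hk
  · intro h
    unfold nextToTail at h
    rw [h3] at h
    apply G.vert_ne_tail ht
    rw [← G.bar_bar (G.vert G.tail), ← h]

end Fatgraph

namespace MarkedFatgraph

open Classical in
/-- The cyclic orders after a Whitehead move: with `(a, b, e)` and `(c, d, ē)` the cyclic orders
at the two ends of the edge, they become `(b, c, e)` and `(d, a, ē)`. -/
def whVert {E : Type} (G : Fatgraph E) (e : E) (x : E) : E :=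
  let a := G.vert e
  let b := G.vert a
  let c := G.vert (G.bar e)
  let d := G.vert c
  if x = b then c else if x = c then e else if x = e then b
  else if x = d then a else if x = a then G.bar e else if x = G.bar e then d
  else G.vert x

open Classical in
/-- The marking after a Whitehead move: only the label of the moved edge changes. -/
def whMark {E π : Type} [Group π] {δ : π} (G : MarkedFatgraph E π δ) (e : E) (x : E) : π :=
  let b := G.vert (G.vert e)
  let c := G.vert (G.bar e)
  if x = e then (G.mark b * G.mark c)⁻¹ else if x = G.bar e then G.mark b * G.mark c
  else G.mark x

section Whitehead

variable {E π : Type} [Group π] {δ : π} (G : MarkedFatgraph E π δ) {e : E}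

theorem wh_trivalent (he : G.Movable e) (x : E) (hx : x ≠ G.bar G.tail) :
    whVert G.toFatgraph e (whVert G.toFatgraph e (whVert G.toFatgraph e x)) = x ∧
      whVert G.toFatgraph e x ≠ x := by
  obtain ⟨h1, h2, h3, h4⟩ := he
  have h2' : G.bar e ≠ G.bar G.tail := fun h => h1 (G.bar_inj h)
  have tr := G.trivalent
  have inj : ∀ x y, G.vert x = G.vert y → x = y := fun _ _ => G.vert_inj
  have bn := G.bar_ne e
  obtain ⟨e1, e2⟩ := tr e h2
  obtain ⟨f1, f2⟩ := tr _ h2'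
  obtain ⟨x1, x2⟩ := tr x hx
  simp only [whVert]
  grind

theorem wh_univalent (he : G.Movable e) :
    whVert G.toFatgraph e (G.bar G.tail) = G.bar G.tail := by
  obtain ⟨h1, h2, h3, h4⟩ := he
  have h2' : G.bar e ≠ G.bar G.tail := fun h => h1 (G.bar_inj h)
  have a1 := G.vert_ne_tail h2
  have a2 := G.vert_ne_tail a1
  have a3 := G.vert_ne_tail h2'
  have a4 := G.vert_ne_tail a3
  simp only [whVert, G.univalent]
  grind

theorem wh_mark_vert (he : G.Movable e) (x : E) (hx : x ≠ G.bar G.tail) :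
    whMark G e x * whMark G e (whVert G.toFatgraph e x) *
      whMark G e (whVert G.toFatgraph e (whVert G.toFatgraph e x)) = 1 := by
  obtain ⟨h1, h2, h3, h4⟩ := he
  have h2' : G.bar e ≠ G.bar G.tail := fun h => h1 (G.bar_inj h)
  have bn := G.bar_ne e
  have inj : ∀ x y, G.vert x = G.vert y → x = y := fun _ _ => G.vert_inj
  obtain ⟨e1, e2⟩ := G.trivalent e h2
  obtain ⟨f1, f2⟩ := G.trivalent _ h2'
  obtain ⟨x1, x2⟩ := G.trivalent x hx
  have m1 : G.mark e * G.mark (G.vert e) * G.mark (G.vert (G.vert e)) = 1 := G.mark_vert e h2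
  have m2 := G.mark_vert _ h2'
  have m3 := G.mark_bar e
  have mx := G.mark_vert x hx
  generalize ha : G.vert e = a at *
  generalize hb : G.vert a = b at *
  generalize hc : G.vert (G.bar e) = c at *
  generalize hd : G.vert c = d at *
  have r1 : G.mark b * G.mark c * (G.mark b * G.mark c)⁻¹ = 1 := mul_inv_cancel _
  have r2 : G.mark d * G.mark a * (G.mark b * G.mark c) = 1 := by
    have q1 : G.mark a * G.mark b = (G.mark e)⁻¹ := by
      rw [mul_assoc] at m1; exact eq_inv_of_mul_eq_one_right m1
    have q2 : G.mark c * G.mark d = G.mark e := by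
      rw [mul_assoc] at m2
      rw [eq_inv_of_mul_eq_one_right m2, eq_inv_of_mul_eq_one_left m3, inv_inv]
    have q3 : G.mark c * G.mark d * (G.mark a * G.mark b) = 1 := by rw [q1, q2, mul_inv_cancel]
    calc G.mark d * G.mark a * (G.mark b * G.mark c)
        = (G.mark c)⁻¹ * (G.mark c * G.mark d * (G.mark a * G.mark b)) * G.mark c := by group
      _ = 1 := by rw [q3]; group
  have v1 : whVert G.toFatgraph e b = c := by simp only [whVert]; grind
  have v2 : whVert G.toFatgraph e c = e := by simp only [whVert]; grind
  have v3 : whVert G.toFatgraph e e = b := by simp only [whVert]; grind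
  have v4 : whVert G.toFatgraph e d = a := by simp only [whVert]; grind
  have v5 : whVert G.toFatgraph e a = G.bar e := by simp only [whVert]; grind
  have v6 : whVert G.toFatgraph e (G.bar e) = d := by simp only [whVert]; grind
  have n1 : whMark G e e = (G.mark b * G.mark c)⁻¹ := by simp only [whMark]; grind
  have n2 : whMark G e (G.bar e) = G.mark b * G.mark c := by simp only [whMark]; grind
  have n3 : ∀ y, y ≠ e → y ≠ G.bar e → whMark G e y = G.mark y := by
    intro y hy hy'; simp only [whMark, if_neg hy, if_neg hy']
  have na := n3 a (by grind) (by grind)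
  have nb := n3 b (by grind) (by grind)
  have nc := n3 c (by grind) (by grind)
  have nd := n3 d (by grind) (by grind)
  have rot : ∀ p q r : π, p * q * r = 1 → q * r * p = 1 := by
    intro p q r h
    rw [mul_assoc] at h
    exact mul_eq_one_comm.mp h
  by_cases c1 : x = b
  · rw [c1, v1, v2, nb, nc, n1]; exact r1
  by_cases c2 : x = c
  · rw [c2, v2, v3, nb, nc, n1]; exact rot _ _ _ r1
  by_cases c3 : x = e
  · rw [c3, v3, v1, nb, nc, n1]; exact rot _ _ _ (rot _ _ _ r1)
  by_cases c4 : x = d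
  · rw [c4, v4, v5, nd, na, n2]; exact r2
  by_cases c5 : x = a
  · rw [c5, v5, v6, nd, na, n2]; exact rot _ _ _ r2
  by_cases c6 : x = G.bar e
  · rw [c6, v6, v4, nd, na, n2]; exact rot _ _ _ (rot _ _ _ r2)
  have w1 : whVert G.toFatgraph e x = G.vert x := by simp only [whVert]; grind
  have w2 : whVert G.toFatgraph e (G.vert x) = G.vert (G.vert x) := by simp only [whVert]; grind
  rw [w1, w2, n3 x c3 c6, n3 _ (by grind) (by grind), n3 _ (by grind) (by grind)]
  exact mx

theorem wh_boundary (he : G.Movable e) (x : E) :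
    ∃ k : ℕ, (fun x => G.bar (whVert G.toFatgraph e x))^[k] G.tail = x := by
  obtain ⟨h1, h2, h3, h4⟩ := he
  have h2' : G.bar e ≠ G.bar G.tail := fun h => h1 (G.bar_inj h)
  have bn := G.bar_ne e
  have bb := G.bar_bar
  have inj : ∀ x y, G.vert x = G.vert y → x = y := fun _ _ => G.vert_inj
  have binj : ∀ x y, G.bar x = G.bar y → x = y := fun _ _ => G.bar_inj
  obtain ⟨e1, e2⟩ := G.trivalent e h2
  obtain ⟨f1, f2⟩ := G.trivalent _ h2'
  have hbd := G.boundary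
  generalize ha : G.vert e = a at *
  generalize hb : G.vert a = b at *
  generalize hc : G.vert (G.bar e) = c at *
  generalize hd : G.vert c = d at *
  have v1 : whVert G.toFatgraph e b = c := by simp only [whVert]; grind
  have v2 : whVert G.toFatgraph e c = e := by simp only [whVert]; grind
  have v3 : whVert G.toFatgraph e e = b := by simp only [whVert]; grind
  have v4 : whVert G.toFatgraph e d = a := by simp only [whVert]; grind
  have v5 : whVert G.toFatgraph e a = G.bar e := by simp only [whVert]; grind
  have v6 : whVert G.toFatgraph e (G.bar e) = d := by simp only [whVert]; grind
  have w : ∀ y, y ≠ a → y ≠ b → y ≠ c → y ≠ d → y ≠ e → y ≠ G.bar e →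
      whVert G.toFatgraph e y = G.vert y := by
    intro y _ _ _ _ _ _; simp only [whVert]; grind
  set F : E → E := fun x => G.bar (whVert G.toFatgraph e x) with hF
  have hstep : ∀ y z, (∃ k : ℕ, F^[k] G.tail = y) → F y = z → ∃ k : ℕ, F^[k] G.tail = z := by
    rintro y z ⟨k, hk⟩ hz
    exact ⟨k + 1, by rw [Function.iterate_succ_apply', hk, hz]⟩
  have Fa : F a = e := by simp only [hF, v5, bb]
  have Fe : F e = G.bar b := by simp only [hF, v3]
  have Fc : F c = G.bar e := by simp only [hF, v2]
  have Fe' : F (G.bar e) = G.bar d := by simp only [hF, v6]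
  have Fb : F b = G.bar c := by simp only [hF, v1]
  have Fd : F d = G.bar a := by simp only [hF, v4]
  have main : ∀ k : ℕ, ∀ y, (fun x => G.bar (G.vert x))^[k] G.tail = y →
      (y ≠ e → y ≠ G.bar e → ∃ m : ℕ, F^[m] G.tail = y) ∧
      (y = e → ∃ m : ℕ, F^[m] G.tail = d) ∧ (y = G.bar e → ∃ m : ℕ, F^[m] G.tail = b) := by
    intro k
    induction k with
    | zero =>
      intro y hy
      rw [Function.iterate_zero, id] at hy
      refine ⟨fun _ _ => ⟨0, hy⟩, fun h => absurd (h.symm.trans hy.symm) h1, fun h => ?_⟩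
      exact absurd (by rw [hy, h, bb]) h2
    | succ k ih =>
      intro y hy
      rw [Function.iterate_succ_apply'] at hy
      obtain ⟨i1, i2, i3⟩ := ih _ rfl
      generalize (fun x => G.bar (G.vert x))^[k] G.tail = z at *
      refine ⟨fun y1 y2 => ?_, fun y1 => ?_, fun y1 => ?_⟩
      · by_cases ze : z = e
        · exact hstep d y (i2 ze) (by rw [Fd]; grind)
        by_cases ze' : z = G.bar e
        · exact hstep b y (i3 ze') (by rw [Fb]; grind)
        have hz := i1 ze ze'
        by_cases za : z = a
        · exact hstep e y (hstep a e (za ▸ hz) Fa) (by rw [Fe]; grind)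
        by_cases zc : z = c
        · exact hstep _ y (hstep c _ (zc ▸ hz) Fc) (by rw [Fe']; grind)
        by_cases zb : z = b
        · exfalso; grind
        by_cases zd : z = d
        · exfalso; grind
        exact hstep z y hz (by simp only [hF]; rw [w z za zb zc zd ze ze']; exact hy)
      · have zd : z = d := by grind
        exact zd ▸ i1 (by grind) (by grind)
      · have zb : z = b := by grind
        exact zb ▸ i1 (by grind) (by grind)
  have reach : ∀ y, y ≠ e → y ≠ G.bar e → ∃ m : ℕ, F^[m] G.tail = y := by
    intro y y1 y2
    obtain ⟨k, hk⟩ := hbd y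
    exact (main k y hk).1 y1 y2
  by_cases xe : x = e
  · exact hstep a x (reach a (by grind) (by grind)) (by rw [Fa, xe])
  by_cases xe' : x = G.bar e
  · exact hstep c x (reach c (by grind) (by grind)) (by rw [Fc, xe'])
  exact reach x xe xe'

theorem wh_full_rank (he : G.Movable e) :
    Subgroup.closure (Set.range (whMark G e)) = ⊤ := by
  obtain ⟨h1, h2, h3, h4⟩ := he
  have h2' : G.bar e ≠ G.bar G.tail := fun h => h1 (G.bar_inj h)
  have bn := G.bar_ne e
  obtain ⟨e1, e2⟩ := G.trivalent e h2
  have n3 : ∀ y, y ≠ e → y ≠ G.bar e → whMark G e y = G.mark y := by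
    intro y hy hy'; simp only [whMark, if_neg hy, if_neg hy']
  have hin : ∀ y, y ≠ e → y ≠ G.bar e →
      G.mark y ∈ Subgroup.closure (Set.range (whMark G e)) := by
    intro y hy hy'
    rw [← n3 y hy hy']
    exact Subgroup.subset_closure ⟨y, rfl⟩
  have he' : G.mark e ∈ Subgroup.closure (Set.range (whMark G e)) := by
    have m1 := G.mark_vert e h2
    rw [mul_assoc] at m1
    rw [eq_inv_of_mul_eq_one_left m1]
    refine Subgroup.inv_mem _ (Subgroup.mul_mem _ (hin _ e2 h3) (hin _ ?_ h4))
    grind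
  rw [eq_top_iff, ← G.full_rank, Subgroup.closure_le]
  rintro _ ⟨y, rfl⟩
  by_cases hy : y = e
  · rw [hy]; exact he'
  by_cases hy' : y = G.bar e
  · rw [hy', eq_inv_of_mul_eq_one_left (G.mark_bar e)]
    exact Subgroup.inv_mem _ he'
  exact hin y hy hy'

/-- The Whitehead move along the edge `e` with distinct trivalent end vertices: the edge is
collapsed, and the resulting four-valent vertex is expanded in the other way. The new edge keeps
the names `e`, `ē`; all other edges keep their names and labels. -/
def whitehead (G : MarkedFatgraph E π δ) (e : E) (he : G.Movable e) : MarkedFatgraph E π δ where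
  bar := G.bar
  vert := whVert G.toFatgraph e
  tail := G.tail
  bar_bar := G.bar_bar
  bar_ne := G.bar_ne
  univalent := wh_univalent G he
  trivalent := wh_trivalent G he
  boundary := wh_boundary G he
  mark := whMark G e
  mark_bar := by
    intro x
    have := G.mark_bar x
    have bb := G.bar_bar
    have bn := G.bar_ne
    simp only [whMark]
    by_cases h : x = e
    · subst h; simp [bn]
    by_cases h' : x = G.bar e
    · subst h'; simp [bn, bb]
    rw [if_neg h, if_neg h', if_neg, if_neg, this]
    · intro h0; exact h (G.bar_inj h0)
    · intro h0; exact h' (by rw [← h0, bb])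
  mark_vert := wh_mark_vert G he
  full_rank := wh_full_rank G he
  geometric := by
    obtain ⟨h1, h2, h3, h4⟩ := he
    have h2' : G.bar G.tail ≠ G.bar e := fun h => h1 (G.bar_inj h).symm
    simp only [whMark, if_neg h2.symm, if_neg h2', G.geometric]

end Whitehead

/-- The Whitehead move along the edge next to the tail, which moves the tail by one step around
the fatgraph. -/
def moveTail {E π : Type} [Group π] {δ : π} (G : MarkedFatgraph E π δ) : MarkedFatgraph E π δ :=
  whitehead G G.nextToTail G.movable_nextToTail

/-- Isomorphism of marked fatgraphs. -/
def Iso {E E' π : Type} [Group π] {δ : π} (G : MarkedFatgraph E π δ)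
    (G' : MarkedFatgraph E' π δ) : Prop :=
  ∃ σ : E ≃ E', (∀ x, σ (G.bar x) = G'.bar (σ x)) ∧ (∀ x, σ (G.vert x) = G'.vert (σ x)) ∧
    σ G.tail = G'.tail ∧ ∀ x, G'.mark (σ x) = G.mark x

/-- The marked fatgraph `φ(G)`, for an automorphism `φ` which fixes the boundary element. -/
def act {E π : Type} [Group π] {δ : π} (φ : MulAction.stabilizer (MulAut π) δ)
    (G : MarkedFatgraph E π δ) : MarkedFatgraph E π δ where
  toFatgraph := G.toFatgraph
  mark x := φ.1 (G.mark x)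
  mark_bar x := by rw [← map_mul, G.mark_bar, map_one]
  mark_vert x hx := by rw [← map_mul, ← map_mul, G.mark_vert x hx, map_one]
  full_rank := by
    have h : Set.range (fun x => φ.1 (G.mark x)) = (φ.1.toMonoidHom) '' Set.range G.mark := by
      rw [← Set.range_comp]; rfl
    rw [h, ← MonoidHom.map_closure, G.full_rank, ← MonoidHom.range_eq_map]
    exact MonoidHom.range_eq_top.mpr φ.1.surjective
  geometric := by rw [G.geometric]; exact φ.2

/-! ### The fatgraph Magnus expansion -/

section Expansion

variable {E π : Type} [Group π] {δ : π} (G : MarkedFatgraph E π δ)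

/-- `-1/3 ∑ᵢ h(L(fᵢ₋₁), -L(fᵢ))` over the path from `x` to its reverse along the boundary cycle,
if this path avoids the tail, that is, if `x` comes before its reverse in the boundary cycle that
starts at the tail; otherwise the negative of the same sum for the reverse of `x`. -/
def pathSum (L : E → That (RatH π)) (x : E) : That (RatH π) :=
  let S : E → That (RatH π) := fun y =>
    (-(1 / 3) : ℚ) • ∑ i ∈ Finset.range (G.pos (G.bar y) - G.pos y),
      haus (L (G.face^[i] y)) (-L (G.face^[i + 1] y))
  if G.pos x < G.pos (G.bar x) then S x else -S (G.bar x)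

/-- The terms of degree at most `n` of `ℓ(x)`: the term of degree one is the homology class of the
label of `x`, and the term of degree `n ≥ 2` is the degree `n` part of the sum over the edge
path, which only involves terms of lower degree. -/
def ellUpTo : ℕ → E → That (RatH π)
  | 0, _ => 0
  | 1, x => inclH (homClass (G.mark x))
  | n + 2, x => ellUpTo (n + 1) x + incl (n + 2) (comp (n + 2) (pathSum G (ellUpTo (n + 1)) x))

/-- The logarithm `ℓ(x)` of the fatgraph Magnus expansion on the oriented edges. -/
def ell (x : E) : That (RatH π) := ofComp fun n => comp n (ellUpTo G n x)

/-- `θ` extends `x ↦ exp (ℓ(x))` from the oriented edges to `π`. -/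
def IsFatgraphExpansion (θ : π →* That (RatH π)) : Prop :=
  ∀ x : E, θ (G.mark x) = texp (ell G x)

/-- The fatgraph Magnus expansion of `G`: the extension of `x ↦ exp (ℓ(x))` to `π`. -/
def magnus : π →* That (RatH π) := Classical.epsilon (IsFatgraphExpansion G)

end Expansion

/-- The fatgraph Johnson map of a move from `G` to `G'`, the element of `IA(T̂)` which takes the
fatgraph Magnus expansion of `G'` to that of `G`. -/
def fatgraphJohnson {E E' π : Type} [Group π] {δ : π} (G : MarkedFatgraph E π δ)
    (G' : MarkedFatgraph E' π δ) : That (RatH π) ≃ₐ[ℚ] That (RatH π) :=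
  transition (magnus G) (magnus G')

end MarkedFatgraph

/-! ### The surface of genus `n + 1` with one boundary component -/

section Surface

/-- The fundamental group of the surface of genus `n + 1` with one boundary component, which is
free on the standard symplectic generators `uᵢ` and `vᵢ`. -/
abbrev SurfaceGroup (n : ℕ) : Type := FreeGroup (Fin (n + 1) ⊕ Fin (n + 1))

/-- The generator `uᵢ`. -/
def genU {n : ℕ} (i : Fin (n + 1)) : SurfaceGroup n := FreeGroup.of (Sum.inl i)

/-- The generator `vᵢ`. -/
def genV {n : ℕ} (i : Fin (n + 1)) : SurfaceGroup n := FreeGroup.of (Sum.inr i)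

/-- The commutator `[uᵢ, vᵢ] = uᵢ vᵢ uᵢ⁻¹ vᵢ⁻¹`. -/
def genComm {n : ℕ} (i : Fin (n + 1)) : SurfaceGroup n := genU i * genV i * (genU i)⁻¹ * (genV i)⁻¹

/-- The product `[u₀, v₀] [u₁, v₁] ⋯` of the first `k` commutators. -/
def partialBoundary (n k : ℕ) : SurfaceGroup n :=
  ((List.ofFn fun i : Fin (n + 1) => (genComm i : SurfaceGroup n)).take k).prod

/-- The class of the boundary, the product of all commutators `[uᵢ, vᵢ]`. -/
def boundaryClass (n : ℕ) : SurfaceGroup n :=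
  (List.ofFn fun i : Fin (n + 1) => (genComm i : SurfaceGroup n)).prod

/-- The mapping class group of the surface relative to its boundary, in its Dehn-Nielsen form: the
automorphisms of the fundamental group (based on the boundary) that fix the boundary class. -/
abbrev MappingClassGroup (n : ℕ) : Type :=
  MulAction.stabilizer (MulAut (SurfaceGroup n)) (boundaryClass n)

/-- The right-handed Dehn twist along the boundary: it drags a loop based on the boundary once
around the boundary, so it acts as `x ↦ δ⁻¹ x δ`, where `δ` is the boundary class. -/
def boundaryTwist (n : ℕ) : MappingClassGroup n :=
  ⟨MulAut.conj (boundaryClass n)⁻¹, by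
    rw [MulAction.mem_stabilizer_iff, MulAut.smul_def, MulAut.conj_apply]; group⟩

/-- The edges of the symplectic fatgraph. Each of the `n + 1` genus one pieces has edges
`x, y, p, q`. The edge `c i` separates the pieces `0, …, i` from the tail (and `c (last)` is the
tail itself); the edge `s j` is the stem of the piece `j + 1`. The stem of the piece `0` is
`c 0`. -/
inductive Edge (n : ℕ) : Type
  | x (i : Fin (n + 1))
  | y (i : Fin (n + 1))
  | p (i : Fin (n + 1))
  | q (i : Fin (n + 1))
  | c (i : Fin (n + 1))
  | s (j : Fin n)

/-- The cyclic orders of the symplectic fatgraph. Each genus one piece has the three vertices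
`(p̄, x, y)`, `(q̄, x̄, ȳ)` and `(stem, p, q)`; these are joined by the vertices
`(c (j + 1), c̄ j, s̄ j)`. -/
def symVert {n : ℕ} : Edge n × Bool → Edge n × Bool
  | (.x i, true) => (.y i, true)
  | (.y i, true) => (.p i, false)
  | (.p i, false) => (.x i, true)
  | (.x i, false) => (.y i, false)
  | (.y i, false) => (.q i, false)
  | (.q i, false) => (.x i, false)
  | (.p i, true) => (.q i, true)
  | (.q i, true) => Fin.cases (.c 0, true) (fun j => (.s j, true)) i
  | (.s j, true) => (.p j.succ, true)
  | (.c i, true) => Fin.cases (.p 0, true) (fun j => (.c j.castSucc, false)) i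
  | (.c i, false) => Fin.lastCases (.c (Fin.last n), false) (fun j => (.s j, false)) i
  | (.s j, false) => (.c j.succ, true)

/-- The labels of the positively oriented edges of the symplectic fatgraph. -/
def symMark {n : ℕ} : Edge n → SurfaceGroup n
  | .x i => genU i
  | .y i => genV i
  | .p i => genU i * genV i
  | .q i => (genU i)⁻¹ * (genV i)⁻¹
  | .c i => (partialBoundary n (i + 1))⁻¹
  | .s j => (genComm j.succ)⁻¹

/-- Reversal of an edge: the second component `true` stands for the positive orientation. -/
def symBar {n : ℕ} (e : Edge n × Bool) : Edge n × Bool := (e.1, !e.2)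

theorem partialBoundary_succ {n : ℕ} (k : Fin (n + 1)) :
    partialBoundary n (k + 1) = partialBoundary n k * genComm k := by
  have hk : (k : ℕ) < (List.ofFn fun i : Fin (n + 1) => (genComm i : SurfaceGroup n)).length := by
    rw [List.length_ofFn]; exact k.2
  rw [partialBoundary, partialBoundary, List.prod_take_succ _ _ hk, List.getElem_ofFn]

theorem sym_boundary {n : ℕ} (e : Edge n × Bool) :
    ∃ k : ℕ, (fun z => symBar (symVert z))^[k] (.c (Fin.last n), true) = e := by
  set F : Edge n × Bool → Edge n × Bool := fun z => symBar (symVert z) with hF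
  set R : Edge n × Bool → Prop := fun e => ∃ k : ℕ, F^[k] (.c (Fin.last n), true) = e with hR
  have step : ∀ y z, R y → F y = z → R z := by
    rintro y z ⟨k, hk⟩ hz
    exact ⟨k + 1, by rw [Function.iterate_succ_apply', hk, hz]⟩
  -- one genus one piece, entered through its stem
  have piece : ∀ i : Fin (n + 1), R (.p i, false) →
      R (.x i, false) ∧ R (.y i, true) ∧ R (.p i, true) ∧ R (.q i, false) ∧ R (.x i, true) ∧
        R (.y i, false) ∧ R (.q i, true) := by
    intro i h
    have h1 := step _ (.x i, false) h rfl
    have h2 := step _ (.y i, true) h1 rfl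
    have h3 := step _ (.p i, true) h2 rfl
    have h4 := step _ (.q i, false) h3 rfl
    have h5 := step _ (.x i, true) h4 rfl
    have h6 := step _ (.y i, false) h5 rfl
    have h7 := step _ (.q i, true) h6 rfl
    exact ⟨h1, h2, h3, h4, h5, h6, h7⟩
  have down : ∀ i : Fin (n + 1), R (.c i, true) := by
    intro i
    induction i using Fin.reverseInduction with
    | last => exact ⟨0, rfl⟩
    | cast j ih => exact step _ _ ih (by simp [hF, symBar, symVert])
  have p0 : R (.p 0, false) := step _ _ (down 0) (by simp [hF, symBar, symVert])
  have up : ∀ i : Fin (n + 1), R (.c i, false) ∧ R (.p i, false) := by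
    intro i
    induction i using Fin.induction with
    | zero => exact ⟨step _ _ (piece 0 p0).2.2.2.2.2.2 (by simp [hF, symBar, symVert]), p0⟩
    | succ j ih =>
      have h1 : R (.s j, true) := step _ _ ih.1 (by simp [hF, symBar, symVert])
      have h2 : R (.p j.succ, false) := step _ _ h1 rfl
      have h3 : R (.s j, false) :=
        step _ _ (piece _ h2).2.2.2.2.2.2 (by simp [hF, symBar, symVert])
      exact ⟨step _ _ h3 rfl, h2⟩
  have stem : ∀ j : Fin n, R (.s j, true) ∧ R (.s j, false) := fun j =>
    ⟨step _ _ (up j.castSucc).1 (by simp [hF, symBar, symVert]),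
      step _ _ (piece _ (up j.succ).2).2.2.2.2.2.2 (by simp [hF, symBar, symVert])⟩
  have pc := fun i => piece i (up i).2
  rcases e with ⟨e | e | e | e | e | e, _ | _⟩
  · exact (pc e).1
  · exact (pc e).2.2.2.2.1
  · exact (pc e).2.2.2.2.2.1
  · exact (pc e).2.1
  · exact (up e).2
  · exact (pc e).2.2.1
  · exact (pc e).2.2.2.1
  · exact (pc e).2.2.2.2.2.2
  · exact (up e).1
  · exact down e
  · exact (stem e).2
  · exact (stem e).1

/-- The symplectic fatgraph of genus `n + 1`: genus one pieces, the `i`-th with two oriented edges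
labelled `uᵢ` and `vᵢ`, whose stems are attached in order to a line that ends in the tail. -/
def symplecticFatgraph (n : ℕ) :
    MarkedFatgraph (Edge n × Bool) (SurfaceGroup n) (boundaryClass n) where
  bar := symBar
  vert := symVert
  tail := (.c (Fin.last n), true)
  bar_bar e := by simp [symBar]
  bar_ne e := by rcases e with ⟨e, _ | _⟩ <;> simp [symBar]
  univalent := by simp [symBar, symVert]
  trivalent := by
    rintro ⟨e | e | e | e | e | e, _ | _⟩ he
    case c.false =>
      induction e using Fin.lastCases with
      | last => exact absurd rfl he
      | cast j => simp [symVert]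
    case c.true => induction e using Fin.cases <;> simp [symVert]
    case p.true => induction e using Fin.cases <;> simp [symVert]
    case q.true => induction e using Fin.cases <;> simp [symVert]
    all_goals simp [symVert]
  boundary := sym_boundary
  mark e := if e.2 then symMark e.1 else (symMark e.1)⁻¹
  mark_bar e := by rcases e with ⟨e, _ | _⟩ <;> simp [symBar]
  mark_vert := by
    have h0 : partialBoundary n 1 = genComm 0 := by
      have h := partialBoundary_succ (n := n) 0
      rw [Fin.val_zero] at h
      rw [h]; simp [partialBoundary]
    have hs : ∀ j : Fin n, partialBoundary n (j + 1 + 1) =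
        partialBoundary n (j + 1) * genComm j.succ := by
      intro j
      have h := partialBoundary_succ (n := n) j.succ
      rwa [Fin.val_succ] at h
    rintro ⟨e | e | e | e | e | e, _ | _⟩ he
    case c.false =>
      induction e using Fin.lastCases with
      | last => exact absurd rfl he
      | cast j => simp [symVert, symMark, hs]
    case c.true =>
      induction e using Fin.cases with
      | zero => simp [symVert, symMark, h0, genComm, mul_assoc]
      | succ j => simp [symVert, symMark, hs]
    case p.true =>
      induction e using Fin.cases with
      | zero => simp [symVert, symMark, h0, genComm, mul_assoc]
      | succ j => simp [symVert, symMark, genComm, mul_assoc]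
    case q.true =>
      induction e using Fin.cases with
      | zero => simp [symVert, symMark, h0, genComm, mul_assoc]
      | succ j => simp [symVert, symMark, genComm, mul_assoc]
    case s.true => simp [symVert, symMark, genComm, mul_assoc]
    case s.false => simp [symVert, symMark, hs]
    all_goals simp [symVert, symMark, mul_assoc]
  full_rank := by
    rw [eq_top_iff, ← FreeGroup.closure_range_of, Subgroup.closure_le]
    rintro _ ⟨i | i, rfl⟩
    · exact Subgroup.subset_closure ⟨(.x i, true), rfl⟩
    · exact Subgroup.subset_closure ⟨(.y i, true), rfl⟩
  geometric := by
    have h : partialBoundary n (n + 1) = boundaryClass n := by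
      rw [partialBoundary, boundaryClass, List.take_of_length_le (by rw [List.length_ofFn])]
    simp [symBar, symMark, h]

end Surface

end FatgraphJohnson

end

noncomputable section

namespace FatgraphJohnson

/-! ### The degree filtration of the completed tensor algebra -/

section Filtration

variable {H : Type} [AddCommGroup H] [Module ℚ H]

/-! Write `δ` for the boundary class and `T` for the boundary twist.

Vanishing. The total Johnson map of `T` is conjugation by `θ(δ)`, since `θ(δ⁻¹ x δ) = θ(δ)⁻¹ θ(x)
θ(δ)`. In degree four, the conjugate of `h ∈ H` is a sum of terms `aᵢ h bⱼ` with `i + j = 3`, and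
one of `i, j` is always 1 or 3. So it suffices that `θ(δ)`, and hence its inverse, has no components
of degree 1 and 3 (`NoOddBelowFive.cf_four_conj`). For the symplectic fatgraph, `ℓ(uᵢ) = u + [u,v]/2
+ ⋯` and `ℓ(vᵢ) = v - [u,v]/2 + ⋯` (`symplectic_ell_sub_mem`). In the group commutator, the cubic
term `[u+v,[u,v]]/2` of the generic formula is cancelled exactly by these quadratic corrections
(`commutator_sub_mem`), leaving `1 + [u,v]` up to degree three. Products preserve the absence of
degrees 1 and 3.

Sum. The transitions of the moves compose to an automorphism taking the expansion of `G_N` to that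
of `G_0`. As `G_N` is isomorphic to the image of `G_0` under `T`, and `ℓ` sees the labels only
through homology, the composite is the total Johnson map of `T` (`isFatgraphExpansion_twist`). The
third component is additive along this composition because every first component vanishes
(`johnsonComponent_three_trans`). This holds since the class of the tail in `H` is zero, so a move
of the tail leaves the quadratic part of `ℓ` unchanged on all edges except the moved one
(`ell_moveTail_sub_mem`), and the labels of the other edges already generate the group.

Existence of the expansions. The sum over an edge path is a difference of values of one function on
the boundary cycle, the `potential`. It follows that the three values `X, Y, Z` of `ℓ` at a vertex
satisfy `X + Y + Z = -(h(X,Y) + h(Y,Z) + h(Z,X))/3`, and this forces `exp X exp Y exp Z = 1`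
(`texp_triple_eq_one`). The labels with the edge and vertex relations present the group
(`Presents`), a property of the symplectic fatgraph that survives Whitehead moves, so the
exponentials extend to a homomorphism. For free groups, transitions between Magnus expansions exist
and are unique.

Full turn. Deleting the tail merges the two other edges at its end; the boundary cycle `redFace` of
what remains is not changed by a move of the tail. When the tail passes along an oriented edge, the
label of this edge is multiplied by `δ` on the right and that of its reverse by `δ⁻¹` on the left.
After one turn each oriented edge has been passed once, so every label is conjugated by `δ`
(`iso_iterate_moveTail`). -/

/-- The coefficient of degree `n`, as an element of the tensor algebra. -/
def cf (n : ℕ) : That H →ₗ[ℚ] TensorAlgebra ℚ H := (TPow H n).subtype ∘ₗ comp n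

theorem cf_apply (n : ℕ) (a : That H) : cf n a = PowerSeries.coeff n a.1 := rfl

theorem coe_comp (n : ℕ) (a : That H) : (comp n a : TensorAlgebra ℚ H) = cf n a := rfl

theorem cf_mem (n : ℕ) (a : That H) : cf n a ∈ TPow H n := a.2 n

theorem cf_ofComp (n : ℕ) (a : ∀ n, TPow H n) : cf n (ofComp a) = a n := by
  simp [cf_apply, ofComp]

theorem cf_mul (n : ℕ) (a b : That H) :
    cf n (a * b) = ∑ p ∈ Finset.HasAntidiagonal.antidiagonal n, cf p.1 a * cf p.2 b := by
  simp only [cf_apply]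
  exact PowerSeries.coeff_mul n a.1 b.1

theorem cf_one (n : ℕ) : cf n (1 : That H) = if n = 0 then 1 else 0 := by
  rw [cf_apply]; exact PowerSeries.coeff_one n

theorem ext_cf {a b : That H} (h : ∀ n, cf n a = cf n b) : a = b :=
  Subtype.ext (PowerSeries.ext h)

/-- The filtration ideal `∏_{n ≥ p} H^{⊗n}`, as a subspace. -/
def filtS (H : Type) [AddCommGroup H] [Module ℚ H] (p : ℕ) : Submodule ℚ (That H) where
  carrier := filt H p
  zero_mem' n _ := map_zero _
  add_mem' ha hb n hn := by rw [map_add, ha n hn, hb n hn, add_zero]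
  smul_mem' r a ha n hn := by rw [map_smul, ha n hn, smul_zero]

theorem mem_filtS {p : ℕ} {a : That H} : a ∈ filtS H p ↔ ∀ n < p, cf n a = 0 :=
  forall₂_congr fun n _ => by rw [← coe_comp, ZeroMemClass.coe_eq_zero]

theorem filtS_anti {p q : ℕ} (h : p ≤ q) {a : That H} (ha : a ∈ filtS H q) : a ∈ filtS H p :=
  fun n hn => ha n (hn.trans_le h)

theorem mem_filtS_zero (a : That H) : a ∈ filtS H 0 := fun n hn => absurd hn n.not_lt_zero

theorem mul_mem_filtS {p q r : ℕ} {a b : That H} (ha : a ∈ filtS H p) (hb : b ∈ filtS H q)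
    (hr : r ≤ p + q) : a * b ∈ filtS H r := by
  rw [mem_filtS] at *
  intro n hn
  rw [cf_mul]
  refine Finset.sum_eq_zero fun x hx => ?_
  have hx := Finset.HasAntidiagonal.mem_antidiagonal.mp hx
  by_cases h : x.1 < p
  · rw [ha _ h, zero_mul]
  · rw [hb _ (by omega), mul_zero]

theorem mul_mem_filtS_left {p : ℕ} {a : That H} (b : That H) (ha : a ∈ filtS H p) :
    b * a ∈ filtS H p := mul_mem_filtS (mem_filtS_zero b) ha (by omega)

theorem mul_mem_filtS_right {p : ℕ} {a : That H} (b : That H) (ha : a ∈ filtS H p) :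
    a * b ∈ filtS H p := mul_mem_filtS ha (mem_filtS_zero b) (by omega)

theorem pow_mem_filtS {X : That H} (hX : X ∈ filtS H 1) (n : ℕ) : X ^ n ∈ filtS H n := by
  induction n with
  | zero => exact mem_filtS_zero _
  | succ n ih => rw [pow_succ]; exact mul_mem_filtS ih hX le_rfl

theorem eq_zero_of_forall_mem_filtS {a : That H} (h : ∀ p, a ∈ filtS H p) : a = 0 :=
  ext_cf fun n => by rw [map_zero]; exact mem_filtS.mp (h (n + 1)) n n.lt_succ_self

theorem eq_of_forall_sub_mem_filtS {a b : That H} (h : ∀ p, a - b ∈ filtS H p) : a = b :=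
  sub_eq_zero.mp (eq_zero_of_forall_mem_filtS h)

theorem cf_eq_of_sub_mem {p : ℕ} {a b : That H} (h : a - b ∈ filtS H p) {n : ℕ} (hn : n < p) :
    cf n a = cf n b := by
  have := mem_filtS.mp h n hn
  rwa [map_sub, sub_eq_zero] at this

theorem cf_incl (n k : ℕ) (a : TPow H n) : cf k (incl n a) = if k = n then (a : TensorAlgebra ℚ H)
    else 0 := by
  rw [incl, cf_ofComp]
  split_ifs with h
  · subst h; rw [Pi.single_eq_same]
  · rw [Pi.single_eq_of_ne h]; rfl

theorem cf_inclH (k : ℕ) (x : H) : cf k (inclH x) = if k = 1 then TensorAlgebra.ι ℚ x else 0 :=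
  cf_incl 1 k _

theorem inclH_mem (x : H) : inclH x ∈ filtS H 1 := by
  rw [mem_filtS]; intro n hn; rw [cf_inclH, if_neg (by omega)]

theorem incl_mem (n : ℕ) (a : TPow H n) : incl n a ∈ filtS H n := by
  rw [mem_filtS]; intro k hk; rw [cf_incl, if_neg hk.ne]

end Filtration

/-! ### Exponential and logarithm -/

section ExpLog

variable {H : Type} [AddCommGroup H] [Module ℚ H]

/-- The value `∑ cₙ Xⁿ` of a power series in one variable at `X`, for `X` without constant
term. -/
def evalAt (X : That H) (f : PowerSeries ℚ) : That H :=
  ofComp fun k => ∑ n ∈ Finset.range (k + 1), PowerSeries.coeff n f • comp k (X ^ n)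

theorem cf_evalAt (X : That H) (f : PowerSeries ℚ) (k : ℕ) :
    cf k (evalAt X f) = ∑ n ∈ Finset.range (k + 1), PowerSeries.coeff n f • cf k (X ^ n) := by
  rw [evalAt, cf_ofComp, AddSubmonoidClass.coe_finsetSum]; rfl

theorem evalAt_sub_sum_mem {X : That H} (hX : X ∈ filtS H 1) (f : PowerSeries ℚ) (m : ℕ) :
    evalAt X f - ∑ n ∈ Finset.range m, PowerSeries.coeff n f • X ^ n ∈ filtS H m := by
  rw [mem_filtS]
  intro k hk
  rw [map_sub, cf_evalAt, map_sum, sub_eq_zero]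
  simp only [map_smul]
  refine Finset.sum_subset (fun x hx => ?_) fun n _ hn => ?_
  · rw [Finset.mem_range] at *; omega
  · rw [Finset.mem_range] at hn
    rw [mem_filtS.mp (pow_mem_filtS hX n) k (by omega), smul_zero]

theorem evalAt_mem {X : That H} {f : PowerSeries ℚ} {m : ℕ}
    (hf : ∀ n < m, PowerSeries.coeff n f = 0) : evalAt X f ∈ filtS H m := by
  rw [mem_filtS]
  intro k hk
  rw [cf_evalAt]
  refine Finset.sum_eq_zero fun n hn => ?_
  rw [Finset.mem_range] at hn
  rw [hf n (by omega), zero_smul]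

theorem aeval_mem {X : That H} (hX : X ∈ filtS H 1) {p : Polynomial ℚ} {m : ℕ}
    (hp : ∀ n < m, p.coeff n = 0) : Polynomial.aeval X p ∈ filtS H m := by
  rw [Polynomial.aeval_eq_sum_range]
  refine Submodule.sum_mem _ fun n _ => ?_
  by_cases h : n < m
  · rw [hp n h, zero_smul]; exact Submodule.zero_mem _
  · exact Submodule.smul_mem _ _ (filtS_anti (not_lt.mp h) (pow_mem_filtS hX n))

/-- Modulo degree `m` only a truncation of the series matters; this lets `evalAt` inherit
multiplicativity from polynomial evaluation. -/
theorem evalAt_sub_aeval_trunc_mem {X : That H} (hX : X ∈ filtS H 1) (f : PowerSeries ℚ) (m : ℕ) :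
    evalAt X f - Polynomial.aeval X (PowerSeries.trunc m f) ∈ filtS H m := by
  have h : Polynomial.aeval X (PowerSeries.trunc m f) =
      ∑ n ∈ Finset.range m, PowerSeries.coeff n f • X ^ n := by
    rw [Polynomial.aeval_eq_sum_range' (n := m + 1), Finset.sum_range_succ,
      PowerSeries.coeff_trunc, if_neg (lt_irrefl m), zero_smul, add_zero]
    · refine Finset.sum_congr rfl fun n hn => ?_
      rw [PowerSeries.coeff_trunc, if_pos (Finset.mem_range.mp hn)]
    · exact Nat.lt_succ_of_le (Polynomial.natDegree_le_iff_coeff_eq_zero.mpr fun k hk => by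
        rw [PowerSeries.coeff_trunc, if_neg (by omega)])
  rw [h]
  exact evalAt_sub_sum_mem hX f m

theorem evalAt_add (X : That H) (f g : PowerSeries ℚ) :
    evalAt X (f + g) = evalAt X f + evalAt X g :=
  ext_cf fun k => by
    simp only [cf_evalAt, map_add, add_smul, Finset.sum_add_distrib]

theorem evalAt_smul (X : That H) (r : ℚ) (f : PowerSeries ℚ) :
    evalAt X (r • f) = r • evalAt X f :=
  ext_cf fun k => by
    simp only [cf_evalAt, map_smul, smul_assoc, Finset.smul_sum]

theorem evalAt_one (X : That H) : evalAt X 1 = 1 := by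
  refine ext_cf fun k => ?_
  rw [cf_evalAt, Finset.sum_range_succ', Finset.sum_eq_zero]
  · simp
  · intro n _; simp [PowerSeries.coeff_one]

theorem evalAt_mul {X : That H} (hX : X ∈ filtS H 1) (f g : PowerSeries ℚ) :
    evalAt X (f * g) = evalAt X f * evalAt X g := by
  refine eq_of_forall_sub_mem_filtS fun m => ?_
  have h1 := evalAt_sub_aeval_trunc_mem hX (f * g) m
  have h2 := evalAt_sub_aeval_trunc_mem hX f m
  have h3 := evalAt_sub_aeval_trunc_mem hX g m
  -- The truncated product and the product of the truncations have the same coefficients below `m`.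
  have h4 : Polynomial.aeval X (PowerSeries.trunc m (f * g) -
      PowerSeries.trunc m f * PowerSeries.trunc m g) ∈ filtS H m := by
    refine aeval_mem hX fun n hn => ?_
    rw [← PowerSeries.trunc_trunc_mul_trunc, Polynomial.coeff_sub, PowerSeries.coeff_trunc,
      if_pos hn, ← Polynomial.coe_mul, Polynomial.coeff_coe, sub_self]
  rw [map_sub, map_mul (Polynomial.aeval X)] at h4
  have h5 := mul_mem_filtS_right (evalAt X g) h2
  have h6 := mul_mem_filtS_left (Polynomial.aeval X (PowerSeries.trunc m f)) h3
  have h := sub_mem (sub_mem (add_mem h1 h4) h5) h6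
  convert h using 1
  simp only [mul_sub, sub_mul]
  abel

/-- Evaluation at `X`, as an algebra homomorphism. -/
def evalHom {X : That H} (hX : X ∈ filtS H 1) : PowerSeries ℚ →ₐ[ℚ] That H :=
  AlgHom.ofLinearMap ⟨⟨evalAt X, evalAt_add X⟩, evalAt_smul X⟩ (evalAt_one X) (evalAt_mul hX)

theorem evalHom_apply {X : That H} (hX : X ∈ filtS H 1) (f : PowerSeries ℚ) :
    evalHom hX f = evalAt X f := rfl

theorem evalAt_X {X : That H} (hX : X ∈ filtS H 1) : evalAt X PowerSeries.X = X := by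
  refine eq_of_forall_sub_mem_filtS fun m => ?_
  have h := evalAt_sub_sum_mem hX PowerSeries.X (m + 2)
  rw [Finset.sum_eq_single_of_mem 1 (by simp)] at h
  · simp only [PowerSeries.coeff_one_X, one_smul, pow_one] at h
    exact filtS_anti (by omega) h
  · intro n _ hn
    rw [PowerSeries.coeff_X, if_neg hn, zero_smul]

theorem texp_eq_evalAt (X : That H) : texp X = evalAt X (PowerSeries.exp ℚ) := by
  simp [texp, evalAt, PowerSeries.coeff_exp]

theorem tlog_eq_evalAt (Z : That H) : tlog Z = evalAt (Z - 1) (PowerSeries.log ℚ) := by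
  unfold tlog evalAt
  congr 1
  funext k
  rw [Finset.sum_range_succ', PowerSeries.coeff_zero_eq_constantCoeff_apply,
    PowerSeries.constantCoeff_log, zero_smul, add_zero, Finset.range_eq_Ico,
    Finset.sum_Ico_add' (fun n => PowerSeries.coeff n (PowerSeries.log ℚ) • comp k ((Z - 1) ^ n)),
    zero_add]
  refine Finset.sum_congr rfl fun n hn => ?_
  rw [PowerSeries.coeff_log, if_neg (by rw [Finset.mem_Ico] at hn; omega)]
  rfl

theorem texp_neg_eq_evalAt (X : That H) :
    texp (-X) = evalAt X (PowerSeries.evalNegHom (PowerSeries.exp ℚ)) := by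
  rw [texp_eq_evalAt]
  refine ext_cf fun k => ?_
  rw [cf_evalAt, cf_evalAt]
  refine Finset.sum_congr rfl fun n _ => ?_
  rw [PowerSeries.evalNegHom, PowerSeries.coeff_rescale, ← neg_one_smul ℚ X, smul_pow, map_smul,
    smul_smul, mul_comm]

theorem texp_mul_texp_neg {X : That H} (hX : X ∈ filtS H 1) : texp X * texp (-X) = 1 := by
  rw [texp_neg_eq_evalAt, texp_eq_evalAt, ← evalAt_mul hX, PowerSeries.exp_mul_exp_neg_eq_one,
    evalAt_one]

theorem texp_neg_mul_texp {X : That H} (hX : X ∈ filtS H 1) : texp (-X) * texp X = 1 := by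
  have := texp_mul_texp_neg (neg_mem hX)
  rwa [neg_neg] at this

theorem texp_sub_sum_mem {X : That H} (hX : X ∈ filtS H 1) (m : ℕ) :
    texp X - ∑ n ∈ Finset.range m, ((n.factorial : ℚ)⁻¹) • X ^ n ∈ filtS H m := by
  have h := evalAt_sub_sum_mem hX (PowerSeries.exp ℚ) m
  rw [← texp_eq_evalAt] at h
  simpa [PowerSeries.coeff_exp] using h

/-- The partial sums of `exp (log (1 + X))` agree with `1 + X` to increasing order. -/
theorem coeff_sum_log_pow (m : ℕ) : ∀ k < m + 1, PowerSeries.coeff k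
    (∑ n ∈ Finset.range (m + 1), ((n.factorial : ℚ)⁻¹) • PowerSeries.log ℚ ^ n -
      (1 + PowerSeries.X)) = 0 := by
  induction m with
  | zero =>
    intro k hk
    obtain rfl : k = 0 := by omega
    simp
  | succ m ih =>
    set E : ℕ → PowerSeries ℚ := fun m =>
      ∑ n ∈ Finset.range (m + 1), ((n.factorial : ℚ)⁻¹) • PowerSeries.log ℚ ^ n with hE
    set L := PowerSeries.derivative ℚ (PowerSeries.log ℚ) with hL
    have hL1 : (1 + PowerSeries.X) * L = 1 := by
      rw [hL, PowerSeries.deriv_log]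
      ext k
      rw [add_mul, one_mul, map_add, PowerSeries.coeff_mk, PowerSeries.coeff_one]
      cases k with
      | zero => simp
      | succ k => simp [PowerSeries.coeff_succ_X_mul, pow_succ]
    -- The power rule turns the term of index `n + 1` into the term of index `n` times `L`.
    have hd : PowerSeries.derivative ℚ (E (m + 1)) = E m * L := by
      simp only [hE]
      rw [map_sum, Finset.sum_range_succ', Finset.sum_mul]
      simp only [pow_zero, Derivation.map_smul, Derivation.map_one_eq_zero, smul_zero, add_zero]
      refine Finset.sum_congr rfl fun n _ => ?_
      rw [Derivation.leibniz_pow, Nat.add_sub_cancel, smul_mul_assoc, ← hL, smul_eq_mul,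
        ← Nat.cast_smul_eq_nsmul ℚ, smul_smul]
      congr 1
      rw [Nat.factorial_succ]
      push_cast
      field_simp
    -- By induction `E m * L` agrees with `(1 + X) * L = 1` below order `m + 1`. Integrating gains
    -- one order; the constant terms are compared separately.
    have hm : PowerSeries.X ^ (m + 1) ∣ (E m - (1 + PowerSeries.X)) * L :=
      Dvd.dvd.mul_right (PowerSeries.X_pow_dvd_iff.mpr ih) L
    rw [sub_mul, hL1, ← hd, PowerSeries.X_pow_dvd_iff] at hm
    intro k hk
    cases k with
    | zero =>
      rw [map_sub, map_sum, Finset.sum_range_succ']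
      simp
    | succ k =>
      have h := hm k (by omega)
      rw [map_sub, PowerSeries.coeff_derivative, PowerSeries.coeff_one, sub_eq_zero] at h
      rw [map_sub, sub_eq_zero, map_add, PowerSeries.coeff_one, PowerSeries.coeff_X]
      change PowerSeries.coeff (k + 1) (E (m + 1)) = _
      cases k with
      | zero => simpa using h
      | succ k =>
        rw [if_neg (by omega)] at h
        rw [if_neg (by omega), if_neg (by omega)]
        have : ((k + 1 : ℕ) : ℚ) + 1 ≠ 0 := by positivity
        rcases mul_eq_zero.mp h with h | h
        · rw [h, add_zero]
        · exact absurd h this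

theorem tlog_mem {Z : That H} : tlog Z ∈ filtS H 1 := by
  rw [tlog_eq_evalAt]
  refine evalAt_mem fun n hn => ?_
  obtain rfl : n = 0 := by omega
  simp

/-- The formal congruence `coeff_sum_log_pow`, evaluated at `Z - 1`, compares `Z` with the partial
sums of the exponential to every order, so no composition of power series is needed. -/
theorem texp_tlog {Z : That H} (hZ : Z - 1 ∈ filtS H 1) : texp (tlog Z) = Z := by
  refine eq_of_forall_sub_mem_filtS fun m => ?_
  have h1 := texp_sub_sum_mem (tlog_mem (Z := Z)) (m + 1)
  have h2 : evalAt (Z - 1) (∑ n ∈ Finset.range (m + 1),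
      ((n.factorial : ℚ)⁻¹) • PowerSeries.log ℚ ^ n - (1 + PowerSeries.X)) ∈ filtS H (m + 1) :=
    evalAt_mem (coeff_sum_log_pow m)
  rw [← evalHom_apply hZ, map_sub, map_sum, map_add, map_one, evalHom_apply hZ PowerSeries.X,
    evalAt_X hZ, add_sub_cancel] at h2
  simp only [map_smul, map_pow, evalHom_apply, ← tlog_eq_evalAt] at h2
  have h := add_mem h1 h2
  rw [sub_add_sub_cancel] at h
  exact filtS_anti (by omega) h

/-- Telescoping: every further factor has degree at least one and raises the order of the difference
by one. -/
theorem pow_sub_pow_mem {A B : That H} {n : ℕ} (hA : A ∈ filtS H 1) (hB : B ∈ filtS H 1)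
    (h : B - A ∈ filtS H n) (j : ℕ) : B ^ (j + 1) - A ^ (j + 1) ∈ filtS H (n + j) := by
  induction j with
  | zero => simpa using h
  | succ j ih =>
    have h1 := mul_mem_filtS ih hB (r := n + (j + 1)) (by omega)
    have h2 := mul_mem_filtS (pow_mem_filtS hA (j + 1)) h (r := n + (j + 1)) (by omega)
    have := add_mem h1 h2
    convert this using 1
    rw [pow_succ, pow_succ A (j + 1), mul_sub, sub_mul, sub_add_sub_cancel]

/-- The linear term of the exponential is the identity, and in the higher powers the difference
gains a degree by `pow_sub_pow_mem`. All perturbation arguments below rest on this first-order rule.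
-/
theorem texp_sub_texp_sub_mem {A B : That H} {n : ℕ} (hA : A ∈ filtS H 1) (hB : B ∈ filtS H 1)
    (h : B - A ∈ filtS H n) : texp B - texp A - (B - A) ∈ filtS H (n + 1) := by
  have h1 := texp_sub_sum_mem hA (n + 2)
  have h2 := texp_sub_sum_mem hB (n + 2)
  have h3 : ∑ j ∈ Finset.range (n + 2), ((j.factorial : ℚ)⁻¹) • B ^ j -
      ∑ j ∈ Finset.range (n + 2), ((j.factorial : ℚ)⁻¹) • A ^ j - (B - A) ∈ filtS H (n + 1) := by
    rw [← Finset.sum_sub_distrib, Finset.sum_range_succ', Finset.sum_range_succ']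
    simp only [← smul_sub, zero_add, Nat.factorial_one, Nat.cast_one, inv_one, one_smul, pow_one,
      pow_zero, sub_self, add_zero, add_sub_cancel_right]
    refine Submodule.sum_mem _ fun j _ => Submodule.smul_mem _ _ ?_
    exact filtS_anti (by omega) (pow_sub_pow_mem hA hB h (j + 1))
  have := add_mem (sub_mem (filtS_anti (Nat.le_succ (n + 1)) h2)
    (filtS_anti (Nat.le_succ (n + 1)) h1)) h3
  convert this using 1
  abel

theorem texp_sub_texp_mem {A B : That H} {n : ℕ} (hA : A ∈ filtS H 1) (hB : B ∈ filtS H 1)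
    (h : B - A ∈ filtS H n) : texp B - texp A ∈ filtS H n := by
  have := add_mem (filtS_anti n.le_succ (texp_sub_texp_sub_mem hA hB h)) h
  rwa [sub_add_cancel] at this

/-- Bootstrapping: once `B - A` has order `k`, it agrees with the difference of the exponentials
modulo order `k + 1`. -/
theorem sub_mem_of_texp_sub_texp_mem {A B : That H} (hA : A ∈ filtS H 1) (hB : B ∈ filtS H 1)
    {n : ℕ} (h : texp B - texp A ∈ filtS H n) : B - A ∈ filtS H n := by
  have key : ∀ k ≤ n, B - A ∈ filtS H k := by
    intro k
    induction k with
    | zero => intro _; exact mem_filtS_zero _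
    | succ k ih =>
      intro hk
      have := sub_mem (filtS_anti hk h) (texp_sub_texp_sub_mem hA hB (ih (by omega)))
      rwa [sub_sub_cancel] at this
  exact key n le_rfl

theorem texp_zero : texp (0 : That H) = 1 := by
  refine eq_of_forall_sub_mem_filtS fun m => ?_
  have h := texp_sub_sum_mem (Submodule.zero_mem (filtS H 1)) (m + 1)
  rw [Finset.sum_range_succ', Finset.sum_eq_zero (by intro i _; simp)] at h
  simp only [zero_add, Nat.factorial_zero, Nat.cast_one, inv_one, pow_zero, one_smul] at h
  exact filtS_anti (by omega) h

theorem texp_sub_one_mem {A : That H} {n : ℕ} (hn : 1 ≤ n) (hA : A ∈ filtS H n) :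
    texp A - 1 ∈ filtS H n := by
  rw [← texp_zero]
  exact texp_sub_texp_mem (Submodule.zero_mem _) (filtS_anti hn hA) (by rwa [sub_zero])

theorem texp_sub_one_sub_mem {A : That H} (hA : A ∈ filtS H 1) : texp A - 1 - A ∈ filtS H 2 := by
  have := texp_sub_texp_sub_mem (Submodule.zero_mem _) hA (n := 1) (by rwa [sub_zero])
  rwa [texp_zero, sub_zero] at this

theorem mul_sub_one_mem {a b : That H} {n : ℕ} (ha : a - 1 ∈ filtS H n) (hb : b - 1 ∈ filtS H n) :
    a * b - 1 ∈ filtS H n := by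
  have := add_mem (mul_mem_filtS_right b ha) hb
  rwa [sub_mul, one_mul, sub_add_sub_cancel] at this

theorem texp_hausdorff {X Y : That H} (hX : X ∈ filtS H 1) (hY : Y ∈ filtS H 1) :
    texp (X + Y + haus X Y) = texp X * texp Y := by
  rw [haus, sub_sub, add_sub_cancel]
  exact texp_tlog (mul_sub_one_mem (texp_sub_one_mem le_rfl hX) (texp_sub_one_mem le_rfl hY))

end ExpLog

/-! ### Perturbation of the Hausdorff series, and its quadratic part. -/

section Hausdorff

variable {H : Type} [AddCommGroup H] [Module ℚ H]

theorem texp_mul_texp_congr {X Y X' Y' : That H} {n : ℕ} (hX : X ∈ filtS H 1) (hY : Y ∈ filtS H 1)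
    (hX' : X' ∈ filtS H 1) (hY' : Y' ∈ filtS H 1) (hXX : X' - X ∈ filtS H n)
    (hYY : Y' - Y ∈ filtS H n) :
    texp X' * texp Y' - texp X * texp Y - ((X' - X) + (Y' - Y)) ∈ filtS H (n + 1) := by
  have h1 := mul_mem_filtS_right (texp Y') (texp_sub_texp_sub_mem hX hX' hXX)
  have h2 := mul_mem_filtS hXX (texp_sub_one_mem le_rfl hY') (r := n + 1) le_rfl
  have h3 := mul_mem_filtS_left (texp X) (texp_sub_texp_sub_mem hY hY' hYY)
  have h4 := mul_mem_filtS (texp_sub_one_mem le_rfl hX) hYY (r := n + 1) (by omega)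
  convert add_mem (add_mem h1 h2) (add_mem h3 h4) using 1
  simp only [mul_sub, sub_mul, mul_one, one_mul]
  abel

theorem haus_mem {X Y : That H} (hX : X ∈ filtS H 1) (hY : Y ∈ filtS H 1) :
    haus X Y ∈ filtS H 2 := by
  have hK : X + Y + haus X Y ∈ filtS H 1 := by
    rw [haus, sub_sub, add_sub_cancel]; exact tlog_mem
  have h1 := texp_sub_one_sub_mem hK
  have h0 := Submodule.zero_mem (filtS H 1)
  have h2 := texp_mul_texp_congr h0 h0 hX hY (n := 1) (by rwa [sub_zero]) (by rwa [sub_zero])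
  rw [texp_hausdorff hX hY] at h1
  rw [texp_zero, sub_zero, sub_zero, mul_one] at h2
  convert sub_mem h2 h1 using 1
  abel

/-- The exponents `X + Y + h(X, Y)` and the sums `X + Y` have the same first variation, so the
variation of `h` appears one order later. This gain is what makes the recursion for `ℓ` well
founded: each degree of a path sum involves only lower degrees of `ℓ`. -/
theorem haus_congr {X Y X' Y' : That H} {n : ℕ} (hX : X ∈ filtS H 1) (hY : Y ∈ filtS H 1)
    (hX' : X' ∈ filtS H 1) (hY' : Y' ∈ filtS H 1) (hXX : X' - X ∈ filtS H n)
    (hYY : Y' - Y ∈ filtS H n) : haus X' Y' - haus X Y ∈ filtS H (n + 1) := by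
  have hK : X + Y + haus X Y ∈ filtS H 1 :=
    add_mem (add_mem hX hY) (filtS_anti one_le_two (haus_mem hX hY))
  have hK' : X' + Y' + haus X' Y' ∈ filtS H 1 :=
    add_mem (add_mem hX' hY') (filtS_anti one_le_two (haus_mem hX' hY'))
  have h1 := texp_mul_texp_congr hX hY hX' hY' hXX hYY
  rw [← texp_hausdorff hX hY, ← texp_hausdorff hX' hY'] at h1
  have h2 := sub_mem_of_texp_sub_texp_mem hK hK' (n := n) (by
    have := add_mem (filtS_anti n.le_succ h1) (add_mem hXX hYY)
    rwa [sub_add_cancel] at this)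
  convert sub_mem h1 (texp_sub_texp_sub_mem hK hK' h2) using 1
  abel

theorem texp_sub_quadratic_mem {X : That H} (hX : X ∈ filtS H 1) :
    texp X - (1 + X + (1 / 2 : ℚ) • (X * X)) ∈ filtS H 3 := by
  have h := texp_sub_sum_mem hX 3
  simpa [Finset.sum_range_succ, pow_two] using h

theorem mul_congr_mem {a b a' b' : That H} {n : ℕ} (ha : a' - a ∈ filtS H n)
    (hb : b' - b ∈ filtS H n) : a' * b' - a * b ∈ filtS H n := by
  convert add_mem (mul_mem_filtS_right b' ha) (mul_mem_filtS_left a hb) using 1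
  rw [sub_mul, mul_sub, sub_add_sub_cancel]

/-- The quadratic part of the Hausdorff series. -/
theorem haus_sub_quadratic_mem {X Y : That H} (hX : X ∈ filtS H 1) (hY : Y ∈ filtS H 1) :
    haus X Y - (1 / 2 : ℚ) • (X * Y - Y * X) ∈ filtS H 3 := by
  have hh := haus_mem hX hY
  have hXY := add_mem hX hY
  have hK : X + Y + haus X Y ∈ filtS H 1 := add_mem hXY (filtS_anti one_le_two hh)
  have h1 := texp_sub_quadratic_mem hK
  rw [texp_hausdorff hX hY] at h1
  have h2 := mul_congr_mem (texp_sub_quadratic_mem hX) (texp_sub_quadratic_mem hY)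
  -- The Hausdorff term has degree two, so the square of the full exponent is `(X + Y) ^ 2` modulo
  -- degree three.
  have h3 := pow_sub_pow_mem hXY hK (n := 2) (by rwa [add_sub_cancel_left]) 1
  have hXX := mul_mem_filtS hX hX (r := 2) le_rfl
  have hYY := mul_mem_filtS hY hY (r := 2) le_rfl
  have h4 := mul_mem_filtS hXX hY (r := 3) le_rfl
  have h5 := mul_mem_filtS hX hYY (r := 3) le_rfl
  have h6 := mul_mem_filtS hXX hYY (r := 3) (by omega)
  rw [pow_two, pow_two] at h3
  have h := add_mem (sub_mem (sub_mem h2 h1) (Submodule.smul_mem _ (1 / 2 : ℚ) h3))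
    (add_mem (add_mem (Submodule.smul_mem _ (1 / 2 : ℚ) h4) (Submodule.smul_mem _ (1 / 2 : ℚ) h5))
      (Submodule.smul_mem _ (1 / 4 : ℚ) h6))
  convert h using 1
  simp only [mul_add, add_mul, mul_one, one_mul, smul_mul_assoc, mul_smul_comm, mul_assoc]
  module

end Hausdorff

/-! ### Endomorphisms of the completed tensor algebra -/

section Endomorphisms

variable {H : Type} [AddCommGroup H] [Module ℚ H]

/-- The sum of the components of degree less than `m`, in the tensor algebra. -/
def tr (m : ℕ) : That H →ₗ[ℚ] TensorAlgebra ℚ H := ∑ k ∈ Finset.range m, cf k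

theorem tr_apply (m : ℕ) (a : That H) : tr m a = ∑ k ∈ Finset.range m, cf k a := by
  rw [tr, LinearMap.sum_apply]

/-- The inclusion of the tensor algebra into its completion. -/
def toThat : TensorAlgebra ℚ H →ₐ[ℚ] That H := TensorAlgebra.lift ℚ inclH

theorem lift_mem {f : H →ₗ[ℚ] That H} (hf : ∀ x, f x ∈ filtS H 1) {n : ℕ} {a : TensorAlgebra ℚ H}
    (ha : a ∈ TPow H n) : TensorAlgebra.lift ℚ f a ∈ filtS H n := by
  induction ha using Submodule.pow_induction_on_right' with
  | algebraMap r => exact mem_filtS_zero _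
  | add x y i hx hy h1 h2 => rw [map_add]; exact add_mem h1 h2
  | mul_mem i x hx ih m hm =>
    obtain ⟨z, rfl⟩ := hm
    rw [map_mul, TensorAlgebra.lift_ι_apply]
    exact mul_mem_filtS ih (hf z) le_rfl

theorem toThat_mem {n : ℕ} {a : TensorAlgebra ℚ H} (ha : a ∈ TPow H n) : toThat a ∈ filtS H n :=
  lift_mem inclH_mem ha

theorem cf_toThat {n : ℕ} {a : TensorAlgebra ℚ H} (ha : a ∈ TPow H n) (k : ℕ) :
    cf k (toThat a) = if k = n then a else 0 := by
  induction ha using Submodule.pow_induction_on_right' generalizing k with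
  | algebraMap r =>
    rw [AlgHom.commutes, Algebra.algebraMap_eq_smul_one, map_smul, cf_one]
    split_ifs
    · rw [Algebra.algebraMap_eq_smul_one]
    · rw [smul_zero]
  | add x y i hx hy h1 h2 =>
    rw [map_add, map_add, h1, h2]
    split_ifs <;> simp
  | mul_mem i x hx ih m hm =>
    obtain ⟨z, rfl⟩ := hm
    rw [map_mul, cf_mul]
    have hz : toThat (TensorAlgebra.ι ℚ z) = inclH z := TensorAlgebra.lift_ι_apply _ _
    simp only [ih, hz, cf_inclH]
    split_ifs with h
    · rw [Finset.sum_eq_single (i, 1)]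
      · simp
      · rintro ⟨p, q⟩ _ hpq
        by_cases h1 : p = i
        · rw [if_neg (c := q = 1), mul_zero]
          rintro rfl
          exact hpq (by rw [h1])
        · simp only [if_neg h1, zero_mul]
      · intro h'; exact absurd (by simp [h]) h'
    · refine Finset.sum_eq_zero fun p hp => ?_
      rw [Finset.HasAntidiagonal.mem_antidiagonal] at hp
      by_cases h1 : p.1 = i
      · rw [if_neg (c := p.2 = 1) (by omega), mul_zero]
      · rw [if_neg h1, zero_mul]

theorem sub_toThat_tr_mem (m : ℕ) (a : That H) : a - toThat (tr m a) ∈ filtS H m := by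
  rw [mem_filtS]
  intro k hk
  rw [tr_apply, map_sub, map_sum, map_sum, Finset.sum_eq_single k]
  · rw [cf_toThat (cf_mem k a), if_pos rfl, sub_self]
  · intro j _ hj
    rw [cf_toThat (cf_mem j a), if_neg hj.symm]
  · intro h; exact absurd (Finset.mem_range.mpr hk) h

theorem linearMap_ext_tpow {V : Type*} [AddCommGroup V] [Module ℚ V]
    {f g : TensorAlgebra ℚ H →ₗ[ℚ] V} (h : ∀ n, ∀ a ∈ TPow H n, f a = g a) : f = g := by
  ext a
  induction a using DirectSum.Decomposition.inductionOn (fun n : ℕ => TPow H n) with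
  | zero => rw [map_zero, map_zero]
  | homogeneous m => exact h _ _ m.2
  | add x y hx hy => rw [map_add, map_add, hx, hy]

theorem lift_tr_sub_mem {f : H →ₗ[ℚ] That H} (hf : ∀ x, f x ∈ filtS H 1) {k m : ℕ} (hk : k ≤ m)
    (a : That H) :
    TensorAlgebra.lift ℚ f (tr m a) - TensorAlgebra.lift ℚ f (tr k a) ∈ filtS H k := by
  rw [← map_sub, tr_apply, tr_apply, ← Finset.sum_Ico_eq_sub _ hk, map_sum]
  refine Submodule.sum_mem _ fun j hj => ?_
  exact filtS_anti (Finset.mem_Ico.mp hj).1 (lift_mem hf (cf_mem j a))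

/-- The continuous linear extension of `f : H → T̂₁` to `T̂`. -/
def extFun (f : H →ₗ[ℚ] That H) : That H →ₗ[ℚ] That H where
  -- If `f` takes values of degree at least one, parts of `a` of degree above `k` cannot contribute
  -- to component `k`; truncating at `k + 1` is then enough.
  toFun a := ofComp fun k => comp k (TensorAlgebra.lift ℚ f (tr (k + 1) a))
  map_add' a b := ext_cf fun k => by
    rw [map_add, cf_ofComp, cf_ofComp, cf_ofComp, map_add, map_add, map_add]; rfl
  map_smul' r a := ext_cf fun k => by
    rw [map_smul, cf_ofComp, cf_ofComp, map_smul, map_smul, map_smul]; rfl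

theorem cf_extFun (f : H →ₗ[ℚ] That H) (k : ℕ) (a : That H) :
    cf k (extFun f a) = cf k (TensorAlgebra.lift ℚ f (tr (k + 1) a)) := cf_ofComp _ _

theorem extFun_sub_mem {f : H →ₗ[ℚ] That H} (hf : ∀ x, f x ∈ filtS H 1) (m : ℕ) (a : That H) :
    extFun f a - TensorAlgebra.lift ℚ f (tr m a) ∈ filtS H m := by
  rw [mem_filtS]
  intro k hk
  rw [map_sub, cf_extFun, sub_eq_zero]
  exact (cf_eq_of_sub_mem (lift_tr_sub_mem hf (show k + 1 ≤ m by omega) a) k.lt_succ_self).symm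

theorem extFun_mem {f : H →ₗ[ℚ] That H} (hf : ∀ x, f x ∈ filtS H 1) {p : ℕ} {a : That H}
    (ha : a ∈ filtS H p) : extFun f a ∈ filtS H p := by
  have h := extFun_sub_mem hf p a
  rwa [tr_apply, Finset.sum_eq_zero, map_zero, sub_zero] at h
  intro k hk
  exact mem_filtS.mp ha k (Finset.mem_range.mp hk)

theorem extFun_toThat {f : H →ₗ[ℚ] That H} (hf : ∀ x, f x ∈ filtS H 1) (a : TensorAlgebra ℚ H) :
    extFun f (toThat a) = TensorAlgebra.lift ℚ f a := by
  have h : extFun f ∘ₗ toThat.toLinearMap = (TensorAlgebra.lift ℚ f).toLinearMap := by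
    refine linearMap_ext_tpow fun n a ha => ?_
    refine eq_of_forall_sub_mem_filtS fun m => ?_
    have h := extFun_sub_mem hf (m + n + 1) (toThat a)
    rw [tr_apply, Finset.sum_eq_single_of_mem n (by simp), cf_toThat ha, if_pos rfl] at h
    · exact filtS_anti (by omega) h
    · intro k _ hk
      rw [cf_toThat ha, if_neg hk]
  exact LinearMap.congr_fun h a

/-- The continuous algebra endomorphism of `T̂` which extends `f : H → T̂₁`. -/
def extHom {f : H →ₗ[ℚ] That H} (hf : ∀ x, f x ∈ filtS H 1) : That H →ₐ[ℚ] That H :=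
  AlgHom.ofLinearMap (extFun f)
    (by
      have h := extFun_toThat hf 1
      rwa [map_one toThat, map_one (TensorAlgebra.lift ℚ f)] at h)
    (by
      intro a b
      refine eq_of_forall_sub_mem_filtS fun m => ?_
      have ha := sub_toThat_tr_mem m a
      have hb := sub_toThat_tr_mem m b
      have h := extFun_mem hf (mul_congr_mem ha hb)
      have ha' := extFun_sub_mem hf m a
      have hb' := extFun_sub_mem hf m b
      rw [map_sub, ← map_mul toThat, extFun_toThat hf, map_mul (TensorAlgebra.lift ℚ f)] at h
      have := sub_mem h (mul_congr_mem ha' hb')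
      convert this using 1
      abel)

theorem extHom_apply {f : H →ₗ[ℚ] That H} (hf : ∀ x, f x ∈ filtS H 1) (a : That H) :
    extHom hf a = extFun f a := rfl

theorem toThat_ι (x : H) : toThat (TensorAlgebra.ι ℚ x) = inclH x := TensorAlgebra.lift_ι_apply _ _

theorem extHom_inclH {f : H →ₗ[ℚ] That H} (hf : ∀ x, f x ∈ filtS H 1) (x : H) :
    extHom hf (inclH x) = f x := by
  rw [extHom_apply, ← toThat_ι, extFun_toThat hf, TensorAlgebra.lift_ι_apply]

/-- Preserving the filtration plays the role of continuity, and the tensor algebra is dense. -/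
theorem algHom_eq_of_eq_inclH {U V : That H →ₐ[ℚ] That H}
    (hU : ∀ p, ∀ a ∈ filtS H p, U a ∈ filtS H p) (hV : ∀ p, ∀ a ∈ filtS H p, V a ∈ filtS H p)
    (h : ∀ x, U (inclH x) = V (inclH x)) : U = V := by
  have hJ : U.comp toThat = V.comp toThat := TensorAlgebra.hom_ext (LinearMap.ext fun x => by
    simpa [toThat_ι] using h x)
  ext1 a
  refine eq_of_forall_sub_mem_filtS fun m => ?_
  have ha := sub_toThat_tr_mem m a
  have h1 := sub_mem (hU m _ ha) (hV m _ ha)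
  have h2 := DFunLike.congr_fun hJ (tr m a)
  rw [AlgHom.comp_apply, AlgHom.comp_apply] at h2
  rwa [map_sub, map_sub, h2, sub_sub_sub_cancel_right] at h1

/-- An endomorphism which raises the degree of `x - U x` by `k` on `H` does so everywhere. -/
theorem algHom_sub_mem {U : That H →ₐ[ℚ] That H} (hU : ∀ p, ∀ a ∈ filtS H p, U a ∈ filtS H p)
    {k : ℕ} (hk : ∀ x, U (inclH x) - inclH x ∈ filtS H (1 + k)) {p : ℕ} {a : That H}
    (ha : a ∈ filtS H p) : U a - a ∈ filtS H (p + k) := by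
  have hom : ∀ n, ∀ c ∈ TPow H n, U (toThat c) - toThat c ∈ filtS H (n + k) := by
    intro n c hc
    induction hc using Submodule.pow_induction_on_right' with
    | algebraMap r => rw [AlgHom.commutes, AlgHom.commutes, sub_self]; exact Submodule.zero_mem _
    | add x y i hx hy h1 h2 =>
      rw [map_add, map_add, add_sub_add_comm]; exact add_mem h1 h2
    | mul_mem i x hx ih m hm =>
      obtain ⟨z, rfl⟩ := hm
      rw [map_mul, map_mul, toThat_ι]
      have h1 := mul_mem_filtS ih (hU 1 _ (inclH_mem z)) (r := i + 1 + k) (by omega)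
      have h2 := mul_mem_filtS (toThat_mem hx) (hk z) (r := i + 1 + k) (by omega)
      have := add_mem h1 h2
      rwa [sub_mul, mul_sub, sub_add_sub_cancel] at this
  have h1 := sub_toThat_tr_mem (p + k) a
  have h2 : U (toThat (tr (p + k) a)) - toThat (tr (p + k) a) ∈ filtS H (p + k) := by
    rw [tr_apply, map_sum, map_sum, ← Finset.sum_sub_distrib]
    refine Submodule.sum_mem _ fun j _ => ?_
    by_cases hj : j < p
    · rw [mem_filtS.mp ha j hj, map_zero, map_zero, sub_self]; exact Submodule.zero_mem _
    · exact filtS_anti (by omega) (hom j _ (cf_mem j a))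
  have h3 := add_mem (sub_mem (hU _ _ h1) h1) h2
  rw [map_sub] at h3
  convert h3 using 1
  abel

theorem mem_filtS_of_map_mem {U : That H →ₐ[ℚ] That H}
    (hU : ∀ p, ∀ a ∈ filtS H p, U a - a ∈ filtS H (p + 1)) {p : ℕ} {a : That H}
    (ha : U a ∈ filtS H p) : a ∈ filtS H p := by
  have key : ∀ q ≤ p, a ∈ filtS H q := by
    intro q
    induction q with
    | zero => intro _; exact mem_filtS_zero a
    | succ q ih =>
      intro hq
      have := sub_mem (filtS_anti hq ha) (hU q a (ih (by omega)))
      rwa [sub_sub_cancel] at this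
  exact key p le_rfl

/-- An element of the kernel lies in every filtration ideal. For surjectivity, a preimage is found
by successive approximation: adding the error `b - U (s p)` to `s p` gives a new error one order
smaller. -/
theorem bijective_of_unipotent {U : That H →ₐ[ℚ] That H}
    (hU : ∀ p, ∀ a ∈ filtS H p, U a - a ∈ filtS H (p + 1)) : Function.Bijective U := by
  constructor
  · rw [injective_iff_map_eq_zero]
    intro a ha
    exact eq_zero_of_forall_mem_filtS fun p =>
      mem_filtS_of_map_mem hU (by rw [ha]; exact Submodule.zero_mem _)
  · intro b
    let s : ℕ → That H := fun p => Nat.rec 0 (fun _ x => x + (b - U x)) p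
    have hs : ∀ p, s (p + 1) = s p + (b - U (s p)) := fun _ => rfl
    have h1 : ∀ p, b - U (s p) ∈ filtS H p := by
      intro p
      induction p with
      | zero => exact mem_filtS_zero _
      | succ p ih =>
        have := hU p _ ih
        rw [hs, map_add]
        convert neg_mem this using 1
        abel
    have h2 : ∀ p k, s (p + k) - s p ∈ filtS H p := by
      intro p k
      induction k with
      | zero => rw [add_zero, sub_self]; exact Submodule.zero_mem _
      | succ k ih =>
        have := add_mem ih (filtS_anti (Nat.le_add_right p k) (h1 (p + k)))
        rw [← add_assoc, hs]
        convert this using 1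
        abel
    -- The limit of the sequence `s`, assembled degree by degree: component `n` is stable from index
    -- `n + 1` on.
    have h3 : ∀ p, ofComp (fun n => comp n (s (n + 1))) - s p ∈ filtS H p := by
      intro p
      rw [mem_filtS]
      intro n hn
      obtain ⟨k, rfl⟩ := Nat.exists_eq_add_of_le (show n + 1 ≤ p from hn)
      rw [map_sub, cf_ofComp, coe_comp, sub_eq_zero]
      exact (cf_eq_of_sub_mem (h2 (n + 1) k) n.lt_succ_self).symm
    refine ⟨ofComp fun n => comp n (s (n + 1)), eq_of_forall_sub_mem_filtS fun p => ?_⟩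
    have h4 := add_mem (filtS_anti p.le_succ (hU p _ (h3 p))) (h3 p)
    rw [sub_add_cancel, map_sub] at h4
    have := sub_mem h4 (h1 p)
    convert this using 1
    abel

theorem IsIA.mem {U : That H ≃ₐ[ℚ] That H} (hU : IsIA U) (p : ℕ) (a : That H)
    (ha : a ∈ filtS H p) : U a ∈ filtS H p := (hU.filt_iff p a).mpr ha

theorem IsIA.sub_mem {U : That H ≃ₐ[ℚ] That H} (hU : IsIA U) (p : ℕ) (a : That H)
    (ha : a ∈ filtS H p) : U a - a ∈ filtS H (p + 1) :=
  algHom_sub_mem (U := U.toAlgHom) (k := 1) hU.mem (fun x => hU.trivial_gr _ (inclH_mem x)) ha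

theorem IsIA.symm {U : That H ≃ₐ[ℚ] That H} (hU : IsIA U) : IsIA U.symm := by
  have h : ∀ p f, U.symm f ∈ filt H p ↔ f ∈ filt H p := fun p f => by
    rw [← hU.filt_iff, U.apply_symm_apply]
  refine ⟨h, fun f hf => ?_⟩
  have := hU.trivial_gr _ ((h 1 f).mpr hf)
  rw [U.apply_symm_apply] at this
  rw [← neg_sub]
  exact (filtS H 2).neg_mem this

theorem IsIA.trans {U V : That H ≃ₐ[ℚ] That H} (hU : IsIA U) (hV : IsIA V) : IsIA (U.trans V) := by
  refine ⟨fun p f => ?_, fun f hf => ?_⟩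
  · rw [AlgEquiv.trans_apply, hV.filt_iff, hU.filt_iff]
  · have h1 := hU.trivial_gr f hf
    have h2 := hV.trivial_gr _ ((hU.filt_iff 1 f).mpr hf)
    have := (filtS H 2).add_mem h2 h1
    rwa [sub_add_sub_cancel] at this

/-- The element of `IA(T̂)` with prescribed restriction to `H`. -/
theorem exists_isIA {f : H →ₗ[ℚ] That H} (hf : ∀ x, f x - inclH x ∈ filtS H 2) :
    ∃ U : That H ≃ₐ[ℚ] That H, IsIA U ∧ ∀ x, U (inclH x) = f x := by
  have hf1 : ∀ x, f x ∈ filtS H 1 := fun x => by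
    have := add_mem (filtS_anti one_le_two (hf x)) (inclH_mem x)
    rwa [sub_add_cancel] at this
  have h1 : ∀ p, ∀ a ∈ filtS H p, extHom hf1 a - a ∈ filtS H (p + 1) := fun p a ha =>
    algHom_sub_mem (fun p a ha => extFun_mem hf1 ha)
      (fun x => by rw [extHom_inclH]; exact hf x) ha
  refine ⟨AlgEquiv.ofBijective (extHom hf1) (bijective_of_unipotent h1),
    ⟨fun p a => ⟨fun h => mem_filtS_of_map_mem h1 h, fun h => extFun_mem hf1 h⟩,
      fun a ha => h1 1 a ha⟩, fun x => extHom_inclH hf1 x⟩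

theorem IsIA.eq_of_eq_inclH {U V : That H ≃ₐ[ℚ] That H} (hU : IsIA U) (hV : IsIA V)
    (h : ∀ x, U (inclH x) = V (inclH x)) : U = V := by
  have := algHom_eq_of_eq_inclH (U := U.toAlgHom) (V := V.toAlgHom) hU.mem hV.mem h
  exact AlgEquiv.ext fun a => DFunLike.congr_fun this a

end Endomorphisms

/-! ### Rational homology and Magnus expansions -/

section Homology

variable {π : Type} [Group π]

theorem homClass_mul (x y : π) : homClass (x * y) = homClass x + homClass y := by
  rw [homClass, map_mul, ofMul_mul, TensorProduct.tmul_add]; rfl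

theorem homClass_one : homClass (1 : π) = 0 := by
  rw [homClass, map_one, ofMul_one, TensorProduct.tmul_zero]

theorem homClass_inv (x : π) : homClass x⁻¹ = -homClass x := by
  rw [eq_neg_iff_add_eq_zero, ← homClass_mul, inv_mul_cancel, homClass_one]

/-- The class of a product is the sum of the classes, so the classes of a generating set span `H`
over `ℚ`. -/
theorem linearMap_ext_of_closure {V : Type*} [AddCommGroup V] [Module ℚ V] {S : Set π}
    (hS : Subgroup.closure S = ⊤) {f g : RatH π →ₗ[ℚ] V}
    (h : ∀ x ∈ S, f (homClass x) = g (homClass x)) : f = g := by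
  have h1 : ∀ x : π, f (homClass x) = g (homClass x) := by
    intro x
    have hx : x ∈ Subgroup.closure S := by rw [hS]; trivial
    induction hx using Subgroup.closure_induction with
    | mem x hx => exact h x hx
    | one => rw [homClass_one, map_zero, map_zero]
    | mul x y _ _ hx hy => rw [homClass_mul, map_add, map_add, hx, hy]
    | inv x _ hx => rw [homClass_inv, map_neg, map_neg, hx]
  refine LinearMap.ext fun z => ?_
  induction z using TensorProduct.induction_on with
  | zero => rw [map_zero, map_zero]
  | add x y hx hy => rw [map_add, map_add, hx, hy]
  | tmul r a =>
    obtain ⟨x, hx⟩ := QuotientGroup.mk_surjective a.toMul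
    have : r ⊗ₜ[ℤ] a = r • homClass x := by
      rw [homClass, TensorProduct.smul_tmul', smul_eq_mul, mul_one]
      congr 1
      exact hx.symm
    rw [this, map_smul, map_smul, h1]

theorem exists_linearMap {α : Type} {V : Type*} [AddCommGroup V] [Module ℚ V] (g : α → V) :
    ∃ f : RatH (FreeGroup α) →ₗ[ℚ] V, ∀ a, f (homClass (FreeGroup.of a)) = g a := by
  let φ : Abelianization (FreeGroup α) →* Multiplicative V :=
    Abelianization.lift (FreeGroup.lift fun a => Multiplicative.ofAdd (g a))
  let ψ : Additive (Abelianization (FreeGroup α)) →+ V := MonoidHom.toAdditiveLeft φ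
  refine ⟨LinearMap.liftBaseChange ℚ ψ.toIntLinearMap, fun a => ?_⟩
  rw [homClass, LinearMap.liftBaseChange_tmul, one_smul]
  change (φ (Abelianization.of (FreeGroup.of a))).toAdd = g a
  simp only [φ, Abelianization.lift_apply_of, FreeGroup.lift_apply_of]
  rfl

/-- Modulo degree two, elements `1 + [x] + ⋯` multiply and invert by adding and negating the
classes, so generators suffice. -/
theorem isMagnusExpansion_of_closure {S : Set π} (hS : Subgroup.closure S = ⊤)
    {θ : π →* That (RatH π)} (h : ∀ x ∈ S, θ x - 1 - inclH (homClass x) ∈ filtS (RatH π) 2) :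
    IsMagnusExpansion θ := by
  have to1 : ∀ x, θ x - 1 - inclH (homClass x) ∈ filtS (RatH π) 2 →
      θ x - 1 ∈ filtS (RatH π) 1 := fun x hx => by
    have := add_mem (filtS_anti one_le_two hx) (inclH_mem (homClass x))
    rwa [sub_add_cancel] at this
  have h1 : ∀ x : π, θ x - 1 - inclH (homClass x) ∈ filtS (RatH π) 2 := by
    intro x
    have hx : x ∈ Subgroup.closure S := by rw [hS]; trivial
    induction hx using Subgroup.closure_induction with
    | mem x hx => exact h x hx
    | one => rw [map_one, homClass_one, map_zero, sub_self, sub_self]; exact Submodule.zero_mem _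
    | mul x y _ _ hx hy =>
      rw [map_mul, homClass_mul, map_add]
      have := add_mem (add_mem hx hy) (mul_mem_filtS (to1 x hx) (to1 y hy) le_rfl)
      convert this using 1
      simp only [mul_sub, sub_mul, mul_one, one_mul]
      abel
    | inv x _ hx =>
      rw [homClass_inv, map_neg]
      have e : θ x * θ x⁻¹ = 1 := by rw [← map_mul, mul_inv_cancel, map_one]
      have e1 : θ x⁻¹ - 1 = -((θ x - 1) * θ x⁻¹) := by rw [sub_mul, e, one_mul, neg_sub]
      have e2 : θ x⁻¹ - 1 ∈ filtS (RatH π) 1 := by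
        rw [e1]; exact neg_mem (mul_mem_filtS_right _ (to1 x hx))
      have := neg_mem (add_mem hx (mul_mem_filtS (to1 x hx) e2 le_rfl))
      convert this using 1
      rw [mul_sub, mul_one, sub_mul, e, one_mul]
      abel
  exact ⟨fun x => to1 x (h1 x), h1⟩

theorem IsTransition.comp {θ θ' θ'' : π →* That (RatH π)} {U V : That (RatH π) ≃ₐ[ℚ] That (RatH π)}
    (hU : IsTransition θ θ' U) (hV : IsTransition θ' θ'' V) : IsTransition θ θ'' (V.trans U) :=
  ⟨hV.1.trans hU.1, fun x => by rw [AlgEquiv.trans_apply, hV.2, hU.2]⟩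

end Homology

/-! ### Transitions between Magnus expansions of a free group. -/

section FreeGroupExpansions

variable {α : Type} {θ θ' : FreeGroup α →* That (RatH (FreeGroup α))}

/-- The classes of the free generators form a basis of `H`, so their images may be prescribed. Thus
every Magnus expansion is a substitution in the standard one, which sends a generator `x` to `1 +
[x]`. -/
theorem IsMagnusExpansion.exists_isIA (hθ : IsMagnusExpansion θ) :
    ∃ V : That (RatH (FreeGroup α)) ≃ₐ[ℚ] That (RatH (FreeGroup α)), IsIA V ∧
      ∀ a, V (inclH (homClass (FreeGroup.of a))) = θ (FreeGroup.of a) - 1 := by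
  obtain ⟨f, hf⟩ := exists_linearMap (fun a => θ (FreeGroup.of a) - 1)
  have h : (filtS (RatH (FreeGroup α)) 2).mkQ ∘ₗ (f - inclH) = 0 := by
    refine linearMap_ext_of_closure (FreeGroup.closure_range_of α) ?_
    rintro _ ⟨a, rfl⟩
    rw [LinearMap.comp_apply, LinearMap.sub_apply, hf, LinearMap.zero_apply,
      Submodule.mkQ_apply, Submodule.Quotient.mk_eq_zero]
    exact hθ.one _
  obtain ⟨V, hV, hVf⟩ := FatgraphJohnson.exists_isIA (f := f) fun x => by
    have := LinearMap.congr_fun h x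
    rwa [LinearMap.comp_apply, LinearMap.zero_apply, Submodule.mkQ_apply,
      Submodule.Quotient.mk_eq_zero] at this
  exact ⟨V, hV, fun a => by rw [hVf, hf]⟩

/-- With `V` and `V'` the substitutions that produce `θ` and `θ'` from the standard expansion, the
transition is `V ∘ V'⁻¹`. -/
theorem exists_isTransition (hθ : IsMagnusExpansion θ) (hθ' : IsMagnusExpansion θ') :
    ∃ U, IsTransition θ θ' U := by
  obtain ⟨V, hV, hVθ⟩ := hθ.exists_isIA
  obtain ⟨V', hV', hVθ'⟩ := hθ'.exists_isIA
  refine ⟨V'.symm.trans V, hV'.symm.trans hV, ?_⟩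
  have : ((V'.symm.trans V : That (RatH (FreeGroup α)) ≃ₐ[ℚ] _) :
      That (RatH (FreeGroup α)) →* That (RatH (FreeGroup α))).comp θ' = θ := by
    refine FreeGroup.ext_hom _ _ fun a => ?_
    change V (V'.symm (θ' (FreeGroup.of a))) = θ (FreeGroup.of a)
    have h1 : θ' (FreeGroup.of a) = V' (inclH (homClass (FreeGroup.of a)) + 1) := by
      rw [map_add, map_one, hVθ', sub_add_cancel]
    rw [h1, V'.symm_apply_apply, map_add, map_one, hVθ, sub_add_cancel]
  exact fun x => DFunLike.congr_fun this x

/-- The condition fixes a transition only on the image of `θ'`. After composition with the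
substitution `V` producing `θ'`, these values determine the restriction to `H`, hence everything. -/
theorem IsTransition.unique (hθ' : IsMagnusExpansion θ')
    {U U' : That (RatH (FreeGroup α)) ≃ₐ[ℚ] That (RatH (FreeGroup α))}
    (hU : IsTransition θ θ' U) (hU' : IsTransition θ θ' U') : U = U' := by
  obtain ⟨V, hV, hVθ⟩ := hθ'.exists_isIA
  have key : V.trans U = V.trans U' := by
    refine (hV.trans hU.1).eq_of_eq_inclH (hV.trans hU'.1) fun x => ?_
    have : (V.trans U).toLinearMap ∘ₗ inclH = (V.trans U').toLinearMap ∘ₗ inclH := by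
      refine linearMap_ext_of_closure (FreeGroup.closure_range_of α) ?_
      rintro _ ⟨a, rfl⟩
      change U (V _) = U' (V _)
      rw [hVθ, map_sub, map_sub, map_one, map_one, hU.2, hU'.2]
    exact LinearMap.congr_fun this x
  refine AlgEquiv.ext fun a => ?_
  have := DFunLike.congr_fun key (V.symm a)
  rwa [AlgEquiv.trans_apply, AlgEquiv.trans_apply, V.apply_symm_apply] at this

theorem isTransition_transition (hθ : IsMagnusExpansion θ) (hθ' : IsMagnusExpansion θ') :
    IsTransition θ θ' (transition θ θ') :=
  Classical.epsilon_spec (exists_isTransition hθ hθ')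

theorem isTransition_iff (hθ : IsMagnusExpansion θ) (hθ' : IsMagnusExpansion θ')
    (U : That (RatH (FreeGroup α)) ≃ₐ[ℚ] That (RatH (FreeGroup α))) :
    IsTransition θ θ' U ↔ U = transition θ θ' :=
  ⟨fun h => h.unique hθ' (isTransition_transition hθ hθ'),
    fun h => h ▸ isTransition_transition hθ hθ'⟩

end FreeGroupExpansions

/-! ### Positions in the boundary cycle -/

namespace Fatgraph

variable {E : Type} (G : Fatgraph E)

theorem iterate_pos (x : E) : G.face^[G.pos x] G.tail = x :=
  Nat.sInf_mem (s := {k : ℕ | G.face^[k] G.tail = x}) (G.boundary x)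

theorem pos_le {x : E} {k : ℕ} (h : G.face^[k] G.tail = x) : G.pos x ≤ k :=
  Nat.sInf_le (s := {k : ℕ | G.face^[k] G.tail = x}) h

theorem pos_tail : G.pos G.tail = 0 := Nat.le_zero.mp (G.pos_le rfl)

theorem face_inj {x y : E} (h : G.face x = G.face y) : x = y := G.vert_inj (G.bar_inj h)

theorem bar_face (x : E) : G.bar (G.face x) = G.vert x := G.bar_bar _

theorem face_bar_tail : G.face (G.bar G.tail) = G.tail := by
  rw [face, G.univalent, G.bar_bar]

/-- The exception is necessary: from the reverse of the tail the boundary cycle closes up to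
position `0`. -/
theorem pos_face {x : E} (hx : x ≠ G.bar G.tail) : G.pos (G.face x) = G.pos x + 1 := by
  refine le_antisymm (G.pos_le ?_) ?_
  · rw [Function.iterate_succ_apply', G.iterate_pos]
  · have h := G.iterate_pos (G.face x)
    rcases hp : G.pos (G.face x) with _ | j
    · rw [hp, Function.iterate_zero, id] at h
      exact absurd (G.face_inj (h.symm.trans G.face_bar_tail.symm)) hx
    · rw [hp, Function.iterate_succ_apply'] at h
      exact Nat.succ_le_succ (G.pos_le (G.face_inj h))

/-- Induction along the boundary cycle. -/
theorem boundary_induction {P : E → Prop} (h0 : P G.tail)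
    (h1 : ∀ x, x ≠ G.bar G.tail → P x → P (G.face x)) (x : E) : P x := by
  have key : ∀ k, P (G.face^[k] G.tail) := by
    intro k
    induction k with
    | zero => exact h0
    | succ k ih =>
      rw [Function.iterate_succ_apply']
      by_cases h : G.face^[k] G.tail = G.bar G.tail
      · rw [h, G.face_bar_tail]; exact h0
      · exact h1 _ h ih
  rw [← G.iterate_pos x]
  exact key _

end Fatgraph

/-! ### The logarithm of the fatgraph Magnus expansion -/

namespace MarkedFatgraph

variable {E π : Type} [Group π] {δ : π} (G : MarkedFatgraph E π δ)

theorem mark_bar_eq (x : E) : G.mark (G.bar x) = (G.mark x)⁻¹ :=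
  eq_inv_of_mul_eq_one_left (G.mark_bar x)

theorem ellUpTo_succ_sub_mem (n : ℕ) (x : E) :
    ellUpTo G (n + 1) x - ellUpTo G n x ∈ filtS (RatH π) (n + 1) := by
  cases n with
  | zero => rw [ellUpTo, ellUpTo, sub_zero]; exact inclH_mem _
  | succ n => rw [ellUpTo, add_sub_cancel_left]; exact incl_mem _ _

theorem ellUpTo_sub_mem {m n : ℕ} (h : n ≤ m) (x : E) :
    ellUpTo G m x - ellUpTo G n x ∈ filtS (RatH π) (n + 1) := by
  induction m, h using Nat.le_induction with
  | base => rw [sub_self]; exact Submodule.zero_mem _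
  | succ m h ih =>
    have := add_mem (filtS_anti (by omega) (ellUpTo_succ_sub_mem G m x)) ih
    rwa [sub_add_sub_cancel] at this

theorem cf_ell (n : ℕ) (x : E) : cf n (ell G x) = cf n (ellUpTo G n x) := cf_ofComp _ _

theorem ell_sub_ellUpTo_mem (n : ℕ) (x : E) :
    ell G x - ellUpTo G n x ∈ filtS (RatH π) (n + 1) := by
  rw [mem_filtS]
  intro k hk
  rw [map_sub, cf_ell, sub_eq_zero]
  exact (cf_eq_of_sub_mem (ellUpTo_sub_mem G (Nat.le_of_lt_succ hk) x) k.lt_succ_self).symm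

theorem ellUpTo_mem (n : ℕ) (x : E) : ellUpTo G n x ∈ filtS (RatH π) 1 := by
  have := ellUpTo_sub_mem G n.zero_le x
  rwa [ellUpTo, sub_zero] at this

theorem ell_mem (x : E) : ell G x ∈ filtS (RatH π) 1 := by
  have := ell_sub_ellUpTo_mem G 0 x
  rwa [ellUpTo, sub_zero] at this

theorem cf_ellUpTo_eq_zero {n k : ℕ} (h : n < k) (x : E) : cf k (ellUpTo G n x) = 0 := by
  induction n with
  | zero => rw [ellUpTo, map_zero]
  | succ n ih =>
    cases n with
    | zero => rw [ellUpTo, cf_inclH, if_neg (by omega)]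
    | succ n => rw [ellUpTo, map_add, ih (by omega), cf_incl, if_neg (by omega), add_zero]

/-- The sum of the Hausdorff terms at the corners of the boundary cycle before `x`. -/
def potential (L : E → That (RatH π)) (x : E) : That (RatH π) :=
  ∑ i ∈ Finset.range (G.pos x), haus (L (G.face^[i] G.tail)) (-L (G.face^[i + 1] G.tail))

/-- The sum over a path is the difference of the potential at its ends. Exchanging `x` and its
reverse changes the sign, so one formula covers both cases of the definition, and no later argument
needs to know which of the two edges comes first. -/
theorem pathSum_eq (L : E → That (RatH π)) (x : E) :
    pathSum G L x = (1 / 3 : ℚ) • (potential G L x - potential G L (G.bar x)) := by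
  have key : ∀ y z, G.pos y ≤ G.pos z → ∑ i ∈ Finset.range (G.pos z - G.pos y),
      haus (L (G.face^[i] y)) (-L (G.face^[i + 1] y)) = potential G L z - potential G L y := by
    intro y z h
    rw [potential, potential, ← Finset.sum_Ico_eq_sub _ h, Finset.sum_Ico_eq_sum_range]
    refine Finset.sum_congr rfl fun i _ => ?_
    have h1 := Function.iterate_add_apply G.face i (G.pos y) G.tail
    have h2 := Function.iterate_add_apply G.face (i + 1) (G.pos y) G.tail
    rw [G.iterate_pos, add_comm] at h1 h2
    rw [← h1, ← h2, add_assoc]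
  unfold pathSum
  dsimp only
  split_ifs with h
  · rw [key x _ h.le]; module
  · rw [G.bar_bar, key _ _ (not_lt.mp h)]; module

theorem potential_tail (L : E → That (RatH π)) : potential G L G.tail = 0 := by
  rw [potential, G.pos_tail, Finset.sum_range_zero]

theorem potential_face (L : E → That (RatH π)) {x : E} (hx : x ≠ G.bar G.tail) :
    potential G L (G.face x) = potential G L x + haus (L x) (-L (G.face x)) := by
  rw [potential, G.pos_face hx, Finset.sum_range_succ, Function.iterate_succ_apply',
    G.iterate_pos]; rfl

theorem potential_mem {L : E → That (RatH π)} (hL : ∀ x, L x ∈ filtS (RatH π) 1) (x : E) :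
    potential G L x ∈ filtS (RatH π) 2 :=
  Submodule.sum_mem _ fun _ _ => haus_mem (hL _) (neg_mem (hL _))

theorem pathSum_mem {L : E → That (RatH π)} (hL : ∀ x, L x ∈ filtS (RatH π) 1) (x : E) :
    pathSum G L x ∈ filtS (RatH π) 2 := by
  rw [pathSum_eq]
  exact Submodule.smul_mem _ _ (sub_mem (potential_mem G hL _) (potential_mem G hL _))

theorem potential_congr {L L' : E → That (RatH π)} (hL : ∀ x, L x ∈ filtS (RatH π) 1)
    (hL' : ∀ x, L' x ∈ filtS (RatH π) 1) {n : ℕ} (h : ∀ x, L' x - L x ∈ filtS (RatH π) n) (x : E) :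
    potential G L' x - potential G L x ∈ filtS (RatH π) (n + 1) := by
  rw [potential, potential, ← Finset.sum_sub_distrib]
  refine Submodule.sum_mem _ fun i _ =>
    haus_congr (hL _) (neg_mem (hL _)) (hL' _) (neg_mem (hL' _)) (h _) ?_
  have := neg_mem (h (G.face^[i + 1] G.tail))
  rwa [neg_sub, ← neg_sub_neg] at this

theorem pathSum_congr {L L' : E → That (RatH π)} (hL : ∀ x, L x ∈ filtS (RatH π) 1)
    (hL' : ∀ x, L' x ∈ filtS (RatH π) 1) {n : ℕ} (h : ∀ x, L' x - L x ∈ filtS (RatH π) n) (x : E) :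
    pathSum G L' x - pathSum G L x ∈ filtS (RatH π) (n + 1) := by
  rw [pathSum_eq, pathSum_eq, ← smul_sub]
  have := sub_mem (potential_congr G hL hL' h x) (potential_congr G hL hL' h (G.bar x))
  rw [sub_sub_sub_comm] at this
  exact Submodule.smul_mem _ _ this

/-- The recursion for the logarithm of the fatgraph Magnus expansion. -/
theorem ell_eq_pathSum (x : E) :
    ell G x = inclH (homClass (G.mark x)) + pathSum G (ell G) x := by
  refine ext_cf fun k => ?_
  rw [cf_ell, map_add]
  have h2 := pathSum_mem G (ell_mem G) x
  match k with
  | 0 =>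
    rw [mem_filtS.mp h2 0 two_pos, ellUpTo, map_zero, cf_inclH, if_neg zero_ne_one, add_zero]
  | 1 => rw [mem_filtS.mp h2 1 one_lt_two, ellUpTo, add_zero]
  | n + 2 =>
    have h := pathSum_congr G (ellUpTo_mem G (n + 1)) (ell_mem G) (ell_sub_ellUpTo_mem G (n + 1)) x
    rw [cf_inclH, if_neg (by omega), zero_add, cf_eq_of_sub_mem h (show n + 2 < _ by omega),
      ellUpTo, map_add, cf_ellUpTo_eq_zero G (by omega), zero_add, cf_incl, if_pos rfl]
    rfl

theorem ell_eq (x : E) : ell G x = inclH (homClass (G.mark x)) +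
    (1 / 3 : ℚ) • (potential G (ell G) x - potential G (ell G) (G.bar x)) := by
  rw [← pathSum_eq, ← ell_eq_pathSum]

theorem ell_bar (x : E) : ell G (G.bar x) = -ell G x := by
  rw [ell_eq G x, ell_eq G (G.bar x), mark_bar_eq, homClass_inv, map_neg, G.bar_bar]
  module

/-- Since `ℓ` is odd under reversal, the term of a corner depends on two consecutive edges pointing
into the same vertex. -/
theorem potential_ell_face {x : E} (hx : x ≠ G.bar G.tail) :
    potential G (ell G) (G.face x) = potential G (ell G) x + haus (ell G x) (ell G (G.vert x)) := by
  rw [potential_face G _ hx, ← ell_bar, Fatgraph.bar_face]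

theorem ell_sub_mem (x : E) : ell G x - inclH (homClass (G.mark x)) ∈ filtS (RatH π) 2 := by
  rw [ell_eq_pathSum, add_sub_cancel_left]
  exact pathSum_mem G (ell_mem G) x

/-- The sum of `ℓ` over the edges at a trivalent vertex. -/
theorem ell_add_ell_add_ell {x : E} (hx : x ≠ G.bar G.tail) :
    ell G x + ell G (G.vert x) + ell G (G.vert (G.vert x)) =
      -(1 / 3 : ℚ) • (haus (ell G x) (ell G (G.vert x)) +
        haus (ell G (G.vert x)) (ell G (G.vert (G.vert x))) +
        haus (ell G (G.vert (G.vert x))) (ell G x)) := by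
  have hy := G.vert_ne_tail hx
  have hz := G.vert_ne_tail hy
  have h3 := (G.trivalent x hx).1
  have e1 := potential_ell_face G hx
  have e2 := potential_ell_face G hy
  have e3 := potential_ell_face G hz
  have hm : homClass (G.mark x) + homClass (G.mark (G.vert x)) +
      homClass (G.mark (G.vert (G.vert x))) = 0 := by
    rw [← homClass_mul, ← homClass_mul, G.mark_vert x hx, homClass_one]
  have hm' := congrArg inclH hm
  rw [map_add, map_add, map_zero] at hm'
  have p1 := ell_eq G x
  have p2 := ell_eq G (G.vert x)
  have p3 := ell_eq G (G.vert (G.vert x))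
  -- The reverse of an edge into the vertex is the boundary successor of the edge before it. The six
  -- values of the potential therefore cancel except for the three corner terms.
  have b1 : G.bar x = G.face (G.vert (G.vert x)) := by rw [Fatgraph.face, h3]
  rw [b1, e3, h3] at p1
  rw [show G.bar (G.vert x) = G.face x from rfl, e1] at p2
  rw [show G.bar (G.vert (G.vert x)) = G.face (G.vert x) from rfl, e2] at p3
  refine (congrArg₂ (· + ·) (congrArg₂ (· + ·) p1 p2) p3).trans ?_
  rw [add_eq_zero_iff_eq_neg'] at hm'
  rw [hm']
  module

end MarkedFatgraph

/-! ### From the additive to the multiplicative relation at a vertex. -/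

section VertexRelation

variable {H : Type} [AddCommGroup H] [Module ℚ H]

/-- If the product is `1` up to order `n`, then `X + Y + h(X, Y)` and `-Z` agree to order `n`, and
the first-order rule for the exponential gives the next degree. -/
theorem texp_triple_sub_mem {X Y Z : That H} (hX : X ∈ filtS H 1) (hY : Y ∈ filtS H 1)
    (hZ : Z ∈ filtS H 1) {n : ℕ} (h : texp X * texp Y * texp Z - 1 ∈ filtS H n) :
    texp X * texp Y * texp Z - 1 - (X + Y + Z + haus X Y) ∈ filtS H (n + 1) := by
  have hK : X + Y + haus X Y ∈ filtS H 1 :=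
    add_mem (add_mem hX hY) (filtS_anti one_le_two (haus_mem hX hY))
  rw [← texp_hausdorff hX hY] at h ⊢
  have hZ' := neg_mem hZ
  have e1 : texp (X + Y + haus X Y) - texp (-Z) =
      (texp (X + Y + haus X Y) * texp Z - 1) * texp (-Z) := by
    rw [sub_mul, mul_assoc, texp_mul_texp_neg hZ, mul_one, one_mul]
  have h1 : texp (X + Y + haus X Y) - texp (-Z) ∈ filtS H n := by
    rw [e1]; exact mul_mem_filtS_right _ h
  have h2 := texp_sub_texp_sub_mem hZ' hK (sub_mem_of_texp_sub_texp_mem hZ' hK h1)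
  have h3 := mul_mem_filtS h1 (texp_sub_one_mem le_rfl hZ) (r := n + 1) le_rfl
  convert add_mem h3 h2 using 1
  rw [mul_sub, sub_mul, texp_neg_mul_texp hZ, mul_one]
  abel

/-- Rotation is conjugation by `exp X`. It preserves the order of the deviation from `1` and does
not affect its leading term. -/
theorem texp_triple_rotate_mem {X Y Z : That H} (hX : X ∈ filtS H 1) {n : ℕ}
    (h : texp X * texp Y * texp Z - 1 ∈ filtS H n) :
    texp Y * texp Z * texp X - 1 ∈ filtS H n ∧
      texp Y * texp Z * texp X - texp X * texp Y * texp Z ∈ filtS H (n + 1) := by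
  have e : texp Y * texp Z * texp X - 1 =
      texp (-X) * (texp X * texp Y * texp Z - 1) * texp X := by
    rw [mul_sub, sub_mul, mul_one, texp_neg_mul_texp hX, mul_assoc (texp X), ← mul_assoc (texp (-X)),
      texp_neg_mul_texp hX, one_mul]
  have h1 : texp Y * texp Z * texp X - 1 ∈ filtS H n := by
    rw [e]; exact mul_mem_filtS_right _ (mul_mem_filtS_left _ h)
  refine ⟨h1, ?_⟩
  have hx := texp_sub_one_mem le_rfl hX
  have := sub_mem (mul_mem_filtS h hx (r := n + 1) le_rfl)
    (mul_mem_filtS hx h1 (r := n + 1) (by omega))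
  convert this using 1
  simp only [mul_sub, sub_mul, mul_one, one_mul, mul_assoc]
  abel

/-- Induction on the order. The deviation of the product from `1` is, to leading order, `X + Y + Z`
plus any one of the three Hausdorff terms, because all cyclic rotations have the same leading term.
The average of the three expressions is zero by hypothesis; this is the source of the factor `1/3`
in the definition of `ℓ`. -/
theorem texp_triple_eq_one {X Y Z : That H} (hX : X ∈ filtS H 1) (hY : Y ∈ filtS H 1)
    (hZ : Z ∈ filtS H 1)
    (h : X + Y + Z = -(1 / 3 : ℚ) • (haus X Y + haus Y Z + haus Z X)) :
    texp X * texp Y * texp Z = 1 := by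
  refine eq_of_forall_sub_mem_filtS fun n => ?_
  induction n with
  | zero => exact mem_filtS_zero _
  | succ n ih =>
    obtain ⟨i2, d2⟩ := texp_triple_rotate_mem hX ih
    obtain ⟨i3, d3⟩ := texp_triple_rotate_mem hY i2
    have h1 := texp_triple_sub_mem hX hY hZ ih
    have h2 := texp_triple_sub_mem hY hZ hX i2
    have h3 := texp_triple_sub_mem hZ hX hY i3
    have hs : haus Z X = -(3 : ℚ) • (X + Y + Z) - haus X Y - haus Y Z := by
      rw [h]; module
    rw [hs] at h3
    have := Submodule.smul_mem _ (1 / 3 : ℚ) (sub_mem (sub_mem (add_mem (add_mem h1 h2) h3)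
      (add_mem d2 d3)) d2)
    convert this using 1
    module

end VertexRelation

namespace MarkedFatgraph

/-! ### Existence and uniqueness of fatgraph Magnus expansions. -/

section Existence

variable {E π : Type} [Group π] {δ : π} (G : MarkedFatgraph E π δ)

theorem texp_ell_vertex {x : E} (hx : x ≠ G.bar G.tail) :
    texp (ell G x) * texp (ell G (G.vert x)) * texp (ell G (G.vert (G.vert x))) = 1 :=
  texp_triple_eq_one (ell_mem G _) (ell_mem G _) (ell_mem G _) (ell_add_ell_add_ell G hx)

/-- The labels of the edges, with the relations of the edges and vertices, present `π`. -/
def Presents : Prop :=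
  ∀ (K : Type) [Group K] (f : E → K), (∀ x, f (G.bar x) * f x = 1) →
    (∀ x, x ≠ G.bar G.tail → f x * f (G.vert x) * f (G.vert (G.vert x)) = 1) →
    ∃ θ : π →* K, ∀ x, θ (G.mark x) = f x

variable {G}

theorem Presents.exists_isFatgraphExpansion (hG : Presents G) : ∃ θ, IsFatgraphExpansion G θ := by
  -- A presentation produces homomorphisms into groups, so the exponentials are regarded as units.
  let f : E → (That (RatH π))ˣ := fun x =>
    ⟨texp (ell G x), texp (-ell G x), texp_mul_texp_neg (ell_mem G x),
      texp_neg_mul_texp (ell_mem G x)⟩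
  obtain ⟨θ, hθ⟩ := hG _ f
    (fun x => Units.ext (by
      change texp (ell G (G.bar x)) * texp (ell G x) = 1
      rw [ell_bar, texp_neg_mul_texp (ell_mem G x)]))
    (fun x hx => Units.ext (texp_ell_vertex G hx))
  exact ⟨(Units.coeHom _).comp θ, fun x => congrArg Units.val (hθ x)⟩

theorem IsFatgraphExpansion.unique {θ θ' : π →* That (RatH π)} (h : IsFatgraphExpansion G θ)
    (h' : IsFatgraphExpansion G θ') : θ = θ' := by
  refine MonoidHom.eq_of_eqOn_dense G.full_rank ?_
  rintro _ ⟨x, rfl⟩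
  rw [h x, h' x]

theorem IsFatgraphExpansion.isMagnusExpansion {θ : π →* That (RatH π)}
    (h : IsFatgraphExpansion G θ) : IsMagnusExpansion θ := by
  refine isMagnusExpansion_of_closure G.full_rank ?_
  rintro _ ⟨x, rfl⟩
  rw [h x]
  have := add_mem (texp_sub_one_sub_mem (ell_mem G x)) (ell_sub_mem G x)
  rwa [sub_add_sub_cancel] at this

theorem Presents.isFatgraphExpansion_magnus (hG : Presents G) :
    IsFatgraphExpansion G (magnus G) :=
  Classical.epsilon_spec hG.exists_isFatgraphExpansion

theorem Presents.isFatgraphExpansion_iff (hG : Presents G) (θ : π →* That (RatH π)) :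
    IsFatgraphExpansion G θ ↔ θ = magnus G :=
  ⟨fun h => h.unique hG.isFatgraphExpansion_magnus, fun h => h ▸ hG.isFatgraphExpansion_magnus⟩

theorem Presents.isMagnusExpansion (hG : Presents G) : IsMagnusExpansion (magnus G) :=
  hG.isFatgraphExpansion_magnus.isMagnusExpansion

/-- A Tietze transformation. A system `f` on the new fatgraph becomes one on the old fatgraph by
changing only the value on the moved edge. That value is dictated by one of the two old vertex
relations; the other follows from the two new relations together. -/
theorem Presents.whitehead (hG : Presents G) {e : E} (he : G.Movable e) :
    Presents (whitehead G e he) := by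
  intro K _ f hbar hvert
  change ∀ x, f (G.bar x) * f x = 1 at hbar
  change ∀ x, x ≠ G.bar G.tail → f x * f (whVert G.toFatgraph e x) *
    f (whVert G.toFatgraph e (whVert G.toFatgraph e x)) = 1 at hvert
  change ∃ θ : π →* K, ∀ x, θ (whMark G e x) = f x
  obtain ⟨h1, h2, h3, h4⟩ := he
  have h2' : G.bar e ≠ G.bar G.tail := fun h => h1 (G.bar_inj h)
  have bn := G.bar_ne e
  have inj : ∀ x y, G.vert x = G.vert y → x = y := fun _ _ => G.vert_inj
  obtain ⟨e1, e2⟩ := G.trivalent e h2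
  obtain ⟨f1, f2⟩ := G.trivalent _ h2'
  have tr := fun x hx => G.trivalent x hx
  have m1 : G.mark e * G.mark (G.vert e) * G.mark (G.vert (G.vert e)) = 1 := G.mark_vert e h2
  have nt := fun x hx => G.vert_ne_tail (x := x) hx
  have na := nt _ h2
  have nb := nt _ na
  have nc := nt _ h2'
  have nd := nt _ nc
  generalize ha : G.vert e = a at *
  generalize hb : G.vert a = b at *
  generalize hc : G.vert (G.bar e) = c at *
  generalize hd : G.vert c = d at *
  have v1 : whVert G.toFatgraph e b = c := by simp only [whVert]; grind
  have v2 : whVert G.toFatgraph e c = e := by simp only [whVert]; grind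
  have v4 : whVert G.toFatgraph e d = a := by simp only [whVert]; grind
  have v5 : whVert G.toFatgraph e a = G.bar e := by simp only [whVert]; grind
  have r1 := hvert b nb
  rw [v1, v2] at r1
  have r2 := hvert d nd
  rw [v4, v5] at r2
  have hbe : f (G.bar e) = (f e)⁻¹ := eq_inv_of_mul_eq_one_left (hbar e)
  have hfe : f e = (f b * f c)⁻¹ := eq_inv_of_mul_eq_one_right r1
  classical
  let f' : E → K := fun x =>
    if x = e then (f a * f b)⁻¹ else if x = G.bar e then f a * f b else f x
  have f'e : f' e = (f a * f b)⁻¹ := if_pos rfl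
  have f'e' : f' (G.bar e) = f a * f b := by simp only [f', if_neg bn, if_true]
  have f'n : ∀ x, x ≠ e → x ≠ G.bar e → f' x = f x := fun x hx hx' => by
    simp only [f', if_neg hx, if_neg hx']
  have f'a := f'n a (by grind) (by grind)
  have f'b := f'n b (by grind) (by grind)
  have f'c := f'n c (by grind) (by grind)
  have f'd := f'n d (by grind) (by grind)
  have rot : ∀ p q r : K, p * q * r = 1 → q * r * p = 1 := by
    intro p q r h
    rw [mul_assoc] at h
    exact mul_eq_one_comm.mp h
  have s1 : f' e * f' a * f' b = 1 := by rw [f'e, f'a, f'b]; group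
  have s2 : f' (G.bar e) * f' c * f' d = 1 := by
    rw [f'e', f'c, f'd]
    rw [hbe, hfe, inv_inv] at r2
    have r3 : f d * (f a * f b * f c) = 1 := by simpa only [mul_assoc] using r2
    exact mul_eq_one_comm.mp r3
  obtain ⟨θ, hθ⟩ := hG K f'
    (fun x => by
      by_cases hx : x = e
      · rw [hx, f'e, f'e', mul_inv_cancel]
      by_cases hx' : x = G.bar e
      · rw [hx', G.bar_bar, f'e, f'e', inv_mul_cancel]
      rw [f'n x hx hx', f'n _ (fun h => hx' (by rw [← h, G.bar_bar]))
        (fun h => hx (G.bar_inj h)), hbar])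
    (fun x hx => by
      by_cases c1 : x = e
      · rw [c1, ha, hb]; exact s1
      by_cases c2 : x = a
      · rw [c2, hb, e1]; exact rot _ _ _ s1
      by_cases c3 : x = b
      · rw [c3, e1, ha]; exact rot _ _ _ (rot _ _ _ s1)
      by_cases c4 : x = G.bar e
      · rw [c4, hc, hd]; exact s2
      by_cases c5 : x = c
      · rw [c5, hd, f1]; exact rot _ _ _ s2
      by_cases c6 : x = d
      · rw [c6, f1, hc]; exact rot _ _ _ (rot _ _ _ s2)
      obtain ⟨x1, x2⟩ := tr x hx
      have w1 : whVert G.toFatgraph e x = G.vert x := by simp only [whVert]; grind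
      have w2 : whVert G.toFatgraph e (G.vert x) = G.vert (G.vert x) := by
        simp only [whVert]; grind
      have := hvert x hx
      rw [w1, w2] at this
      rw [f'n x c1 c4, f'n _ (by grind) (by grind), f'n _ (by grind) (by grind), this])
  refine ⟨θ, fun x => ?_⟩
  have hmb : θ (G.mark b * G.mark c) = f b * f c := by rw [map_mul, hθ, hθ, f'b, f'c]
  simp only [whMark, ha, hb, hc]
  split_ifs with hx hx'
  · rw [map_inv, hmb, hx, hfe]
  · rw [hmb, hx', hbe, hfe, inv_inv]
  · rw [hθ, f'n x hx hx']

theorem Presents.moveTail (hG : Presents G) : Presents (moveTail G) := hG.whitehead _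

theorem Presents.iterate_moveTail (hG : Presents G) (i : ℕ) :
    Presents (MarkedFatgraph.moveTail^[i] G) := by
  induction i with
  | zero => exact hG
  | succ i ih => rw [Function.iterate_succ_apply']; exact ih.moveTail

end Existence

/-! ### Invariance of `ℓ` under isomorphism. -/

section Naturality

variable {E E' π : Type} [Group π] {δ δ' : π} {G : MarkedFatgraph E π δ}
  {G' : MarkedFatgraph E' π δ'} {σ : E ≃ E'}

theorem face_map (hbar : ∀ x, σ (G.bar x) = G'.bar (σ x)) (hvert : ∀ x, σ (G.vert x) = G'.vert (σ x))
    (k : ℕ) (x : E) : G'.face^[k] (σ x) = σ (G.face^[k] x) := by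
  induction k generalizing x with
  | zero => rfl
  | succ k ih =>
    rw [Function.iterate_succ_apply, Function.iterate_succ_apply, ← ih, Fatgraph.face,
      Fatgraph.face, hbar, hvert]

/-- The logarithm of the fatgraph Magnus expansion depends only on the fatgraph and on the
homology classes of the labels. -/
theorem ell_map (hbar : ∀ x, σ (G.bar x) = G'.bar (σ x))
    (hvert : ∀ x, σ (G.vert x) = G'.vert (σ x)) (htail : σ G.tail = G'.tail)
    (hmark : ∀ x, homClass (G'.mark (σ x)) = homClass (G.mark x)) (x : E) :
    ell G' (σ x) = ell G x := by
  have hf := face_map hbar hvert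
  have hpos : ∀ x, G'.pos (σ x) = G.pos x := fun x => by
    rw [Fatgraph.pos, Fatgraph.pos]
    congr 1
    ext k
    rw [Set.mem_ofPred_eq, Set.mem_ofPred_eq, ← htail, hf, σ.injective.eq_iff]
  have hup : ∀ n x, ellUpTo G' n (σ x) = ellUpTo G n x := by
    intro n
    induction n with
    | zero => intro x; rw [ellUpTo, ellUpTo]
    | succ n ih =>
      cases n with
      | zero => intro x; rw [ellUpTo, ellUpTo, hmark]
      | succ n =>
        have hp : ∀ x, potential G' (ellUpTo G' (n + 1)) (σ x) =
            potential G (ellUpTo G (n + 1)) x := fun x => by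
          rw [potential, potential, hpos]
          refine Finset.sum_congr rfl fun i _ => ?_
          rw [← htail, hf, hf, ih, ih]
        intro x
        rw [ellUpTo, ellUpTo, ih, pathSum_eq, pathSum_eq, ← hbar, hp, hp]
  refine ext_cf fun k => ?_
  rw [cf_ell, cf_ell, hup]

end Naturality

/-- Freeness gives `θ` from the values on the edges `x` and `y`. The vertex relations then determine
the values on `p`, `q` and the stems, and, by induction along the line, on the edges `c`. -/
theorem presents_symplecticFatgraph (n : ℕ) : Presents (symplecticFatgraph n) := by
  intro K _ f hbar hvert
  change ∀ x : Edge n × Bool, f (symBar x) * f x = 1 at hbar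
  change ∀ x : Edge n × Bool, x ≠ (.c (Fin.last n), false) →
    f x * f (symVert x) * f (symVert (symVert x)) = 1 at hvert
  have hb : ∀ e : Edge n, f (e, false) = (f (e, true))⁻¹ := fun e =>
    eq_inv_of_mul_eq_one_left (hbar (e, true))
  let θ : SurfaceGroup n →* K :=
    FreeGroup.lift (Sum.elim (fun i => f (.x i, true)) (fun i => f (.y i, true)))
  have hu : ∀ i, θ (genU i) = f (.x i, true) := fun i => FreeGroup.lift_apply_of
  have hv : ∀ i, θ (genV i) = f (.y i, true) := fun i => FreeGroup.lift_apply_of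
  have hp : ∀ i, f (.p i, true) = f (.x i, true) * f (.y i, true) := fun i => by
    have h := hvert (.x i, true) (by simp)
    simp only [symVert, hb] at h
    exact (mul_inv_eq_one.mp h).symm
  have hq : ∀ i, f (.q i, true) = (f (.x i, true))⁻¹ * (f (.y i, true))⁻¹ := fun i => by
    have h := hvert (.x i, false) (by simp)
    simp only [symVert, hb] at h
    exact (mul_inv_eq_one.mp h).symm
  have hcomm : ∀ i, θ (genComm i) = f (.p i, true) * f (.q i, true) := fun i => by
    simp only [genComm, map_mul, map_inv, hu, hv, hp, hq, mul_assoc]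
  have h0 : f (.c 0, true) = (θ (genComm 0))⁻¹ := by
    have h := hvert (.p 0, true) (by simp)
    simp only [symVert, Fin.cases_zero] at h
    rw [hcomm]
    exact eq_inv_of_mul_eq_one_right h
  have hs : ∀ j : Fin n, f (.s j, true) = (θ (genComm j.succ))⁻¹ := fun j => by
    have h := hvert (.p j.succ, true) (by simp)
    simp only [symVert, Fin.cases_succ] at h
    rw [hcomm]
    exact eq_inv_of_mul_eq_one_right h
  have hc : ∀ i : Fin (n + 1), f (.c i, true) = (θ (partialBoundary n (i + 1)))⁻¹ := by
    intro i
    induction i using Fin.induction with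
    | zero =>
      have h := partialBoundary_succ (n := n) 0
      rw [h0, h, Fin.val_zero, map_mul]
      simp [partialBoundary]
    | succ j ih =>
      have h := hvert (.c j.succ, true) (by simp)
      simp only [symVert, Fin.cases_succ, Fin.lastCases_castSucc, hb, hs, ih, inv_inv] at h
      rw [partialBoundary_succ j.succ, Fin.val_succ, map_mul]
      rw [mul_assoc] at h
      exact eq_inv_of_mul_eq_one_left h
  have hmark : ∀ e : Edge n, θ (symMark e) = f (e, true) := by
    rintro (i | i | i | i | i | j)
    · exact hu i
    · exact hv i
    · rw [symMark, map_mul, hu, hv, hp]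
    · rw [symMark, map_mul, map_inv, map_inv, hu, hv, hq]
    · rw [symMark, map_inv, hc]
    · rw [symMark, map_inv, hs]
  refine ⟨θ, ?_⟩
  rintro ⟨e, _ | _⟩
  · change θ (symMark e)⁻¹ = _
    rw [map_inv, hmark, hb]
  · exact hmark e

end MarkedFatgraph

/-! ### Moving the tail around the fatgraph -/

namespace Fatgraph

variable {E : Type} (G : Fatgraph E)

/-- The edge that precedes the tail in the cyclic order at the trivalent end of the tail. -/
def prevToTail : E := G.vert G.nextToTail

theorem tail_ne : G.tail ≠ G.bar G.tail := (G.bar_ne _).symm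

theorem vert_prevToTail : G.vert G.prevToTail = G.tail := (G.trivalent _ G.tail_ne).1

theorem nextToTail_ne : G.nextToTail ≠ G.tail ∧ G.nextToTail ≠ G.bar G.tail :=
  ⟨G.movable_nextToTail.ne_tail, G.movable_nextToTail.ne_bar_tail⟩

/-- The edges that remain when the tail and the edge next to it are removed. -/
def IsReduced (x : E) : Prop :=
  x ≠ G.tail ∧ x ≠ G.bar G.tail ∧ x ≠ G.nextToTail ∧ x ≠ G.bar G.nextToTail

theorem isReduced_bar {x : E} (h : G.IsReduced x) : G.IsReduced (G.bar x) := by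
  obtain ⟨h1, h2, h3, h4⟩ := h
  have bb := G.bar_bar
  refine ⟨?_, ?_, ?_, ?_⟩ <;> grind

theorem isReduced_prevToTail : G.IsReduced G.prevToTail := by
  obtain ⟨h1, h2, h3, h4⟩ := G.movable_nextToTail
  have hv := G.vert_ne_tail h2
  have ht := G.tail_ne
  have h5 := (G.trivalent _ h2).2
  refine ⟨fun h => ?_, hv, h5, h3⟩
  have := G.vert_prevToTail
  rw [h] at this
  exact h1 this

/-- The edge that follows the reverse of the edge next to the tail in the boundary cycle is not
the one before the reverse of the tail. -/
theorem face_bar_nextToTail_ne : G.face (G.bar G.nextToTail) ≠ G.prevToTail := by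
  intro h
  have key : ∀ x, x = G.tail ∨ x = G.bar G.nextToTail ∨ x = G.prevToTail ∨ x = G.bar G.tail := by
    refine G.boundary_induction (Or.inl rfl) ?_
    rintro x hx (rfl | rfl | rfl | rfl)
    · exact Or.inr (Or.inl rfl)
    · exact Or.inr (Or.inr (Or.inl h))
    · exact Or.inr (Or.inr (Or.inr (by rw [face, vert_prevToTail])))
    · exact absurd rfl hx
  obtain ⟨-, -, h3, h4⟩ := G.isReduced_prevToTail
  rcases key G.nextToTail with h | h | h | h
  · exact G.nextToTail_ne.1 h
  · exact G.bar_ne _ h.symm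
  · exact h3 h.symm
  · exact G.nextToTail_ne.2 h

open Classical in
/-- The boundary cycle of the fatgraph without its tail. -/
def redFace (x : E) : E :=
  -- Without the tail, its trivalent end becomes bivalent and the two remaining edges there merge
  -- into one, named after `prevToTail`. The cycle omits both orientations of the tail and of
  -- `nextToTail`.
  if x = G.prevToTail then G.face (G.bar G.nextToTail)
  else if G.face x = G.nextToTail then G.bar G.prevToTail else G.face x

theorem redFace_prevToTail : G.redFace G.prevToTail = G.face (G.bar G.nextToTail) := if_pos rfl

theorem face_nextToTail : G.face G.nextToTail = G.bar G.prevToTail := rfl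

theorem face_prevToTail : G.face G.prevToTail = G.bar G.tail := by rw [face, vert_prevToTail]

theorem face_tail : G.face G.tail = G.bar G.nextToTail := rfl

theorem isReduced_redFace {x : E} (hx : G.IsReduced x) : G.IsReduced (G.redFace x) := by
  obtain ⟨h1, h2, h3, h4⟩ := G.movable_nextToTail
  have inj : ∀ x y, G.face x = G.face y → x = y := fun _ _ => G.face_inj
  have hp := G.isReduced_bar G.isReduced_prevToTail
  have ht := G.face_tail
  have ht' := G.face_bar_tail
  have hf := G.face_prevToTail
  have hn := G.face_nextToTail
  have bn := G.bar_ne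
  have bb := G.bar_bar
  have hvf : ∀ y, G.face y = G.bar (G.vert y) := fun _ => rfl
  have hvp : G.vert G.nextToTail = G.prevToTail := rfl
  have hv3 := G.trivalent (G.bar G.nextToTail) (by grind)
  have hvp' := G.vert_prevToTail
  unfold redFace
  split_ifs with c1 c2
  · refine ⟨?_, ?_, ?_, ?_⟩ <;> grind
  · exact hp
  · obtain ⟨x1, x2, x3, x4⟩ := hx
    refine ⟨?_, ?_, ?_, ?_⟩ <;> grind

/-- The full boundary cycle is followed from the tail. On reaching `nextToTail`, which the reduced
cycle skips, the induction carries the claim for the edge after it instead; this is the second half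
of `key`. -/
theorem exists_redFace_iterate (x : E) (hx : G.IsReduced x) :
    ∃ j : ℕ, G.redFace^[j + 1] G.prevToTail = x := by
  have hp := G.isReduced_bar G.isReduced_prevToTail
  have key : ∀ x, (G.IsReduced x → ∃ j : ℕ, G.redFace^[j + 1] G.prevToTail = x) ∧
      (x = G.nextToTail → ∃ j : ℕ, G.redFace^[j + 1] G.prevToTail = G.bar G.prevToTail) := by
    refine G.boundary_induction ⟨fun h => absurd rfl h.1, fun h => absurd h.symm G.nextToTail_ne.1⟩
      fun y hy ih => ?_
    by_cases y1 : y = G.tail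
    · rw [y1, face_tail]
      exact ⟨fun h => absurd rfl h.2.2.2, fun h => absurd h (G.bar_ne _)⟩
    by_cases y2 : y = G.bar G.nextToTail
    · have h : G.redFace^[0 + 1] G.prevToTail = G.face y := by
        rw [zero_add, Function.iterate_one, redFace_prevToTail, y2]
      refine ⟨fun _ => ⟨0, h⟩, fun h' => ?_⟩
      have := G.isReduced_redFace G.isReduced_prevToTail
      rw [redFace_prevToTail, ← y2] at this
      exact absurd h' this.2.2.1
    by_cases y3 : y = G.nextToTail
    · rw [y3, face_nextToTail]
      exact ⟨fun _ => ih.2 y3, fun h => absurd h hp.2.2.1⟩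
    obtain ⟨j, hj⟩ := ih.1 ⟨y1, hy, y3, y2⟩
    by_cases y4 : y = G.prevToTail
    · rw [y4, face_prevToTail]
      exact ⟨fun h => absurd rfl h.2.1, fun h => absurd h.symm G.nextToTail_ne.2⟩
    have hj' : G.redFace^[j + 1 + 1] G.prevToTail = G.redFace y := by
      rw [Function.iterate_succ_apply', hj]
    by_cases y5 : G.face y = G.nextToTail
    · rw [redFace, if_neg y4, if_pos y5] at hj'
      exact ⟨fun h => absurd y5 h.2.2.1, fun _ => ⟨_, hj'⟩⟩
    · rw [redFace, if_neg y4, if_neg y5] at hj'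
      exact ⟨fun _ => ⟨_, hj'⟩, fun h => absurd h y5⟩
  exact (key x).1 hx

theorem isReduced_iterate (j : ℕ) : G.IsReduced (G.redFace^[j] G.prevToTail) := by
  induction j with
  | zero => exact G.isReduced_prevToTail
  | succ j ih => rw [Function.iterate_succ_apply']; exact G.isReduced_redFace ih

theorem card_isReduced [Fintype E] [DecidablePred G.IsReduced] :
    (Finset.univ.filter G.IsReduced).card = Fintype.card E - 4 := by
  classical
  have h : Finset.univ.filter G.IsReduced =
      ({G.tail, G.bar G.tail, G.nextToTail, G.bar G.nextToTail} : Finset E)ᶜ := by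
    ext x
    simp [IsReduced]
  obtain ⟨h1, h2⟩ := G.nextToTail_ne
  have bb := G.bar_bar
  have bn := G.bar_ne
  rw [h, Finset.card_compl]
  congr 1
  rw [Finset.card_insert_of_notMem, Finset.card_insert_of_notMem, Finset.card_insert_of_notMem,
    Finset.card_singleton]
  all_goals
    simp only [Finset.mem_insert, Finset.mem_singleton]
    grind

/-- The orbit of `prevToTail` is exactly the set of reduced edges, so the period is their number. -/
theorem minimalPeriod_redFace [Fintype E] :
    Function.minimalPeriod G.redFace G.prevToTail = Fintype.card E - 4 := by
  classical
  rw [← card_isReduced G]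
  set p := Function.minimalPeriod G.redFace G.prevToTail with hp
  have hpos : 0 < p := by
    obtain ⟨j, hj⟩ := G.exists_redFace_iterate _ G.isReduced_prevToTail
    exact Function.IsPeriodicPt.minimalPeriod_pos j.succ_pos hj
  rw [← Finset.card_range p]
  refine Finset.card_bij (fun i _ => G.redFace^[i] G.prevToTail) ?_ ?_ ?_
  · intro i _
    exact Finset.mem_filter.mpr ⟨Finset.mem_univ _, G.isReduced_iterate i⟩
  · intro i hi j hj h
    exact Function.iterate_injOn_Iio_minimalPeriod (Finset.mem_range.mp hi)
      (Finset.mem_range.mp hj) h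
  · intro x hx
    obtain ⟨j, hj⟩ := G.exists_redFace_iterate x (Finset.mem_filter.mp hx).2
    exact ⟨(j + 1) % p, Finset.mem_range.mpr (Nat.mod_lt _ hpos), by
      rw [hp, Function.iterate_mod_minimalPeriod_eq, hj]⟩

/-- Every edge of the reduced fatgraph is met once when the tail moves around. -/
theorem card_filter_redFace_iterate [Fintype E] [DecidableEq E] {x : E} (hx : G.IsReduced x) :
    ((Finset.range (Fintype.card E - 4)).filter
      fun i => G.redFace^[i + 1] G.prevToTail = x).card = 1 := by
  rw [← minimalPeriod_redFace]
  set p := Function.minimalPeriod G.redFace G.prevToTail with hp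
  obtain ⟨j, hj⟩ := G.exists_redFace_iterate x hx
  have hpos : 0 < p := by
    obtain ⟨j, hj⟩ := G.exists_redFace_iterate _ G.isReduced_prevToTail
    exact Function.IsPeriodicPt.minimalPeriod_pos j.succ_pos hj
  rw [Finset.card_eq_one]
  refine ⟨j % p, ?_⟩
  ext i
  rw [Finset.mem_filter, Finset.mem_singleton, Finset.mem_range, ← hj]
  constructor
  · rintro ⟨hi, h⟩
    -- Applying `p - 1` further steps turns the exponents `i + 1` and `j + 1` into `i + p` and `j +
    -- p`, which the period reduces to `i` and `j`.
    have h' := congrArg G.redFace^[p - 1] h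
    rw [← Function.iterate_add_apply, ← Function.iterate_add_apply,
      show p - 1 + (i + 1) = i + p by omega, show p - 1 + (j + 1) = j + p by omega, hp,
      Function.iterate_add_minimalPeriod_eq, Function.iterate_add_minimalPeriod_eq,
      ← Function.iterate_mod_minimalPeriod_eq (n := j)] at h'
    exact Function.iterate_injOn_Iio_minimalPeriod hi (Nat.mod_lt _ hpos) h'
  · rintro rfl
    refine ⟨Nat.mod_lt _ hpos, ?_⟩
    rw [Function.iterate_succ_apply', Function.iterate_mod_minimalPeriod_eq,
      Function.iterate_succ_apply']

end Fatgraph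

theorem Fatgraph.redFace_cases {E : Type} (G : Fatgraph E) (x : E) :
    (x = G.prevToTail ∧ G.redFace x = G.face (G.bar G.nextToTail)) ∨
    (x ≠ G.prevToTail ∧ G.face x = G.nextToTail ∧ G.redFace x = G.bar G.prevToTail) ∨
    (x ≠ G.prevToTail ∧ G.face x ≠ G.nextToTail ∧ G.redFace x = G.face x) := by
  unfold Fatgraph.redFace
  split_ifs with h1 h2
  exacts [Or.inl ⟨h1, rfl⟩, Or.inr (Or.inl ⟨h1, h2, rfl⟩), Or.inr (Or.inr ⟨h1, h2, rfl⟩)]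

/-! ### One move of the tail: cyclic orders, renaming and labels. -/

namespace MarkedFatgraph

variable {E π : Type} [Group π] {δ : π} (G : MarkedFatgraph E π δ)

theorem moveTail_bar (x : E) : (moveTail G).bar x = G.bar x := rfl

theorem moveTail_tail : (moveTail G).tail = G.tail := rfl

theorem mark_tail : G.mark G.tail = δ⁻¹ := by
  have h := mark_bar_eq G G.tail
  rw [G.geometric] at h
  exact inv_eq_iff_eq_inv.mp h.symm

theorem mark_nextToTail : G.mark G.nextToTail = δ * (G.mark G.prevToTail)⁻¹ := by
  have h := G.mark_vert G.tail G.tail_ne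
  rw [mark_tail] at h
  change δ⁻¹ * G.mark G.nextToTail * G.mark G.prevToTail = 1 at h
  rw [← eq_inv_of_mul_eq_one_left h, mul_inv_cancel_left]

/-- The edge opposite to the tail, in the move of the tail. -/
def pastTail : E := G.vert (G.bar G.nextToTail)

theorem bar_pastTail : G.bar G.pastTail = G.face (G.bar G.nextToTail) := rfl

/-- The distinctness relations of the edges near the tail. -/
theorem pastTail_facts : G.pastTail ≠ G.tail ∧ G.pastTail ≠ G.bar G.tail ∧
    G.pastTail ≠ G.nextToTail ∧ G.pastTail ≠ G.bar G.nextToTail ∧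
    G.pastTail ≠ G.prevToTail ∧ G.pastTail ≠ G.bar G.prevToTail := by
  have hr := G.isReduced_redFace G.isReduced_prevToTail
  rw [Fatgraph.redFace_prevToTail, ← bar_pastTail] at hr
  obtain ⟨h1, h2, h3, h4⟩ := hr
  have h5 := G.face_bar_nextToTail_ne
  rw [← bar_pastTail] at h5
  have bb := G.bar_bar
  refine ⟨by grind, by grind, by grind, by grind, fun h => ?_, by grind⟩
  exact G.bar_ne _ (G.vert_inj h)

theorem moveTail_vert (x : E) : (moveTail G).vert x = whVert G.toFatgraph G.nextToTail x := rfl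

/-- The cyclic orders after a move of the tail. -/
theorem moveTail_vert_facts :
    (moveTail G).vert G.tail = G.pastTail ∧ (moveTail G).vert G.pastTail = G.nextToTail ∧
    (moveTail G).vert G.nextToTail = G.tail ∧
    (moveTail G).vert (G.vert G.pastTail) = G.prevToTail ∧
    (moveTail G).vert G.prevToTail = G.bar G.nextToTail ∧
    (moveTail G).vert (G.bar G.nextToTail) = G.vert G.pastTail ∧
    ∀ x, x ≠ G.tail → x ≠ G.pastTail → x ≠ G.nextToTail → x ≠ G.vert G.pastTail →
      x ≠ G.prevToTail → x ≠ G.bar G.nextToTail → (moveTail G).vert x = G.vert x := by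
  obtain ⟨h1, h2, h3, h4⟩ := G.movable_nextToTail
  have h2' : G.bar G.nextToTail ≠ G.bar G.tail := fun h => h1 (G.bar_inj h)
  have inj : ∀ x y, G.vert x = G.vert y → x = y := fun _ _ => G.vert_inj
  have bn := G.bar_ne G.nextToTail
  have hb := G.vert_prevToTail
  obtain ⟨e1, e2⟩ := G.trivalent _ h2
  obtain ⟨f1, f2⟩ := G.trivalent _ h2'
  simp only [moveTail_vert, whVert]
  simp only [Fatgraph.prevToTail, pastTail] at *
  refine ⟨?_, ?_, ?_, ?_, ?_, ?_, fun x _ _ _ _ _ _ => ?_⟩ <;> grind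

theorem moveTail_nextToTail : (moveTail G).nextToTail = G.pastTail := (moveTail_vert_facts G).1

theorem moveTail_prevToTail : (moveTail G).prevToTail = G.nextToTail := by
  rw [Fatgraph.prevToTail, moveTail_nextToTail]
  exact (moveTail_vert_facts G).2.1

open Classical in
/-- The renaming of the edges in a move of the tail, which extends the identification of the edges
of the fatgraph without its tail. -/
def movePerm : Equiv.Perm E :=
  Equiv.swap G.nextToTail (G.bar G.pastTail) * Equiv.swap (G.bar G.nextToTail) G.pastTail

theorem movePerm_facts :
    movePerm G G.nextToTail = G.bar G.pastTail ∧ movePerm G (G.bar G.nextToTail) = G.pastTail ∧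
    movePerm G G.pastTail = G.bar G.nextToTail ∧ movePerm G (G.bar G.pastTail) = G.nextToTail ∧
    ∀ x, x ≠ G.nextToTail → x ≠ G.bar G.nextToTail → x ≠ G.pastTail → x ≠ G.bar G.pastTail →
      movePerm G x = x := by
  obtain ⟨h1, h2, h3, h4, h5, h6⟩ := pastTail_facts G
  have bb := G.bar_bar
  have bn := G.bar_ne
  simp only [movePerm, Equiv.Perm.mul_apply, Equiv.swap_apply_def]
  refine ⟨?_, ?_, ?_, ?_, fun x _ _ _ _ => ?_⟩ <;> grind

theorem movePerm_bar (x : E) : movePerm G (G.bar x) = G.bar (movePerm G x) := by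
  obtain ⟨h1, h2, h3, h4, h5⟩ := movePerm_facts G
  have bb := G.bar_bar
  by_cases c1 : x = G.nextToTail
  · rw [c1, h1, h2, bb]
  by_cases c2 : x = G.bar G.nextToTail
  · rw [c2, bb, h1, h2]
  by_cases c3 : x = G.pastTail
  · rw [c3, h3, h4, bb]
  by_cases c4 : x = G.bar G.pastTail
  · rw [c4, bb, h3, h4]
  rw [h5 x c1 c2 c3 c4, h5 _ (by grind) (by grind) (by grind) (by grind)]

theorem movePerm_tail : movePerm G G.tail = G.tail := by
  obtain ⟨h1, h2⟩ := G.nextToTail_ne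
  obtain ⟨h3, h4, -⟩ := pastTail_facts G
  have bb := G.bar_bar
  exact (movePerm_facts G).2.2.2.2 _ (by grind) (by grind) (by grind) (by grind)

theorem movePerm_prevToTail_redFace :
    movePerm G (G.redFace G.prevToTail) = (moveTail G).prevToTail := by
  rw [Fatgraph.redFace_prevToTail, ← bar_pastTail, moveTail_prevToTail]
  exact (movePerm_facts G).2.2.2.1

/-- Moving the tail does not change the boundary cycle of the fatgraph without its tail. -/
theorem redFace_moveTail {x : E} (hx : G.IsReduced x) :
    (moveTail G).redFace (movePerm G x) = movePerm G (G.redFace x) := by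
  have hR := G.isReduced_redFace hx
  obtain ⟨p1, p2, p3, p4, p5, p6⟩ := pastTail_facts G
  obtain ⟨v1, v2, v3, v4, v5, v6, v7⟩ := moveTail_vert_facts G
  obtain ⟨m1, m2, m3, m4, m5⟩ := movePerm_facts G
  obtain ⟨n1, n2⟩ := G.nextToTail_ne
  obtain ⟨a1, a2, a3, a4⟩ := G.isReduced_prevToTail
  obtain ⟨x1, x2, x3, x4⟩ := hx
  have inj : ∀ x y, G.vert x = G.vert y → x = y := fun _ _ => G.vert_inj
  have bb := G.bar_bar
  have bn := G.bar_ne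
  have t1 : G.vert G.tail = G.nextToTail := rfl
  have t2 : G.vert G.nextToTail = G.prevToTail := rfl
  have t3 := G.vert_prevToTail
  have t4 : G.vert (G.bar G.nextToTail) = G.pastTail := rfl
  have t5 := G.univalent
  have t6 : G.vert (G.vert G.pastTail) = G.bar G.nextToTail := (G.trivalent _ (by grind)).1
  have tri : ∀ y, y ≠ G.bar G.tail → G.vert y ≠ y := fun y hy => (G.trivalent y hy).2
  have r := G.redFace_cases x
  have r' := (moveTail G).redFace_cases (movePerm G x)
  rw [moveTail_prevToTail, moveTail_nextToTail] at r'
  simp only [Fatgraph.face, moveTail_bar] at r r'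
  obtain ⟨y1, y2, y3, y4⟩ := hR
  generalize (moveTail G).redFace (movePerm G x) = R' at *
  generalize G.redFace x = R at *
  generalize (moveTail G).vert = V at *
  generalize movePerm G = ψ at *
  generalize G.pastTail = c at *
  generalize G.nextToTail = e at *
  generalize G.prevToTail = a at *
  generalize G.tail = t at *
  generalize G.vert = v at *
  generalize G.bar = B at *
  by_cases c1 : x = c
  · subst c1; grind
  by_cases c2 : x = B c
  · subst c2
    -- Here the edge opposite to the tail may be a loop returning to the same vertex, and its
    -- boundary successor is then affected by the move too.
    by_cases c5 : B c = v c
    · grind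
    · have ca : B c ≠ a := fun h => p6 (by rw [← h, bb])
      have hV : V (B c) = v (B c) := v7 _ x1 c1 x3 c5 ca x4
      have hvc : v (B c) ≠ c := fun h => x4 (inj _ _ (h.trans t4.symm))
      have hvb : v (B c) ≠ B c := tri _ x2
      obtain h | ⟨-, h, -⟩ | ⟨-, -, h⟩ := r
      · exact absurd h.1 ca
      · exact absurd (inj _ _ (by rw [t6, ← h, bb])) c5
      · have := m5 R y3 y4 (by grind) (by grind)
        grind
  have hψ : ψ x = x := m5 x x3 x4 c1 c2
  rw [hψ] at r'
  by_cases c3 : x = a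
  · subst c3; grind
  by_cases c4 : x = v c
  · subst c4; grind
  grind

/-- The labels after a move of the tail. -/
theorem mark_moveTail {x : E} (hx : G.IsReduced x) : (moveTail G).mark (movePerm G x) =
    (open Classical in if G.redFace G.prevToTail = G.bar x then δ⁻¹ else 1) * G.mark x *
    (open Classical in if G.redFace G.prevToTail = x then δ else 1) := by
  obtain ⟨p1, p2, p3, p4, p5, p6⟩ := pastTail_facts G
  obtain ⟨m1, m2, m3, m4, m5⟩ := movePerm_facts G
  obtain ⟨x1, x2, x3, x4⟩ := hx
  have bb := G.bar_bar
  have bn := G.bar_ne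
  have hb : G.vert (G.vert G.nextToTail) = G.tail := G.vert_prevToTail
  have hm : ∀ y, (moveTail G).mark y = whMark G G.nextToTail y := fun _ => rfl
  -- The new label is the inverse of the product of the labels of the tail and `pastTail`, and the
  -- tail has label `δ⁻¹`.
  have hm1 : (moveTail G).mark G.nextToTail = G.mark (G.bar G.pastTail) * δ := by
    rw [hm, whMark, if_pos rfl, hb, mark_tail, mul_inv_rev, inv_inv, mark_bar_eq]; rfl
  have hm2 : (moveTail G).mark (G.bar G.nextToTail) = δ⁻¹ * G.mark G.pastTail := by
    rw [← moveTail_bar, mark_bar_eq, hm1, mark_bar_eq, mul_inv_rev, inv_inv]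
  have hm3 : ∀ y, y ≠ G.nextToTail → y ≠ G.bar G.nextToTail → (moveTail G).mark y = G.mark y :=
    fun y h h' => by rw [hm, whMark]; simp only [if_neg h, if_neg h']
  rw [Fatgraph.redFace_prevToTail, ← bar_pastTail]
  by_cases c1 : x = G.pastTail
  · rw [c1, m3, hm2, if_pos rfl, if_neg (G.bar_ne _), mul_one]
  by_cases c2 : x = G.bar G.pastTail
  · rw [c2, m4, hm1, if_pos rfl, if_neg (by rw [bb]; exact bn _), one_mul]
  rw [m5 x x3 x4 c1 c2, hm3 x x3 x4, if_neg (fun h => c1 (G.bar_inj h).symm),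
    if_neg (fun h => c2 h.symm), one_mul, mul_one]

end MarkedFatgraph

/-! ### Iterated moves of the tail, and the full turn. -/

namespace MarkedFatgraph

variable {E π : Type} [Group π] {δ : π} (G : MarkedFatgraph E π δ)

theorem iterate_moveTail_bar (k : ℕ) (x : E) : (moveTail^[k] G).bar x = G.bar x := by
  induction k with
  | zero => rfl
  | succ k ih => rw [Function.iterate_succ_apply', moveTail_bar, ih]

theorem iterate_moveTail_tail (k : ℕ) : (moveTail^[k] G).tail = G.tail := by
  induction k with
  | zero => rfl
  | succ k ih => rw [Function.iterate_succ_apply', moveTail_tail, ih]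

/-- The renaming of the edges in a sequence of moves of the tail. -/
def iterPerm : ℕ → Equiv.Perm E
  | 0 => 1
  | k + 1 => movePerm (moveTail^[k] G) * iterPerm k

theorem iterPerm_succ (k : ℕ) (x : E) :
    iterPerm G (k + 1) x = movePerm (moveTail^[k] G) (iterPerm G k x) := rfl

theorem iterPerm_bar (k : ℕ) (x : E) : iterPerm G k (G.bar x) = G.bar (iterPerm G k x) := by
  induction k with
  | zero => rfl
  | succ k ih =>
    rw [iterPerm_succ, iterPerm_succ, ih, ← iterate_moveTail_bar G k, movePerm_bar,
      iterate_moveTail_bar]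

theorem iterPerm_tail (k : ℕ) : iterPerm G k G.tail = G.tail := by
  induction k with
  | zero => rfl
  | succ k ih => rw [iterPerm_succ, ih, ← iterate_moveTail_tail G k, movePerm_tail]

/-- Each renaming sends the edge next to the tail to the reverse of the new one, so the orientation
depends on the parity of the number of moves. -/
theorem iterPerm_nextToTail (k : ℕ) : iterPerm G k G.nextToTail =
    if Even k then (moveTail^[k] G).nextToTail else G.bar (moveTail^[k] G).nextToTail := by
  induction k with
  | zero => rfl
  | succ k ih =>
    obtain ⟨h1, h2, -⟩ := movePerm_facts (moveTail^[k] G)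
    rw [iterPerm_succ, ih, Function.iterate_succ_apply', moveTail_nextToTail]
    by_cases h : Even k
    · rw [if_pos h, if_neg (by rw [Nat.even_add_one, not_not]; exact h), h1, iterate_moveTail_bar]
    · rw [if_neg h, if_pos (Nat.even_add_one.mpr h), ← iterate_moveTail_bar G k, h2]

theorem isReduced_iterPerm {x : E} (hx : G.IsReduced x) (k : ℕ) :
    (moveTail^[k] G).IsReduced (iterPerm G k x) := by
  obtain ⟨h1, h2, h3, h4⟩ := hx
  have ht := iterPerm_tail G k
  have hn := iterPerm_nextToTail G k
  have hb := iterPerm_bar G k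
  have bb := G.bar_bar
  have inj := (iterPerm G k).injective
  refine ⟨fun h => ?_, fun h => ?_, fun h => ?_, fun h => ?_⟩
  · rw [iterate_moveTail_tail, ← ht] at h
    exact h1 (inj h)
  · rw [iterate_moveTail_tail, iterate_moveTail_bar, ← ht, ← hb] at h
    exact h2 (inj h)
  · split_ifs at hn
    · exact h3 (inj (h.trans hn.symm))
    · exact h4 (inj (by rw [hb, hn, bb, h]))
  · rw [iterate_moveTail_bar] at h
    split_ifs at hn
    · exact h4 (inj (by rw [hb, hn, h]))
    · exact h3 (inj (h.trans hn.symm))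

theorem redFace_iterPerm {x : E} (hx : G.IsReduced x) (k : ℕ) :
    (moveTail^[k] G).redFace (iterPerm G k x) = iterPerm G k (G.redFace x) := by
  induction k with
  | zero => rfl
  | succ k ih =>
    rw [iterPerm_succ, iterPerm_succ, Function.iterate_succ_apply',
      redFace_moveTail _ (isReduced_iterPerm G hx k), ih]

theorem iterPerm_iterate (k : ℕ) :
    iterPerm G k (G.redFace^[k] G.prevToTail) = (moveTail^[k] G).prevToTail := by
  induction k with
  | zero => rfl
  | succ k ih =>
    rw [iterPerm_succ, Function.iterate_succ_apply' G.redFace,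
      ← redFace_iterPerm G (G.isReduced_iterate k), ih, movePerm_prevToTail_redFace,
      Function.iterate_succ_apply']

-- In its first `k` moves the tail passes along the successors of `prevToTail` in the reduced cycle.
-- The exponents count how often it passes along the reverse of `x` and along `x`.
open Classical in
theorem mark_iterPerm {x : E} (hx : G.IsReduced x) (k : ℕ) :
    (moveTail^[k] G).mark (iterPerm G k x) =
      δ⁻¹ ^ ((Finset.range k).filter
        fun i => G.redFace^[i + 1] G.prevToTail = G.bar x).card * G.mark x *
      δ ^ ((Finset.range k).filter fun i => G.redFace^[i + 1] G.prevToTail = x).card := by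
  induction k with
  | zero =>
    change G.mark x = δ⁻¹ ^ 0 * G.mark x * δ ^ 0
    rw [pow_zero, pow_zero, one_mul, mul_one]
  | succ k ih =>
    have hk : (moveTail^[k] G).redFace (moveTail^[k] G).prevToTail =
        iterPerm G k (G.redFace^[k + 1] G.prevToTail) := by
      rw [← iterPerm_iterate, redFace_iterPerm G (G.isReduced_iterate k),
        Function.iterate_succ_apply']
    rw [iterPerm_succ, Function.iterate_succ_apply',
      mark_moveTail _ (isReduced_iterPerm G hx k), ih, hk, iterate_moveTail_bar, ← iterPerm_bar,
      (iterPerm G k).injective.eq_iff, (iterPerm G k).injective.eq_iff, Finset.range_add_one,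
      Finset.filter_insert, Finset.filter_insert]
    have hn : k ∉ Finset.range k := Finset.notMem_range_self
    split_ifs with h1 h2 h2
    · exact absurd (h1.symm.trans h2) (G.bar_ne x)
    · rw [Finset.card_insert_of_notMem (fun h => hn (Finset.mem_filter.mp h).1), pow_succ', mul_one]
      simp only [mul_assoc]
    · rw [Finset.card_insert_of_notMem (fun h => hn (Finset.mem_filter.mp h).1), pow_succ, one_mul]
      simp only [mul_assoc]
    · rw [one_mul, mul_one]

theorem Iso.symm {E E' : Type} {G : MarkedFatgraph E π δ} {G' : MarkedFatgraph E' π δ}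
    (h : Iso G G') : Iso G' G := by
  obtain ⟨σ, h1, h2, h3, h4⟩ := h
  refine ⟨σ.symm, fun x => ?_, fun x => ?_, ?_, fun x => ?_⟩
  · rw [Equiv.symm_apply_eq, h1, σ.apply_symm_apply]
  · rw [Equiv.symm_apply_eq, h2, σ.apply_symm_apply]
  · rw [Equiv.symm_apply_eq, h3]
  · rw [← h4, σ.apply_symm_apply]

/-- Moving the tail once around the fatgraph is the boundary twist. -/
theorem iso_iterate_moveTail [Fintype E] (φ : MulAction.stabilizer (MulAut π) δ)
    (hφ : ∀ x, φ.1 x = δ⁻¹ * x * δ) (heven : Even (Fintype.card E - 4)) :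
    Iso (moveTail^[Fintype.card E - 4] G) (act φ G) := by
  classical
  set N := Fintype.card E - 4 with hN
  set G' := moveTail^[N] G with hG'
  set σ := iterPerm G N with hσ
  have hbar : ∀ x, G'.bar x = G.bar x := iterate_moveTail_bar G N
  have htail : G'.tail = G.tail := iterate_moveTail_tail G N
  have sbar : ∀ x, σ (G.bar x) = G'.bar (σ x) := fun x => by rw [hbar]; exact iterPerm_bar G N x
  have stail : σ G.tail = G'.tail := by rw [htail]; exact iterPerm_tail G N
  -- The number of moves must be even here; otherwise the edge would return reversed.
  have snext : σ G.nextToTail = G'.nextToTail := by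
    have := iterPerm_nextToTail G N
    rwa [if_pos heven] at this
  have sprev : σ G.prevToTail = G'.prevToTail := by
    have h := iterPerm_iterate G N
    rwa [hN, ← G.minimalPeriod_redFace, Function.iterate_minimalPeriod, G.minimalPeriod_redFace]
      at h
  have sred : ∀ x, G.IsReduced x → G'.redFace (σ x) = σ (G.redFace x) := fun x hx =>
    redFace_iterPerm G hx N
  have smark : ∀ x, G.IsReduced x → G'.mark (σ x) = δ⁻¹ * G.mark x * δ := fun x hx => by
    have := mark_iterPerm G hx N
    rwa [G.card_filter_redFace_iterate hx, G.card_filter_redFace_iterate (G.isReduced_bar hx),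
      pow_one, pow_one] at this
  -- The full boundary cycle is recovered from the reduced one, given the tail and its two
  -- neighbours.
  have sface : ∀ x, σ (G.face x) = G'.face (σ x) := by
    intro x
    by_cases x1 : x = G.tail
    · rw [x1, stail, G.face_tail, G'.face_tail, sbar, snext]
    by_cases x2 : x = G.bar G.tail
    · rw [x2, sbar, stail, G.face_bar_tail, G'.face_bar_tail, stail]
    by_cases x3 : x = G.nextToTail
    · rw [x3, snext, G.face_nextToTail, G'.face_nextToTail, sbar, sprev]
    by_cases x4 : x = G.bar G.nextToTail
    · rw [x4, sbar, snext, ← G.redFace_prevToTail, ← G'.redFace_prevToTail, ← sprev,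
        sred _ G.isReduced_prevToTail]
    have hr := sred x ⟨x1, x2, x3, x4⟩
    have c := G.redFace_cases x
    have c' := G'.redFace_cases (σ x)
    rw [← sprev, σ.injective.eq_iff] at c'
    rcases c with ⟨c, -⟩ | ⟨c, d, h⟩ | ⟨c, d, h⟩
    · rw [c, G.face_prevToTail, sprev, G'.face_prevToTail, sbar, stail]
    · rcases c' with ⟨c', -⟩ | ⟨-, d', h'⟩ | ⟨-, d', h'⟩
      · exact absurd c' c
      · rw [d, snext, d']
      · rw [h, h', sbar, sprev, ← G'.face_nextToTail, ← snext] at hr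
        exact absurd (σ.injective (G'.face_inj hr)) x3
    · rcases c' with ⟨c', -⟩ | ⟨-, d', h'⟩ | ⟨-, d', h'⟩
      · exact absurd c' c
      · rw [h, h', ← sbar] at hr
        exact absurd (G.face_inj ((σ.injective hr).symm.trans G.face_nextToTail.symm)) x3
      · rw [← h, ← hr, h']
  refine Iso.symm (G' := G') (G := act φ G) ⟨σ, sbar, fun x => ?_, stail, fun x => ?_⟩
  · change σ (G.vert x) = G'.vert (σ x)
    rw [← G.bar_face, ← G'.bar_face, sbar, sface]
  · change G'.mark (σ x) = φ.1 (G.mark x)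
    rw [hφ]
    have ht : G'.mark (σ G.tail) = δ⁻¹ * G.mark G.tail * δ := by
      rw [stail, mark_tail, mark_tail]; group
    -- This edge is not reduced, but the relation at the end of the tail expresses its label by `δ`
    -- and the label of `prevToTail`.
    have he : G'.mark (σ G.nextToTail) = δ⁻¹ * G.mark G.nextToTail * δ := by
      rw [snext, mark_nextToTail, mark_nextToTail, ← sprev, smark _ G.isReduced_prevToTail]; group
    have hb : ∀ y, G'.mark (σ y) = δ⁻¹ * G.mark y * δ →
        G'.mark (σ (G.bar y)) = δ⁻¹ * G.mark (G.bar y) * δ := fun y hy => by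
      rw [sbar, mark_bar_eq, mark_bar_eq, hy]; group
    by_cases x1 : x = G.tail
    · rw [x1]; exact ht
    by_cases x2 : x = G.bar G.tail
    · rw [x2]; exact hb _ ht
    by_cases x3 : x = G.nextToTail
    · rw [x3]; exact he
    by_cases x4 : x = G.bar G.nextToTail
    · rw [x4]; exact hb _ he
    exact smark x ⟨x1, x2, x3, x4⟩

end MarkedFatgraph

/-- The edges of the symplectic fatgraph, in bijection with a sum of finite sets. -/
def edgeEquiv (n : ℕ) : Edge n ≃ (Fin 5 × Fin (n + 1)) ⊕ Fin n where
  toFun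
    | .x i => Sum.inl (0, i)
    | .y i => Sum.inl (1, i)
    | .p i => Sum.inl (2, i)
    | .q i => Sum.inl (3, i)
    | .c i => Sum.inl (4, i)
    | .s j => Sum.inr j
  invFun
    | Sum.inl (0, i) => .x i
    | Sum.inl (1, i) => .y i
    | Sum.inl (2, i) => .p i
    | Sum.inl (3, i) => .q i
    | Sum.inl (4, i) => .c i
    | Sum.inr j => .s j
  left_inv := by rintro (i | i | i | i | i | j) <;> rfl
  right_inv := by
    rintro (⟨k, i⟩ | j)
    · fin_cases k <;> rfl
    · rfl

instance (n : ℕ) : Fintype (Edge n) := Fintype.ofEquiv _ (edgeEquiv n).symm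

/-- There are `6n + 5` unoriented edges. With genus `g = n + 1` the result is the number `12g - 6`
of moves. -/
theorem card_edge_sub_four (n : ℕ) : Fintype.card (Edge n × Bool) - 4 = 12 * n + 6 := by
  rw [Fintype.card_prod, Fintype.card_congr (edgeEquiv n), Fintype.card_sum, Fintype.card_prod,
    Fintype.card_fin, Fintype.card_fin, Fintype.card_fin, Fintype.card_bool]
  omega

theorem iso_symplecticFatgraph_boundaryTwist (n : ℕ) :
    MarkedFatgraph.Iso (MarkedFatgraph.moveTail^[12 * n + 6] (symplecticFatgraph n))
      (MarkedFatgraph.act (boundaryTwist n) (symplecticFatgraph n)) := by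
  rw [← card_edge_sub_four]
  refine MarkedFatgraph.iso_iterate_moveTail _ _ (fun x => ?_) ?_
  · change MulAut.conj (boundaryClass n)⁻¹ x = _
    rw [MulAut.conj_apply, inv_inv]
  · rw [card_edge_sub_four]
    exact ⟨6 * n + 3, by ring⟩

/-! ### Half brackets, and the third component of a composite. -/

section Components

variable {H : Type} [AddCommGroup H] [Module ℚ H]

theorem That.neg_mul (X Y : That H) : -X * Y = -(X * Y) := _root_.neg_mul X Y

theorem That.mul_neg (X Y : That H) : X * -Y = -(X * Y) := _root_.mul_neg X Y

/-- Half the commutator, the quadratic part of the Hausdorff series. -/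
def halfBracket (X Y : That H) : That H := (1 / 2 : ℚ) • (X * Y - Y * X)

/-- The three classes at a trivalent vertex add up to zero. By this identity and the next one, all
three corners there carry the same half bracket. -/
theorem halfBracket_neg_add_left (X Y : That H) : halfBracket (-(X + Y)) X = halfBracket X Y := by
  simp only [halfBracket, That.neg_mul, That.mul_neg, add_mul, mul_add]
  congr 1; abel

theorem halfBracket_neg_add_right (X Y : That H) : halfBracket Y (-(X + Y)) = halfBracket X Y := by
  simp only [halfBracket, That.neg_mul, That.mul_neg, add_mul, mul_add]
  congr 1; abel

theorem halfBracket_self_neg (X : That H) : halfBracket X (-X) = 0 := by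
  simp only [halfBracket, That.neg_mul, That.mul_neg, sub_self, smul_zero]

theorem halfBracket_neg_self (X : That H) : halfBracket (-X) X = 0 := by
  simp only [halfBracket, That.neg_mul, That.mul_neg, sub_self, smul_zero]

theorem halfBracket_neg_neg (X Y : That H) : halfBracket (-X) (-Y) = halfBracket X Y := by
  simp only [halfBracket, That.neg_mul, That.mul_neg, neg_neg]

theorem halfBracket_zero_left (X : That H) : halfBracket 0 X = 0 := by
  simp only [halfBracket, zero_mul, mul_zero, sub_self, smul_zero]

theorem halfBracket_zero_right (X : That H) : halfBracket X 0 = 0 := by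
  simp only [halfBracket, zero_mul, mul_zero, sub_self, smul_zero]

theorem coe_johnsonComponent (m : ℕ) (U : That H ≃ₐ[ℚ] That H) (h : H) :
    (johnsonComponent m U h : TensorAlgebra ℚ H) = cf (m + 1) (U (inclH h) - inclH h) := rfl

theorem trans_sub_mem {U V : That H ≃ₐ[ℚ] That H} (hU : IsIA U) {k : ℕ}
    (hU1 : ∀ x, U (inclH x) - inclH x ∈ filtS H k) (hV1 : ∀ x, V (inclH x) - inclH x ∈ filtS H k)
    (x : H) : (V.trans U) (inclH x) - inclH x ∈ filtS H k := by
  have := add_mem (hU.mem _ _ (hV1 x)) (hU1 x)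
  rwa [map_sub, sub_add_sub_cancel] at this

/-- The third component is additive on automorphisms with vanishing first component. -/
theorem johnsonComponent_three_trans {U V : That H ≃ₐ[ℚ] That H} (hU : IsIA U)
    (hU1 : ∀ x, U (inclH x) - inclH x ∈ filtS H 3) (hV1 : ∀ x, V (inclH x) - inclH x ∈ filtS H 3) :
    johnsonComponent 3 (V.trans U) = johnsonComponent 3 U + johnsonComponent 3 V := by
  refine LinearMap.ext fun h => Subtype.ext ?_
  rw [LinearMap.add_apply, Submodule.coe_add, coe_johnsonComponent, coe_johnsonComponent,
    coe_johnsonComponent, AlgEquiv.trans_apply, ← map_add]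
  -- `V` changes `h` in degree three and above, and `U` changes that correction only two degrees
  -- higher. The cross term begins in degree five and does not reach the third component, which has
  -- degree four.
  have h5 := algHom_sub_mem (U := U.toAlgHom) (k := 2) hU.mem hU1 (hV1 h)
  refine cf_eq_of_sub_mem (p := 5) ?_ (by omega)
  convert h5 using 1
  change _ = U (V (inclH h) - inclH h) - _
  rw [map_sub]
  abel

end Components

/-! ### The quadratic part of `ℓ` under a move of the tail. -/

namespace MarkedFatgraph

variable {E π : Type} [Group π] {δ : π} (G : MarkedFatgraph E π δ)

/-- The homology class of the label of an edge, in degree one. -/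
def edgeClass (x : E) : That (RatH π) := inclH (homClass (G.mark x))

theorem edgeClass_mem (x : E) : edgeClass G x ∈ filtS (RatH π) 1 := inclH_mem _

theorem edgeClass_bar (x : E) : edgeClass G (G.bar x) = -edgeClass G x := by
  rw [edgeClass, mark_bar_eq, homClass_inv, map_neg]; rfl

theorem edgeClass_vertex {x : E} (hx : x ≠ G.bar G.tail) :
    edgeClass G x + edgeClass G (G.vert x) + edgeClass G (G.vert (G.vert x)) = 0 := by
  rw [edgeClass, edgeClass, edgeClass, ← map_add, ← map_add, ← homClass_mul, ← homClass_mul,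
    G.mark_vert x hx, homClass_one, map_zero]

theorem edgeClass_tail (hδ : homClass δ = 0) : edgeClass G G.tail = 0 := by
  rw [edgeClass, mark_tail, homClass_inv, hδ, neg_zero, map_zero]

/-- The quadratic part of the potential. -/
theorem potential_face_sub_mem {x : E} (hx : x ≠ G.bar G.tail) :
    potential G (ell G) (G.face x) - potential G (ell G) x -
      halfBracket (edgeClass G x) (edgeClass G (G.vert x)) ∈ filtS (RatH π) 3 := by
  rw [potential_ell_face G hx, add_sub_cancel_left]
  have h1 := haus_congr (edgeClass_mem G x) (edgeClass_mem G (G.vert x)) (ell_mem G x)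
    (ell_mem G (G.vert x)) (ell_sub_mem G x) (ell_sub_mem G (G.vert x))
  have h2 := haus_sub_quadratic_mem (edgeClass_mem G x) (edgeClass_mem G (G.vert x))
  have := add_mem h1 h2
  rwa [sub_add_sub_cancel] at this

/-- The quadratic part of `ℓ` can be computed from any function with the recursion of the
potential in degree two. -/
theorem ell_sub_mem_of_potential {Q : E → That (RatH π)} (h0 : Q G.tail ∈ filtS (RatH π) 3)
    (h : ∀ x, x ≠ G.bar G.tail → Q (G.face x) - Q x -
      halfBracket (edgeClass G x) (edgeClass G (G.vert x)) ∈ filtS (RatH π) 3) (x : E) :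
    ell G x - (edgeClass G x + (1 / 3 : ℚ) • (Q x - Q (G.bar x))) ∈ filtS (RatH π) 3 := by
  have key : ∀ x, potential G (ell G) x - Q x ∈ filtS (RatH π) 3 := by
    refine G.boundary_induction ?_ fun x hx ih => ?_
    · rw [potential_tail, zero_sub]; exact neg_mem h0
    · have := add_mem (sub_mem (potential_face_sub_mem G hx) (h x hx)) ih
      convert this using 1
      abel
  have := Submodule.smul_mem _ (1 / 3 : ℚ) (sub_mem (key x) (key (G.bar x)))
  rw [ell_eq]
  convert this using 1
  rw [edgeClass]
  module

theorem edgeClass_moveTail {x : E} (h1 : x ≠ G.nextToTail) (h2 : x ≠ G.bar G.nextToTail) :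
    edgeClass (moveTail G) x = edgeClass G x := by
  have : (moveTail G).mark x = whMark G G.nextToTail x := rfl
  rw [edgeClass, this, whMark]
  simp only [if_neg h1, if_neg h2]
  rfl

theorem edgeClass_moveTail_nextToTail (hδ : homClass δ = 0) :
    edgeClass (moveTail G) G.nextToTail = -edgeClass G G.pastTail := by
  have hv := edgeClass_vertex (moveTail G) (x := G.tail) G.tail_ne
  obtain ⟨p1, p2, p3, p4, p5, p6⟩ := pastTail_facts G
  obtain ⟨v1, v2, -⟩ := moveTail_vert_facts G
  have ht : edgeClass (moveTail G) G.tail = 0 := edgeClass_tail (moveTail G) hδ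
  rw [v1, v2, ht, zero_add, edgeClass_moveTail G p3 p4] at hv
  exact eq_neg_of_add_eq_zero_right hv

/-- The effect of a move of the tail on the quadratic part of the potential. -/
theorem exists_potential_after_move {H : Type} [AddCommGroup H] [Module ℚ H] {v V B : E → E}
    {t e a c d : E} {k k' p : E → That H}
    (inj : ∀ x y, v x = v y → x = y) (bb : ∀ x, B (B x) = x) (bn : ∀ x, B x ≠ x)
    (t1 : v t = e) (t2 : v e = a) (t3 : v a = t) (t4 : v (B e) = c) (t5 : v (B t) = B t)
    (t6 : v d = B e) (t7 : v c = d)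
    (n1 : e ≠ t) (n2 : e ≠ B t)
    (a1 : a ≠ t) (a2 : a ≠ B t) (a3 : a ≠ e) (a4 : a ≠ B e)
    (p1 : c ≠ t) (p2 : c ≠ B t) (p3 : c ≠ e) (p4 : c ≠ B e)
    (v1 : V t = c) (v2 : V c = e) (v3 : V e = t) (v4 : V d = a) (v5 : V a = B e) (v6 : V (B e) = d)
    (v7 : ∀ x, x ≠ t → x ≠ c → x ≠ e → x ≠ d → x ≠ a → x ≠ B e → V x = v x)
    (kt : k t = 0) (ke : k (B e) = -(k c + k d)) (ka : k a = -(k c + k d)) (kea : k e = -k a)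
    (ke' : k' e = -k c) (kbe' : k' (B e) = k c) (kn : ∀ y, y ≠ e → y ≠ B e → k' y = k y)
    (pt : p t = 0) (pf : ∀ y, y ≠ B t →
      p (B (v y)) - p y - halfBracket (k y) (k (v y)) ∈ filtS H 3) :
    ∃ Q : E → That H, Q t ∈ filtS H 3 ∧
      (∀ y, y ≠ B t → Q (B (V y)) - Q y - halfBracket (k' y) (k' (V y)) ∈ filtS H 3) ∧
      ∀ x, x ≠ e → x ≠ B e → Q x - Q (B x) = p x - p (B x) := by
  classical
  have binj : ∀ x y, B x = B y → x = y := fun x y h => by rw [← bb x, h, bb]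
  have hbe : B e ≠ B t := by grind
  have hbet : B e ≠ t := by grind
  have d1 : d ≠ t := by grind
  have d2 : d ≠ B t := by grind
  have d3 : d ≠ e := by grind
  have d4 : d ≠ B e := by grind
  have htbe : t ≠ B e := by grind
  obtain ⟨φ, hφ⟩ : ∃ φ, φ = halfBracket (k c) (k d) := ⟨_, rfl⟩
  -- The old cycle passes from the tail over `B e` to `B c`, collecting the corner term `φ`. The new
  -- cycle goes from the tail straight to `B c`, where the vanishing class of the tail gives zero,
  -- so the values are lowered by `φ`. The shift is regained at the new corner from `a` to `e`, just
  -- before `B t`. The value at `B e` comes from the corner after `c`, whose half bracket is zero.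
  obtain ⟨Q, Qt, Qt', Qe, Qe', Qn⟩ : ∃ Q : E → That H, Q t = 0 ∧ Q (B t) = p (B t) ∧ Q e = p a ∧
      Q (B e) = p c - φ ∧ ∀ y, y ≠ t → y ≠ B t → y ≠ e → y ≠ B e → Q y = p y - φ := by
    refine ⟨fun y => if y = t then 0 else if y = B t then p (B t) else if y = e then p a
      else if y = B e then p c - φ else p y - φ, ?_, ?_, ?_, ?_, fun y h1 h2 h3 h4 => ?_⟩
    · exact if_pos rfl
    · simp only [if_neg (bn t), if_true]
    · simp only [if_neg n1, if_neg n2, if_true]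
    · simp only [if_neg hbet, if_neg hbe, if_neg (bn e), if_true]
    · simp only [if_neg h1, if_neg h2, if_neg h3, if_neg h4]
  have Qb : ∀ y, y ≠ t → y ≠ B t → y ≠ e → y ≠ B e → Q (B y) = p (B y) - φ := by
    intro y h1 h2 h3 h4
    exact Qn _ (fun h => h2 (by rw [← h, bb])) (fun h => h1 (binj _ _ h))
      (fun h => h4 (by rw [← h, bb])) (fun h => h3 (binj _ _ h))
  have f1 := pf t (bn t).symm
  have f2 := pf (B e) hbe
  have f3 := pf d d2
  have f4 := pf e n2
  have f5 := pf c p2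
  have f6 := pf a a2
  rw [t1, pt, kt, halfBracket_zero_left, sub_zero, sub_zero] at f1
  rw [t4, ke, halfBracket_neg_add_left, ← hφ] at f2
  rw [t6, bb, ke, halfBracket_neg_add_right, ← hφ] at f3
  rw [t2, kea, halfBracket_neg_self, sub_zero] at f4
  rw [t7, ← hφ] at f5
  rw [t3, kt, halfBracket_zero_right, sub_zero] at f6
  refine ⟨Q, by rw [Qt]; exact Submodule.zero_mem _, fun y hy => ?_, fun x hx1 hx2 => ?_⟩
  · by_cases y1 : y = t
    · rw [y1, v1, Qt, Qb c p1 p2 p3 p4, kn t n1.symm htbe, kt, halfBracket_zero_left]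
      convert add_mem f1 f2 using 1
      abel
    by_cases y2 : y = c
    · rw [y2, v2, Qe', Qn c p1 p2 p3 p4, kn c p3 p4, ke', halfBracket_self_neg, sub_self,
        sub_zero]
      exact Submodule.zero_mem _
    by_cases y3 : y = e
    · rw [y3, v3, Qt', Qe, kn t n1.symm htbe, kt, halfBracket_zero_right, sub_zero]
      exact f6
    by_cases y4 : y = d
    · rw [y4, v4, Qb a a1 a2 a3 a4, Qn d d1 d2 d3 d4, kn d d3 d4, kn a a3 a4, ka,
        halfBracket_neg_add_right, ← hφ]
      convert add_mem f3 f4 using 1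
      abel
    by_cases y5 : y = a
    · rw [y5, v5, bb, Qe, Qn a a1 a2 a3 a4, kn a a3 a4, kbe', ka, halfBracket_neg_add_left,
        ← hφ, sub_sub_cancel, sub_self]
      exact Submodule.zero_mem _
    by_cases y6 : y = B e
    · rw [y6, v6, Qb d d1 d2 d3 d4, Qe', kbe', kn d d3 d4, ← hφ]
      convert f5 using 1
      abel
    have w1 : v y ≠ t := fun h => y5 (inj _ _ (h.trans t3.symm))
    have w2 : v y ≠ B t := fun h => hy (inj _ _ (h.trans t5.symm))
    have w3 : v y ≠ e := fun h => y1 (inj _ _ (h.trans t1.symm))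
    have w4 : v y ≠ B e := fun h => y4 (inj _ _ (h.trans t6.symm))
    rw [v7 y y1 y2 y3 y4 y5 y6, Qn y y1 hy y3 y6, Qb (v y) w1 w2 w3 w4, kn y y3 y6,
      kn (v y) w3 w4, sub_sub_sub_cancel_right]
    exact pf y hy
  · by_cases x1 : x = t
    · rw [x1, Qt, Qt', pt]
    by_cases x2 : x = B t
    · rw [x2, bb, Qt, Qt', pt]
    rw [Qn x x1 x2 hx1 hx2, Qb x x1 x2 hx1 hx2, sub_sub_sub_cancel_right]

/-- Moving the tail does not change the quadratic part of `ℓ`. -/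
theorem ell_moveTail_sub_mem (hδ : homClass δ = 0) {x : E} (hx1 : x ≠ G.nextToTail)
    (hx2 : x ≠ G.bar G.nextToTail) :
    ell (moveTail G) x - ell G x ∈ filtS (RatH π) 3 := by
  obtain ⟨p1, p2, p3, p4, p5, p6⟩ := pastTail_facts G
  obtain ⟨v1, v2, v3, v4, v5, v6, v7⟩ := moveTail_vert_facts G
  obtain ⟨n1, n2⟩ := G.nextToTail_ne
  obtain ⟨a1, a2, a3, a4⟩ := G.isReduced_prevToTail
  have hbe : G.bar G.nextToTail ≠ G.bar G.tail := fun h => n1 (G.bar_inj h)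
  have et : edgeClass G G.tail = 0 := edgeClass_tail G hδ
  have ee : edgeClass G (G.bar G.nextToTail) =
      -(edgeClass G G.pastTail + edgeClass G (G.vert G.pastTail)) := by
    have h := edgeClass_vertex G hbe
    rw [add_assoc] at h
    exact eq_neg_of_add_eq_zero_left h
  have ea : edgeClass G G.prevToTail = -edgeClass G G.nextToTail := by
    have h := edgeClass_vertex G G.tail_ne
    rw [et, zero_add] at h
    exact eq_neg_of_add_eq_zero_right h
  have ee' := edgeClass_moveTail_nextToTail G hδ
  obtain ⟨Q, Q1, Q2, Q3⟩ := exists_potential_after_move (v := G.vert) (V := (moveTail G).vert)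
    (B := G.bar) (t := G.tail) (e := G.nextToTail) (a := G.prevToTail) (c := G.pastTail)
    (d := G.vert G.pastTail) (k := edgeClass G) (k' := edgeClass (moveTail G))
    (p := potential G (ell G)) (fun _ _ => G.vert_inj) G.bar_bar G.bar_ne rfl rfl G.vert_prevToTail
    rfl G.univalent (G.trivalent _ hbe).1 rfl n1 n2 a1 a2 a3 a4 p1 p2 p3 p4 v1 v2 v3 v4 v5 v6 v7
    et ee (by rw [ea, ← ee, edgeClass_bar]) (by rw [ea, neg_neg]) ee'
    (by
      change edgeClass (moveTail G) ((moveTail G).bar G.nextToTail) = _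
      rw [edgeClass_bar, ee', neg_neg])
    (fun y h h' => edgeClass_moveTail G h h') (potential_tail G _)
    (fun y hy => potential_face_sub_mem G hy)
  have main := ell_sub_mem_of_potential (moveTail G) Q1 Q2 x
  rw [moveTail_bar, Q3 x hx1 hx2, edgeClass_moveTail G hx1 hx2] at main
  rw [ell_eq G x]
  exact main

/-- The relation at the end of the tail recovers the omitted label from `δ`, itself the label of the
reversed tail, and the label of `prevToTail`. -/
theorem closure_mark_ne_nextToTail : Subgroup.closure
    {m | ∃ x, x ≠ G.nextToTail ∧ x ≠ G.bar G.nextToTail ∧ G.mark x = m} = ⊤ := by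
  set S := {m | ∃ x, x ≠ G.nextToTail ∧ x ≠ G.bar G.nextToTail ∧ G.mark x = m} with hS
  have hin : ∀ x, x ≠ G.nextToTail → x ≠ G.bar G.nextToTail → G.mark x ∈ Subgroup.closure S :=
    fun x h1 h2 => Subgroup.subset_closure ⟨x, h1, h2, rfl⟩
  obtain ⟨n1, n2⟩ := G.nextToTail_ne
  obtain ⟨-, -, a3, a4⟩ := G.isReduced_prevToTail
  have he : G.mark G.nextToTail ∈ Subgroup.closure S := by
    rw [mark_nextToTail]
    refine Subgroup.mul_mem _ ?_ (Subgroup.inv_mem _ (hin _ a3 a4))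
    have h := hin (G.bar G.tail) n2.symm (fun h => n1 (G.bar_inj h).symm)
    rwa [G.geometric] at h
  rw [eq_top_iff, ← G.full_rank, Subgroup.closure_le]
  rintro _ ⟨y, rfl⟩
  by_cases h1 : y = G.nextToTail
  · rw [h1]; exact he
  by_cases h2 : y = G.bar G.nextToTail
  · rw [h2, mark_bar_eq]; exact Subgroup.inv_mem _ he
  exact hin y h1 h2

/-- The first component of the fatgraph Johnson map of a move of the tail vanishes. -/
theorem IsTransition.moveTail_sub_mem (hδ : homClass δ = 0) {θ θ' : π →* That (RatH π)}
    (hθ : IsFatgraphExpansion G θ) (hθ' : IsFatgraphExpansion (moveTail G) θ')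
    {U : That (RatH π) ≃ₐ[ℚ] That (RatH π)} (hU : IsTransition θ θ' U) (h : RatH π) :
    U (inclH h) - inclH h ∈ filtS (RatH π) 3 := by
  have key : (filtS (RatH π) 3).mkQ ∘ₗ (U.toLinearMap - LinearMap.id) ∘ₗ inclH = 0 := by
    refine linearMap_ext_of_closure (closure_mark_ne_nextToTail G) ?_
    rintro _ ⟨x, h1, h2, rfl⟩
    rw [LinearMap.comp_apply, LinearMap.zero_apply, Submodule.mkQ_apply,
      Submodule.Quotient.mk_eq_zero]
    change U (inclH _) - inclH _ ∈ _
    have hm : (moveTail G).mark x = G.mark x := by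
      change whMark G G.nextToTail x = _
      rw [whMark]; simp only [if_neg h1, if_neg h2]
    have e1 := hθ x
    have e2 := hθ' x
    rw [hm] at e2
    -- `U` moves the part of `θ'` of degree at least two only in degree three, so modulo degree
    -- three `U [x] - [x]` is `θ - θ'` at the label. That difference vanishes because `ℓ` keeps its
    -- quadratic part.
    have hz := hU.1.sub_mem 2 _ (hθ'.isMagnusExpansion.one (G.mark x))
    have ht := texp_sub_texp_mem (ell_mem G x) (ell_mem (moveTail G) x)
      (ell_moveTail_sub_mem G hδ h1 h2)
    rw [← e1, ← e2] at ht
    rw [map_sub, map_sub, map_one, hU.2] at hz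
    convert neg_mem (add_mem hz ht) using 1
    abel
  have := LinearMap.congr_fun key h
  rwa [LinearMap.comp_apply, LinearMap.zero_apply, Submodule.mkQ_apply,
    Submodule.Quotient.mk_eq_zero] at this

end MarkedFatgraph

/-! ### Group commutators up to degree three, and absence of degrees one and three. -/

section Commutators

variable {H : Type} [AddCommGroup H] [Module ℚ H]

/-- If the logarithms of `A` and `B` are `u + [u, v] / 2` and `v - [u, v] / 2` up to degree two,
then the group commutator of `A` and `B` is `1 + [u, v]` up to degree three. -/
theorem commutator_sub_mem {u v X Y A' B' : That H} (hu : u ∈ filtS H 1) (hv : v ∈ filtS H 1)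
    (hX : X ∈ filtS H 1) (hY : Y ∈ filtS H 1)
    (hXu : X - (u + halfBracket u v) ∈ filtS H 3) (hYv : Y - (v - halfBracket u v) ∈ filtS H 3)
    (hA : texp X * A' = 1) (hB : texp Y * B' = 1) :
    texp X * texp Y * A' * B' - 1 - (u * v - v * u) ∈ filtS H 4 := by
  set w := halfBracket u v with hw
  have w2 : w ∈ filtS H 2 := Submodule.smul_mem _ _
    (sub_mem (mul_mem_filtS hu hv le_rfl) (mul_mem_filtS hv hu le_rfl))
  have w1 := filtS_anti one_le_two w2
  have uu : u * u ∈ filtS H 2 := mul_mem_filtS hu hu le_rfl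
  have vv : v * v ∈ filtS H 2 := mul_mem_filtS hv hv le_rfl
  have quad : ∀ {Z z c : That H}, Z ∈ filtS H 1 → z ∈ filtS H 1 → c ∈ filtS H 2 →
      Z - (z + c) ∈ filtS H 3 →
      texp Z - 1 - (z + (c + (1 / 2 : ℚ) • (z * z))) ∈ filtS H 3 := by
    intro Z z c hZ hz hc h
    have h1 := texp_sub_quadratic_mem hZ
    have hzc : Z - z ∈ filtS H 2 := by
      have := add_mem (filtS_anti (Nat.le_succ 2) h) hc
      convert this using 1
      abel
    have h2 : Z * Z - z * z ∈ filtS H 3 := by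
      have := add_mem (mul_mem_filtS (r := 3) hzc hZ le_rfl) (mul_mem_filtS (r := 3) hz hzc le_rfl)
      rwa [sub_mul, mul_sub, sub_add_sub_cancel] at this
    have h3 := add_mem (add_mem h1 h) (Submodule.smul_mem _ (1 / 2 : ℚ) h2)
    convert h3 using 1
    rw [smul_sub]
    abel
  have qa := quad hX hu w2 hXu
  have qb := quad hY hv (neg_mem w2) (by rwa [← sub_eq_add_neg])
  obtain ⟨a, ha⟩ : ∃ a, a = texp X - 1 := ⟨_, rfl⟩
  obtain ⟨b, hb⟩ : ∃ b, b = texp Y - 1 := ⟨_, rfl⟩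
  obtain ⟨r, hr⟩ : ∃ r, r = w + (1 / 2 : ℚ) • (u * u) := ⟨_, rfl⟩
  obtain ⟨s, hs⟩ : ∃ s, s = -w + (1 / 2 : ℚ) • (v * v) := ⟨_, rfl⟩
  have r2 : r ∈ filtS H 2 := hr ▸ add_mem w2 (Submodule.smul_mem _ _ uu)
  have s2 : s ∈ filtS H 2 := hs ▸ add_mem (neg_mem w2) (Submodule.smul_mem _ _ vv)
  rw [← ha, ← hr] at qa
  rw [← hb, ← hs] at qb
  have a1 : a ∈ filtS H 1 := ha ▸ texp_sub_one_mem le_rfl hX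
  have b1 : b ∈ filtS H 1 := hb ▸ texp_sub_one_mem le_rfl hY
  have ur1 : u + r ∈ filtS H 1 := add_mem hu (filtS_anti one_le_two r2)
  have vs1 : v + s ∈ filtS H 1 := add_mem hv (filtS_anti one_le_two s2)
  have hab : a * b - (u + r) * (v + s) ∈ filtS H 4 := by
    have := add_mem (mul_mem_filtS (r := 4) qa b1 le_rfl) (mul_mem_filtS (r := 4) ur1 qb le_rfl)
    rwa [sub_mul, mul_sub, sub_add_sub_cancel] at this
  have hba : b * a - (v + s) * (u + r) ∈ filtS H 4 := by
    have := add_mem (mul_mem_filtS (r := 4) qb a1 le_rfl) (mul_mem_filtS (r := 4) vs1 qa le_rfl)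
    rwa [sub_mul, mul_sub, sub_add_sub_cancel] at this
  -- The cubic cancellation: the corrections `w` and `-w` inside `r` and `s` are such that all terms
  -- of degree two and three match, leaving only `r s - s r` of degree four.
  have hcub : (u + r) * (v + s) - (v + s) * (u + r) - (u * v - v * u) * (1 + (u + v)) ∈
      filtS H 4 := by
    have h1 : r * s - s * r ∈ filtS H 4 :=
      sub_mem (mul_mem_filtS r2 s2 le_rfl) (mul_mem_filtS s2 r2 le_rfl)
    convert h1 using 1
    rw [hr, hs, hw, halfBracket]
    simp only [mul_add, add_mul, mul_sub, sub_mul, That.neg_mul, That.mul_neg, smul_mul_assoc,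
      mul_smul_comm, smul_sub, mul_assoc, mul_one]
    module
  have hlow : (u * v - v * u) * (texp Y * texp X - (1 + (u + v))) ∈ filtS H 4 := by
    refine mul_mem_filtS (q := 2) (sub_mem (mul_mem_filtS hu hv le_rfl)
      (mul_mem_filtS hv hu le_rfl)) ?_ le_rfl
    have h1 : b * a ∈ filtS H 2 := mul_mem_filtS b1 a1 le_rfl
    have h2 := add_mem (filtS_anti (Nat.le_succ 2) qa) r2
    have h3 := add_mem (filtS_anti (Nat.le_succ 2) qb) s2
    convert add_mem h1 (add_mem h2 h3) using 1
    rw [ha, hb, sub_mul, mul_sub, one_mul, mul_one]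
    abel
  have hBA : texp Y * texp X * (A' * B') = 1 := by
    rw [mul_assoc, ← mul_assoc (texp X), hA, one_mul, hB]
  -- Writing `A B = (1 + [u,v]) B A` modulo degree four avoids expanding inverses; `A' B'` is
  -- cancelled against `B A` afterwards.
  have hmain : texp X * texp Y - (1 + (u * v - v * u)) * (texp Y * texp X) ∈ filtS H 4 := by
    convert sub_mem (add_mem (sub_mem hab hba) hcub) hlow using 1
    have e : texp X * texp Y - texp Y * texp X = a * b - b * a := by
      rw [ha, hb]; simp only [sub_mul, mul_sub, one_mul, mul_one]; abel
    rw [mul_sub, add_mul, one_mul, ← sub_sub, e]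
    abel
  have := mul_mem_filtS_right (A' * B') hmain
  rw [sub_mul, mul_assoc (1 + _), hBA, mul_one, ← mul_assoc] at this
  rwa [sub_sub]

/-- The components of degree one and three vanish. -/
def NoOddBelowFive (a : That H) : Prop := cf 1 a = 0 ∧ cf 3 a = 0

theorem cf_one_mul (a b : That H) : cf 1 (a * b) = cf 0 a * cf 1 b + cf 1 a * cf 0 b := by
  rw [cf_mul, Finset.Nat.sum_antidiagonal_eq_sum_range_succ_mk]
  simp only [Finset.sum_range_succ, Finset.sum_range_zero, zero_add]

theorem cf_three_mul (a b : That H) : cf 3 (a * b) =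
    cf 0 a * cf 3 b + cf 1 a * cf 2 b + cf 2 a * cf 1 b + cf 3 a * cf 0 b := by
  rw [cf_mul, Finset.Nat.sum_antidiagonal_eq_sum_range_succ_mk]
  simp only [Finset.sum_range_succ, Finset.sum_range_zero, zero_add]

theorem NoOddBelowFive.one : NoOddBelowFive (1 : That H) :=
  ⟨by rw [cf_one, if_neg one_ne_zero], by rw [cf_one, if_neg three_ne_zero]⟩

theorem NoOddBelowFive.mul {a b : That H} (ha : NoOddBelowFive a) (hb : NoOddBelowFive b) :
    NoOddBelowFive (a * b) :=
  ⟨by rw [cf_one_mul, ha.1, hb.1, mul_zero, zero_mul, add_zero],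
    by rw [cf_three_mul, ha.1, hb.1, ha.2, hb.2]; simp⟩

theorem NoOddBelowFive.of_mul_eq_one {a b : That H} (ha : NoOddBelowFive a) (ha0 : cf 0 a = 1)
    (h : a * b = 1) : NoOddBelowFive b := by
  have h1 := cf_one_mul a b
  have h3 := cf_three_mul a b
  rw [h, cf_one, if_neg one_ne_zero, ha.1, ha0, zero_mul, add_zero, one_mul] at h1
  rw [h, cf_one, if_neg three_ne_zero, ha.1, ha.2, ← h1, ha0] at h3
  exact ⟨h1.symm, by simpa using h3.symm⟩

/-- The factor `h` takes degree one, and in any splitting `3 = i + j` one of the two degrees is 1 or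
3. -/
theorem NoOddBelowFive.cf_four_conj {a b : That H} (ha : NoOddBelowFive a) (hb : NoOddBelowFive b)
    (h : H) : cf 4 (a * inclH h * b) = 0 := by
  have key : ∀ n, cf (n + 1) (a * inclH h) = cf n a * TensorAlgebra.ι ℚ h := by
    intro n
    rw [cf_mul, Finset.sum_eq_single (n, 1)]
    · rw [cf_inclH, if_pos rfl]
    · rintro ⟨i, j⟩ hij hne
      rw [cf_inclH, if_neg, mul_zero]
      rintro rfl
      rw [Finset.HasAntidiagonal.mem_antidiagonal] at hij
      exact hne (Prod.ext (by simpa using hij) rfl)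
    · intro hn
      exact (hn (Finset.HasAntidiagonal.mem_antidiagonal (a := (n, 1)) |>.mpr rfl)).elim
  have key0 : cf 0 (a * inclH h) = 0 :=
    mem_filtS.mp (mul_mem_filtS_left a (inclH_mem h)) 0 one_pos
  rw [cf_mul, Finset.Nat.sum_antidiagonal_eq_sum_range_succ_mk]
  simp [Finset.sum_range_succ, key0, key, ha.1, ha.2, hb.1, hb.2]

theorem noOddBelowFive_of_sub_mem {a : That H} {x y : H}
    (h : a - 1 - (inclH x * inclH y - inclH y * inclH x) ∈ filtS H 4) : NoOddBelowFive a := by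
  have h2 : ∀ x y : H, ∀ k ≠ 2, cf k (inclH x * inclH y) = 0 := by
    intro x y k hk
    have hm : TensorAlgebra.ι ℚ x * TensorAlgebra.ι ℚ y ∈ TPow H 2 := by
      rw [TPow, pow_two]
      exact Submodule.mul_mem_mul (LinearMap.mem_range_self _ _) (LinearMap.mem_range_self _ _)
    rw [← toThat_ι, ← toThat_ι, ← map_mul toThat, cf_toThat hm, if_neg hk]
  have key : ∀ k < 4, k ≠ 0 → k ≠ 2 → cf k a = 0 := by
    intro k hk h0 hk2
    have := mem_filtS.mp h k hk
    rwa [map_sub, map_sub, map_sub, h2 x y k hk2, h2 y x k hk2, cf_one, if_neg h0, sub_zero,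
      sub_zero, sub_zero] at this
  exact ⟨key 1 (by norm_num) (by norm_num) (by norm_num),
    key 3 (by norm_num) (by norm_num) (by norm_num)⟩

end Commutators

/-! ### The total Johnson map of a conjugation. -/

section Conjugation

variable {π : Type} [Group π]

theorem IsMagnusExpansion.cf_zero {θ : π →* That (RatH π)} (hθ : IsMagnusExpansion θ) (x : π) :
    cf 0 (θ x) = 1 := by
  have h : θ x - 1 ∈ filtS (RatH π) 1 := hθ.zero x
  rw [cf_eq_of_sub_mem h one_pos, cf_one, if_pos rfl]

/-- The algebra automorphism `a ↦ θ(d)⁻¹ a θ(d)`. -/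
def conjHom (θ : π →* That (RatH π)) (d : π) : That (RatH π) ≃ₐ[ℚ] That (RatH π) :=
  MulSemiringAction.toAlgEquiv ℚ (That (RatH π)) (ConjAct.toConjAct (θ.toHomUnits d⁻¹))

theorem conjHom_apply (θ : π →* That (RatH π)) (d : π) (a : That (RatH π)) :
    conjHom θ d a = θ d⁻¹ * a * θ d := by
  have h := ConjAct.units_smul_def (ConjAct.toConjAct (θ.toHomUnits d⁻¹)) a
  rw [conjHom, MulSemiringAction.toAlgEquiv_apply, h, ConjAct.ofConjAct_toConjAct, ← map_inv,
    inv_inv]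
  rfl

theorem IsMagnusExpansion.isIA_conjHom {θ : π →* That (RatH π)} (hθ : IsMagnusExpansion θ) (d : π) :
    IsIA (conjHom θ d) := by
  have hinv : ∀ a, θ d * conjHom θ d a * θ d⁻¹ = a := fun a => by
    have h : θ d * θ d⁻¹ = 1 := by rw [← map_mul θ, mul_inv_cancel, map_one θ]
    rw [conjHom_apply, ← mul_assoc, ← mul_assoc, h, one_mul, mul_assoc, h, mul_one]
  have hle : ∀ p, ∀ x y : π, ∀ a ∈ filtS (RatH π) p, θ x * a * θ y ∈ filtS (RatH π) p :=
    fun p x y a ha => mul_mem_filtS_right _ (mul_mem_filtS_left _ ha)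
  refine ⟨fun p a => ⟨fun h => ?_, fun h => ?_⟩, fun a ha => ?_⟩
  · rw [← hinv a]; exact hle p _ _ _ h
  · rw [conjHom_apply]; exact hle p _ _ _ h
  · change conjHom θ d a - a ∈ filtS (RatH π) 2
    rw [conjHom_apply]
    have h1 := mul_mem_filtS_right (θ d) (mul_mem_filtS (r := 2) (hθ.zero d⁻¹) ha le_rfl)
    have h2 := mul_mem_filtS (r := 2) ha (hθ.zero d) le_rfl
    convert add_mem h1 h2 using 1
    rw [sub_mul, one_mul, sub_mul, mul_sub, mul_one, sub_add_sub_cancel]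

/-- An explicit transition; uniqueness of transitions will identify it with the total Johnson map of
the boundary twist. -/
theorem IsMagnusExpansion.isTransition_conj {θ : π →* That (RatH π)} (hθ : IsMagnusExpansion θ)
    (d : π) : IsTransition (twist θ (MulAut.conj d⁻¹)) θ (conjHom θ d) := by
  refine ⟨hθ.isIA_conjHom d, fun x => ?_⟩
  rw [conjHom_apply, ← map_mul θ, ← map_mul θ]
  change _ = θ (MulAut.conj d⁻¹ x)
  rw [MulAut.conj_apply, inv_inv]

theorem homClass_conj (d x : π) : homClass (MulAut.conj d x) = homClass x := by
  rw [MulAut.conj_apply, homClass_mul, homClass_mul, homClass_inv, add_neg_cancel_comm]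

theorem IsMagnusExpansion.twist_conj {θ : π →* That (RatH π)} (hθ : IsMagnusExpansion θ) (d : π) :
    IsMagnusExpansion (twist θ (MulAut.conj d)) :=
  ⟨fun x => hθ.zero _, fun x => by
    have := hθ.one (MulAut.conj d x)
    rwa [homClass_conj] at this⟩

end Conjugation

/-! ### The boundary class in the symplectic expansion. -/

section Symplectic

open MarkedFatgraph

variable {n : ℕ}

theorem homClass_genComm (i : Fin (n + 1)) : homClass (genComm i : SurfaceGroup n) = 0 := by
  rw [genComm, homClass_mul, homClass_mul, homClass_mul, homClass_inv, homClass_inv]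
  abel

theorem homClass_boundaryClass : homClass (boundaryClass n) = 0 := by
  refine List.prod_induction (fun x => homClass x = 0) (fun a b ha hb => ?_) homClass_one ?_
  · rw [homClass_mul, ha, hb, add_zero]
  · intro x hx
    obtain ⟨i, rfl⟩ := List.mem_ofFn.mp hx
    exact homClass_genComm i

/-- The path between the two orientations of `x`, and likewise of `y`, has four corners. The one
from `p` to the reverse of `q` joins edges with opposite classes, since the stem is null-homologous,
and contributes nothing. The other three contribute `[u,v]/2` each, and the factor `1/3` leaves one
copy. The signs differ because the cycle meets the reverse of `x` before `x`, but `y` before its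
reverse. -/
theorem symplectic_ell_sub_mem (i : Fin (n + 1)) :
    let G := symplecticFatgraph n
    let u := inclH (homClass (genU i : SurfaceGroup n))
    let v := inclH (homClass (genV i : SurfaceGroup n))
    ell G (.x i, true) - (u + halfBracket u v) ∈ filtS _ 3 ∧
      ell G (.y i, true) - (v - halfBracket u v) ∈ filtS _ 3 := by
  intro G u v
  have hx : edgeClass G (.x i, true) = u := rfl
  have hy : edgeClass G (.y i, true) = v := rfl
  have hx' : edgeClass G (.x i, false) = -u := edgeClass_bar G (.x i, true)
  have hy' : edgeClass G (.y i, false) = -v := edgeClass_bar G (.y i, true)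
  have hp : edgeClass G (.p i, true) = u + v := by
    change inclH (homClass (genU i * genV i)) = _
    rw [homClass_mul, map_add]
  have hp' : edgeClass G (.p i, false) = -(u + v) := by
    rw [← hp]; exact edgeClass_bar G (.p i, true)
  have hq : edgeClass G (.q i, true) = -(u + v) := by
    change inclH (homClass ((genU i)⁻¹ * (genV i)⁻¹)) = _
    rw [homClass_mul, homClass_inv, homClass_inv, ← neg_add, map_neg, map_add]
  have hq' : edgeClass G (.q i, false) = u + v := by
    rw [← neg_neg (u + v), ← hq]; exact edgeClass_bar G (.q i, true)
  have ne : ∀ {e : Edge n × Bool}, e.1 ≠ .c (Fin.last n) → e ≠ G.bar G.tail :=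
    fun h h' => h (congrArg Prod.fst h')
  have f1 := potential_face_sub_mem G (x := (.x i, false)) (ne (by simp))
  have f2 := potential_face_sub_mem G (x := (.y i, true)) (ne (by simp))
  have f3 := potential_face_sub_mem G (x := (.p i, true)) (ne (by simp))
  have f4 := potential_face_sub_mem G (x := (.q i, false)) (ne (by simp))
  have f5 := potential_face_sub_mem G (x := (.x i, true)) (ne (by simp))
  change potential G (ell G) (.y i, true) - potential G (ell G) (.x i, false) -
    halfBracket (edgeClass G (.x i, false)) (edgeClass G (.y i, false)) ∈ _ at f1
  change potential G (ell G) (.p i, true) - potential G (ell G) (.y i, true) -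
    halfBracket (edgeClass G (.y i, true)) (edgeClass G (.p i, false)) ∈ _ at f2
  change potential G (ell G) (.q i, false) - potential G (ell G) (.p i, true) -
    halfBracket (edgeClass G (.p i, true)) (edgeClass G (.q i, true)) ∈ _ at f3
  change potential G (ell G) (.x i, true) - potential G (ell G) (.q i, false) -
    halfBracket (edgeClass G (.q i, false)) (edgeClass G (.x i, false)) ∈ _ at f4
  change potential G (ell G) (.y i, false) - potential G (ell G) (.x i, true) -
    halfBracket (edgeClass G (.x i, true)) (edgeClass G (.y i, true)) ∈ _ at f5
  have b4 : halfBracket (u + v) (-u) = halfBracket u v := by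
    rw [← neg_neg (u + v), halfBracket_neg_neg, halfBracket_neg_add_left]
  rw [hx', hy', halfBracket_neg_neg] at f1
  rw [hy, hp', halfBracket_neg_add_right] at f2
  rw [hp, hq, halfBracket_self_neg, sub_zero] at f3
  rw [hq', hx', b4] at f4
  rw [hx, hy] at f5
  have f23 := add_mem f2 f3
  constructor
  · have := Submodule.smul_mem _ (1 / 3 : ℚ) (add_mem (add_mem f1 f23) f4)
    rw [ell_eq]
    change inclH (homClass (genU i)) + (1 / 3 : ℚ) •
      (potential G (ell G) (.x i, true) - potential G (ell G) (.x i, false)) - _ ∈ _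
    convert this using 1
    module
  · have := Submodule.smul_mem _ (-1 / 3 : ℚ) (add_mem (add_mem f23 f4) f5)
    rw [ell_eq]
    change inclH (homClass (genV i)) + (1 / 3 : ℚ) •
      (potential G (ell G) (.y i, true) - potential G (ell G) (.y i, false)) - _ ∈ _
    convert this using 1
    module

/-- The property is multiplicative, so one commutator is enough. -/
theorem noOddBelowFive_boundaryClass {θ : SurfaceGroup n →* That (RatH (SurfaceGroup n))}
    (hθ : IsFatgraphExpansion (symplecticFatgraph n) θ) : NoOddBelowFive (θ (boundaryClass n)) := by
  refine List.prod_induction (fun x => NoOddBelowFive (θ x)) (fun a b ha hb => ?_) ?_ ?_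
  · rw [map_mul θ]; exact ha.mul hb
  · rw [map_one θ]; exact .one
  · intro x hx
    obtain ⟨i, rfl⟩ := List.mem_ofFn.mp hx
    obtain ⟨h1, h2⟩ := symplectic_ell_sub_mem i
    have hu : θ (genU i) = texp (ell (symplecticFatgraph n) (.x i, true)) := hθ (.x i, true)
    have hv : θ (genV i) = texp (ell (symplecticFatgraph n) (.y i, true)) := hθ (.y i, true)
    have hinv : ∀ x, θ x * θ x⁻¹ = 1 := fun x => by rw [← map_mul θ, mul_inv_cancel, map_one θ]
    have := commutator_sub_mem (inclH_mem _) (inclH_mem _) (ell_mem _ _) (ell_mem _ _) h1 h2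
      (by rw [← hu]; exact hinv _) (by rw [← hv]; exact hinv _)
    rw [← hu, ← hv, ← map_mul θ, ← map_mul θ, ← map_mul θ] at this
    exact noOddBelowFive_of_sub_mem this

theorem johnsonComponent_three_conjHom {θ : SurfaceGroup n →* That (RatH (SurfaceGroup n))}
    (hθ : IsFatgraphExpansion (symplecticFatgraph n) θ) :
    johnsonComponent 3 (conjHom θ (boundaryClass n)) = 0 := by
  have hd := noOddBelowFive_boundaryClass hθ
  have hd' : NoOddBelowFive (θ (boundaryClass n)⁻¹) :=
    hd.of_mul_eq_one (hθ.isMagnusExpansion.cf_zero _)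
      (by rw [← map_mul θ, mul_inv_cancel, map_one θ])
  refine LinearMap.ext fun h => Subtype.ext ?_
  rw [coe_johnsonComponent, map_sub, conjHom_apply, hd'.cf_four_conj hd, cf_inclH,
    if_neg (by norm_num), sub_zero]
  rfl

end Symplectic

namespace MarkedFatgraph

/-! ### Composition along a sequence of moves. -/

section IteratedMoves

variable {E α : Type} {δ : FreeGroup α} {G : MarkedFatgraph E (FreeGroup α) δ}

/-- The third component is additive over a sequence of moves of the tail. -/
theorem exists_isTransition_iterate_moveTail (hG : Presents G) (hδ : homClass δ = 0) (k : ℕ) :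
    ∃ C, IsTransition (magnus G) (magnus (moveTail^[k] G)) C ∧
      (∀ h, C (inclH h) - inclH h ∈ filtS (RatH (FreeGroup α)) 3) ∧
      johnsonComponent 3 C = ∑ i ∈ Finset.range k,
        johnsonComponent 3 (fatgraphJohnson (moveTail^[i] G) (moveTail^[i + 1] G)) := by
  induction k with
  | zero =>
    refine ⟨AlgEquiv.refl, ⟨⟨fun _ _ => Iff.rfl, fun f _ => ?_⟩, fun _ => rfl⟩, fun h => ?_, ?_⟩
    · change f - f ∈ filtS _ 2
      rw [sub_self]; exact Submodule.zero_mem _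
    · rw [AlgEquiv.coe_refl, id, sub_self]; exact Submodule.zero_mem _
    · refine LinearMap.ext fun h => Subtype.ext ?_
      rw [coe_johnsonComponent, AlgEquiv.coe_refl, id, sub_self, map_zero]; rfl
  | succ k ih =>
    obtain ⟨C, hC, hC1, hC3⟩ := ih
    have h := hG.iterate_moveTail k
    have h' := hG.iterate_moveTail (k + 1)
    have hU : IsTransition (magnus (moveTail^[k] G)) (magnus (moveTail^[k + 1] G))
        (fatgraphJohnson (moveTail^[k] G) (moveTail^[k + 1] G)) :=
      isTransition_transition h.isMagnusExpansion h'.isMagnusExpansion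
    have hU1 : ∀ x, fatgraphJohnson (moveTail^[k] G) (moveTail^[k + 1] G) (inclH x) - inclH x ∈
        filtS (RatH (FreeGroup α)) 3 := by
      refine IsTransition.moveTail_sub_mem _ hδ h.isFatgraphExpansion_magnus ?_ hU
      rw [← Function.iterate_succ_apply' moveTail]
      exact h'.isFatgraphExpansion_magnus
    refine ⟨_, hC.comp hU, trans_sub_mem hC.1 hC1 hU1, ?_⟩
    rw [johnsonComponent_three_trans hC.1 hC1 hU1, hC3, Finset.sum_range_succ]

end IteratedMoves

/-- If `G'` is the image of `G` under a mapping class acting trivially on homology, the expansion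
of `G` is that of `G'`, composed with the mapping class. -/
theorem isFatgraphExpansion_twist {E E' π : Type} [Group π] {δ : π} {G : MarkedFatgraph E π δ}
    {G' : MarkedFatgraph E' π δ} {φ : MulAction.stabilizer (MulAut π) δ} (h : Iso G' (act φ G))
    (hφ : ∀ x, homClass (φ.1 x) = homClass x) {θ : π →* That (RatH π)}
    (hθ : IsFatgraphExpansion G' θ) : IsFatgraphExpansion G (twist θ φ.1) := by
  obtain ⟨σ, h1, h2, h3, h4⟩ := h
  intro y
  obtain ⟨x, rfl⟩ := σ.surjective y
  have hmark : φ.1 (G.mark (σ x)) = G'.mark x := h4 x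
  -- Only homology classes of labels enter `ℓ`, and `φ` acts trivially on them, so corresponding
  -- edges have the same logarithm.
  rw [ell_map (G := G') (G' := G) h1 h2 h3 (fun z => by rw [← h4 z]; exact (hφ _).symm) x]
  change θ (φ.1 (G.mark (σ x))) = _
  rw [hmark, hθ x]

end MarkedFatgraph

end FatgraphJohnson

end

open FatgraphJohnson MarkedFatgraph in
theorem mainTheorem11 (n : ℕ) :
    let G : ℕ → MarkedFatgraph (Edge n × Bool) (SurfaceGroup n) (boundaryClass n) :=
      fun i => moveTail^[i] (symplecticFatgraph n)
    let N : ℕ := 12 * n + 6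
    let θ := magnus (G 0)
    let T : MulAut (SurfaceGroup n) := (boundaryTwist n).1
    -- the fatgraph Magnus expansions exist, are unique, and are Magnus expansions
    (∀ i ≤ N, IsMagnusExpansion (magnus (G i)) ∧
      ∀ θ', IsFatgraphExpansion (G i) θ' ↔ θ' = magnus (G i)) ∧
    -- the fatgraph Johnson maps of the moves exist and are unique
    (∀ i < N, ∀ U, IsTransition (magnus (G i)) (magnus (G (i + 1))) U ↔
      U = fatgraphJohnson (G i) (G (i + 1))) ∧
    -- the total Johnson map of the boundary twist exists and is unique
    (∀ U, IsTransition (twist θ T) θ U ↔ U = totalJohnson θ T) ∧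
    -- the moves of the tail once around the fatgraph represent the boundary twist
    Iso (G N) (act (boundaryTwist n) (G 0)) ∧
    -- the third component is the sum of the contributions of the moves, and it vanishes
    johnsonComponent 3 (totalJohnson θ T) =
      ∑ i ∈ Finset.range N, johnsonComponent 3 (fatgraphJohnson (G i) (G (i + 1))) ∧
    johnsonComponent 3 (totalJohnson θ T) = 0 := by
  intro G N θ T
  have hP : ∀ i, Presents (G i) := (presents_symplecticFatgraph n).iterate_moveTail
  have hM : ∀ i, IsMagnusExpansion (magnus (G i)) := fun i => (hP i).isMagnusExpansion
  have hθ : IsMagnusExpansion θ := hM 0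
  have htotal : ∀ U, IsTransition (twist θ T) θ U ↔ U = totalJohnson θ T :=
    fun U => isTransition_iff (hθ.twist_conj _) hθ U
  have hiso : Iso (G N) (act (boundaryTwist n) (G 0)) := iso_symplecticFatgraph_boundaryTwist n
  refine ⟨fun i _ => ⟨hM i, (hP i).isFatgraphExpansion_iff⟩,
    fun i _ U => isTransition_iff (hM i) (hM (i + 1)) U, htotal, hiso, ?_, ?_⟩
  · obtain ⟨C, hC, -, hC3⟩ := exists_isTransition_iterate_moveTail (hP 0)
      homClass_boundaryClass N
    -- The expansion of `G N` precomposed with the twist is a fatgraph expansion of `G 0`, and there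
    -- is only one.
    have hN : twist (magnus (G N)) T = θ :=
      ((hP 0).isFatgraphExpansion_iff _).mp
        (isFatgraphExpansion_twist hiso (homClass_conj _) (hP N).isFatgraphExpansion_magnus)
    -- The composite `C` takes the expansion of `G N` to `θ`. Evaluated at `T x`, this says that `C`
    -- takes `θ` to `θ ∘ T`, so `C` is the total Johnson map.
    have hCT : IsTransition (twist θ T) θ C :=
      ⟨hC.1, fun x => by rw [← hN]; exact (hC.2 (T x)).trans (by rw [hN]; rfl)⟩
    rw [← (htotal C).mp hCT]
    exact hC3
  -- The vanishing does not use the sum: conjugation by `θ` of the boundary class is the total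
  -- Johnson map, and its third component is computed directly.
  · rw [← (htotal _).mp (hθ.isTransition_conj (boundaryClass n))]
    exact johnsonComponent_three_conjHom (hP 0).isFatgraphExpansion_magnus
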